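/- Let $G=(V,E)$ be a tree with $n=|V|$ vertices. Call $U\subseteq V$ a *subtree* if it induces a connected (nonempty) subgraph of $G$. A function $f:2^V\times V\to[0,\infty]$ ($f(U,s)$ is the cost for the sink $s$ to serve $U$) is a *minmax monotone* atomic cost function if: 1. $f(\{s\},s)=0$; $f(U,s)=\infty$ if $U$ is not a subtree or if $s\notin U$; 2. (set monotonicity) $f(U_1,s)\le f(U_2,s)$ whenever $s\in U_1\subseteq U_2$ and $U_1$ is a subtree; 3. (path monotonicity) if $U$ is a subtree, $s\notin U$, and $u\in U$ is adjacent to $s$, then $f(U,u)\le f(U\cup\{s\},s)$; 4. (max tree composition) if $U$ is a subtree, $s\in U$, and $U_1,\dots,U_r$ are the vertex sets of the components left when $s$ is removed from $U$, then $f(U,s)=\max_i f(U_i\cup\{s\},s)$ (which is $0$ if $r=0$). A *sink configuration* is a set $S\subseteq V$ with a partition $\mathcal P=\{P_s\}_{s\in S}$ of $V$ into subtrees such that $S\cap P_s=\{s\}$ for all $s\in S$; its cost is $f(\mathcal P,S)=\max_{s\in S}f(P_s,s)$. The *bounded-cost minmax $k$-sink problem* is: given $G$ (by adjacency lists), an integer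 $k\ge1$ and a real number $\mathcal T\ge0$, output a sink configuration $(S,\mathcal P)$ with $|S|\le k$ and $f(\mathcal P,S)\le\mathcal T$, or output "No" if there is none. The function $f$ is accessible only through an oracle which, given a subtree $U$ (as a list of its vertices) and $s\in U$, returns $f(U,s)$ in time $t_{\mathcal A}(|U|)$. Here $t_{\mathcal A}:\mathbb N\to[0,\infty)$ is *asymptotically subadditive*: it is nondecreasing, $t_{\mathcal A}(n)=\Omega(n)$, $\sum_i t_{\mathcal A}(n_i)=O\bigl(t_{\mathcal A}(\sum_i n_i)\bigr)$ uniformly over finite families of positive integers $n_i$, and $t_{\mathcal A}(n+1)=O(t_{\mathcal A}(n))$. **Theorem 2.** There is a deterministic algorithm, namely a fixed program for a unit-cost random access machine with words of $O(\log(n+k))$ bits, which uses the oracle and otherwise only compares costs with each other and with $\mathcal T$, that solves the bounded-cost minmax $k$-sink problem for every tree $G$, every minmax monotone $f$, every $k\ge1$ and every $\mathcal T\ge0$. For every asymptotically subadditive $t_{\mathcal A}$ its running time, including the time $t_{\mathcal A}(|U|)$ of every oracle query $(U,s)$, is $O\bigl(k\,t_{\mathcal A}(n)\log n\bigr)$.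 That is, there are constants $C$ and $N$, depending only on $t_{\mathcal A}$, such that the running time is at most $C\,k\,t_{\mathcal A}(n)\log n$ for all $n\ge N$, all $k\ge1$ and all inputs. -/

import Mathlib

open scoped ENNReal NNReal

/-! ### Sinks in trees: minmax monotone cost functions -/

section Sinks

variable {V : Type} [Fintype V] [DecidableEq V]

/-- `U` is a subtree of the tree `G`: the graph that `U` induces is connected (in particular `U` is
nonempty). Since `G` is a tree, the induced graph then is a tree. -/
def IsSubtree (G : SimpleGraph V) (U : Finset V) : Prop :=
  (G.induce (U : Set V)).Connected

open Classical in
/-- The slice of `U` at `s` that contains `u`: all vertices that can be reached from `u` by a walk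
that stays inside `U` and avoids `s`. If `u` runs over the neighbours of `s` in `U`, these are the
vertex sets of the trees of the forest that is left when `s` is removed from the subtree `U`. -/
noncomputable def slice (G : SimpleGraph V) (U : Finset V) (s u : V) : Finset V :=
  Finset.univ.filter fun w => ∃ p : G.Walk u w, ∀ x ∈ p.support, x ∈ U ∧ x ≠ s

open Classical in
/-- The neighbours of `s` inside `U`. -/
noncomputable def nbrsIn (G : SimpleGraph V) (U : Finset V) (s : V) : Finset V :=
  U.filter fun u => G.Adj s u

/-- The axioms of an atomic minmax monotone cost function on the tree `G`; `f U s` is the cost for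
the sink `s` to serve all vertices of `U`. The maximum over an empty set of slices is `0`. -/
structure IsMinmaxMonotone (G : SimpleGraph V) (f : Finset V → V → ℝ≥0∞) : Prop where
  /-- a sink serves itself for free -/
  singleton : ∀ s, f {s} s = 0
  /-- only subtrees can be served -/
  not_subtree : ∀ U s, ¬ IsSubtree G U → f U s = ∞
  /-- a sink has to belong to the set that it serves -/
  not_mem : ∀ U s, s ∉ U → f U s = ∞
  /-- set monotonicity -/
  set_mono : ∀ U₁ U₂ s, IsSubtree G U₁ → s ∈ U₁ → U₁ ⊆ U₂ → f U₁ s ≤ f U₂ s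
  /-- path monotonicity: moving the sink out of `U` to an adjacent vertex does not decrease the
  cost -/
  path_mono : ∀ U s u, IsSubtree G U → s ∉ U → u ∈ U → G.Adj s u → f U u ≤ f (insert s U) s
  /-- max tree composition -/
  max_comp : ∀ U s, IsSubtree G U → s ∈ U →
    f U s = (nbrsIn G U s).sup fun u => f (insert s (slice G U s u)) s

/-- `(S, P)` is a sink configuration: the blocks `P s`, `s ∈ S`, form a partition of the vertex set
into subtrees, and `s` is the only element of `S` in the block `P s`. (Values of `P` outside `S` are
irrelevant.) -/
structure IsSinkConfig (G : SimpleGraph V) (S : Finset V) (P : V → Finset V) : Prop where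
  subtree : ∀ s ∈ S, IsSubtree G (P s)
  inter : ∀ s ∈ S, S ∩ P s = {s}
  disjoint : ∀ s ∈ S, ∀ s' ∈ S, s ≠ s' → Disjoint (P s) (P s')
  cover : ∀ v, ∃ s ∈ S, v ∈ P s

/-- The cost of a sink configuration: the maximum of the costs of its blocks. -/
noncomputable def configCost (f : Finset V → V → ℝ≥0∞) (S : Finset V) (P : V → Finset V) : ℝ≥0∞ :=
  S.sup fun s => f (P s) s

/-- `(S, P)` is a sink configuration with at most `k` sinks and with cost at most `T`. -/
def IsFeasible (G : SimpleGraph V) (f : Finset V → V → ℝ≥0∞) (k : ℕ) (T : ℝ≥0)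
    (S : Finset V) (P : V → Finset V) : Prop :=
  IsSinkConfig G S P ∧ S.card ≤ k ∧ configCost f S P ≤ (T : ℝ≥0∞)

end Sinks

/-! ### Asymptotically subadditive running times -/

/-- `t` is asymptotically subadditive: it is a nondecreasing function with `t(n) = Ω(n)`,
`∑ t(nᵢ) = O(t(∑ nᵢ))` uniformly over all finite families of positive integers `nᵢ`, and
`t(n + 1) = O(t(n))`. -/
structure AsymptoticallySubadditive (t : ℕ → ℝ) : Prop where
  nonneg : ∀ n, 0 ≤ t n
  mono : Monotone t
  linear : (fun n : ℕ => (n : ℝ)) =O[Filter.atTop] t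
  subadd : ∃ (C : ℝ) (N : ℕ), ∀ l : List ℕ, (∀ m ∈ l, 0 < m) → N ≤ l.sum →
    (l.map t).sum ≤ C * t l.sum
  succ : (fun n : ℕ => t (n + 1)) =O[Filter.atTop] t

/-! ### A random access machine with an oracle

A program works on word registers, on word arrays (each program names finitely many of both) and on
cost registers, which hold elements of `[0, ∞]`. Costs can only be produced by the oracle and
compared with each other. Words are natural numbers up to a bound `W`. -/

/-- The tests of the machine: comparisons of two word registers, and of two cost registers. -/
inductive Test where
  | lt (x y : ℕ)
  | le (x y : ℕ)
  | eq (x y : ℕ)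
  | ne (x y : ℕ)
  /-- cost register `c` is at most cost register `d` -/
  | costLe (c d : ℕ)

/-- The programs of the machine. Registers and arrays are named by fixed numbers. -/
inductive Prog where
  | skip
  /-- `x := a` for a constant `a` -/
  | const (x a : ℕ)
  /-- `x := y` -/
  | move (x y : ℕ)
  /-- `x := y + z` -/
  | add (x y z : ℕ)
  /-- `x := max (y - z) 0` -/
  | sub (x y z : ℕ)
  /-- `x := ⌊y / 2⌋` -/
  | half (x y : ℕ)
  /-- `x := A[i]`, where `i` is a register -/
  | load (x A i : ℕ)
  /-- `A[i] := x`, where `i` is a register -/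
  | store (A i x : ℕ)
  /-- cost register `c` receives the oracle's answer for the vertices `A[0], …, A[m - 1]` and the
  sink `s`, where `m` and `s` are registers -/
  | query (c A m s : ℕ)
  | seq (p q : Prog)
  | ite (b : Test) (p q : Prog)
  | loop (b : Test) (p : Prog)

/-- The memory of the machine. -/
structure Memory where
  reg : ℕ → ℕ
  arr : ℕ → ℕ → ℕ
  cost : ℕ → ℝ≥0∞

namespace Memory

/-- Write the word `a` into register `x`. -/
def setReg (σ : Memory) (x a : ℕ) : Memory :=
  { σ with reg := Function.update σ.reg x a }

/-- Write the word `a` into cell `i` of array `A`. -/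
def setArr (σ : Memory) (A i a : ℕ) : Memory :=
  { σ with arr := Function.update σ.arr A (Function.update (σ.arr A) i a) }

/-- Write the cost `a` into cost register `c`. -/
def setCost (σ : Memory) (c : ℕ) (a : ℝ≥0∞) : Memory :=
  { σ with cost := Function.update σ.cost c a }

end Memory

/-- The truth of a test. -/
def Test.Holds (σ : Memory) : Test → Prop
  | .lt x y => σ.reg x < σ.reg y
  | .le x y => σ.reg x ≤ σ.reg y
  | .eq x y => σ.reg x = σ.reg y
  | .ne x y => σ.reg x ≠ σ.reg y
  | .costLe c d => σ.cost c ≤ σ.cost d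

/-- `Exec W ask t p σ σ' c`: started in memory `σ`, the program `p` halts in memory `σ'` after time
`c`. Each elementary instruction and each evaluation of a test takes time `1`; in addition, an
oracle query about `m` vertices takes time `t m`. Words are bounded by `W`: an instruction that
would create a larger word cannot be executed, and neither can a query that the oracle does not
answer; then there is no halting computation. -/
inductive Exec (W : ℕ) (ask : List ℕ → ℕ → ℝ≥0∞ → Prop) (t : ℕ → ℝ) :
    Prog → Memory → Memory → ℝ → Prop where
  | skip (σ : Memory) : Exec W ask t .skip σ σ 0
  | const (σ : Memory) (x a : ℕ) (h : a ≤ W) :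
      Exec W ask t (.const x a) σ (σ.setReg x a) 1
  | move (σ : Memory) (x y : ℕ) :
      Exec W ask t (.move x y) σ (σ.setReg x (σ.reg y)) 1
  | add (σ : Memory) (x y z : ℕ) (h : σ.reg y + σ.reg z ≤ W) :
      Exec W ask t (.add x y z) σ (σ.setReg x (σ.reg y + σ.reg z)) 1
  | sub (σ : Memory) (x y z : ℕ) :
      Exec W ask t (.sub x y z) σ (σ.setReg x (σ.reg y - σ.reg z)) 1
  | half (σ : Memory) (x y : ℕ) :
      Exec W ask t (.half x y) σ (σ.setReg x (σ.reg y / 2)) 1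
  | load (σ : Memory) (x A i : ℕ) :
      Exec W ask t (.load x A i) σ (σ.setReg x (σ.arr A (σ.reg i))) 1
  | store (σ : Memory) (A i x : ℕ) :
      Exec W ask t (.store A i x) σ (σ.setArr A (σ.reg i) (σ.reg x)) 1
  | query (σ : Memory) (c A m s : ℕ) (a : ℝ≥0∞)
      (h : ask ((List.range (σ.reg m)).map (σ.arr A)) (σ.reg s) a) :
      Exec W ask t (.query c A m s) σ (σ.setCost c a) (1 + t (σ.reg m))
  | seq (p q : Prog) (σ σ' σ'' : Memory) (c c' : ℝ) (h : Exec W ask t p σ σ' c)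
      (h' : Exec W ask t q σ' σ'' c') : Exec W ask t (.seq p q) σ σ'' (c + c')
  | ite_true (b : Test) (p q : Prog) (σ σ' : Memory) (c : ℝ) (hb : b.Holds σ)
      (h : Exec W ask t p σ σ' c) : Exec W ask t (.ite b p q) σ σ' (1 + c)
  | ite_false (b : Test) (p q : Prog) (σ σ' : Memory) (c : ℝ) (hb : ¬ b.Holds σ)
      (h : Exec W ask t q σ σ' c) : Exec W ask t (.ite b p q) σ σ' (1 + c)
  | loop_done (b : Test) (p : Prog) (σ : Memory) (hb : ¬ b.Holds σ) :
      Exec W ask t (.loop b p) σ σ 1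
  | loop_step (b : Test) (p : Prog) (σ σ' σ'' : Memory) (c c' : ℝ) (hb : b.Holds σ)
      (h : Exec W ask t p σ σ' c) (h' : Exec W ask t (.loop b p) σ' σ'' c') :
      Exec W ask t (.loop b p) σ σ'' (1 + c + c')

/-! ### Input, oracle and output of the bounded cost problem -/

/-- The one-sink oracle for `f`. It answers the query `(U, s)`, where `U` is a subtree that is given
by a list of its vertices without repetition and `s ∈ U`, with `f U s`; it answers nothing else. -/
inductive OneSinkOracle {n : ℕ} (G : SimpleGraph (Fin n)) (f : Finset (Fin n) → Fin n → ℝ≥0∞) :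
    List ℕ → ℕ → ℝ≥0∞ → Prop where
  | answer (l : List (Fin n)) (s : Fin n) (hl : l.Nodup) (hU : IsSubtree G l.toFinset)
      (hs : s ∈ l) : OneSinkOracle G f (l.map Fin.val) s.val (f l.toFinset s)

/-- `adj` contains the adjacency lists of the vertices of `G` one after the other; the list of `u`
fills the cells from `off u` to `off (u + 1) - 1`. -/
structure IsAdjacencyList {n : ℕ} (G : SimpleGraph (Fin n)) (off adj : ℕ → ℕ) : Prop where
  zero : off 0 = 0
  mono : ∀ u : Fin n, off u ≤ off (u + 1)
  lt : ∀ j < off n, adj j < n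
  adj_iff : ∀ u v : Fin n, G.Adj u v ↔ ∃ j, off u ≤ j ∧ j < off (u + 1) ∧ adj j = v
  inj : ∀ (u : Fin n) (i j : ℕ), off u ≤ i → i < off (u + 1) → off u ≤ j → j < off (u + 1) →
    adj i = adj j → i = j

/-- The initial memory: `n` and `k` are in registers `0` and `1`, the offsets and the adjacency
lists in arrays `0` and `1`, the threshold `T` is in cost register `0`; all else is zero. -/
def initialMemory (n k : ℕ) (T : ℝ≥0) (off adj : ℕ → ℕ) : Memory where
  reg x := if x = 0 then n else if x = 1 then k else 0
  arr A i :=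
    if A = 0 then (if i ≤ n then off i else 0)
    else if A = 1 then (if i < off n then adj i else 0)
    else 0
  cost c := if c = 0 then (T : ℝ≥0∞) else 0

/-- The final memory `σ` holds a solution of the bounded cost problem. Either register `0` is `1`
and there is a feasible sink configuration `(S, P)`, which array `2` shows by listing for each
vertex the sink it is assigned to; or register `0` is `0` (the output "No") and there is no feasible
sink configuration. -/
def IsSolution {n : ℕ} (G : SimpleGraph (Fin n)) (f : Finset (Fin n) → Fin n → ℝ≥0∞) (k : ℕ)
    (T : ℝ≥0) (σ : Memory) : Prop :=
  (σ.reg 0 = 1 ∧ ∃ S P, IsFeasible G f k T S P ∧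
    ∀ s ∈ S, ∀ v ∈ P s, σ.arr 2 (v : ℕ) = (s : ℕ)) ∨
  (σ.reg 0 = 0 ∧ ¬ ∃ S P, IsFeasible G f k T S P)

/-!
The algorithm roots the tree and processes the vertices from the leaves to the root, in the reverse
order of a breadth-first search. Its state is a function `fl`: the vertex `s` is a sink if
`fl s ≤ pos s`, and then it may serve those of its ancestors that have position at least `fl s`.
Sinks start with `fl s = 0`; if `s` turns out to be unable to pay for its ancestor `w` and all that
hangs there, it is declared dead above `w` by setting `fl s = pos w + 1`.

Given `fl`, every vertex chooses a sink below it that may serve it (`IsBest`). Optimistically, a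
vertex with such a sink is assigned to it and any other vertex is assigned like its parent
(`IsLab`); only the vertices at positions `≥ j` are processed, the others are sinks of their own.
These blocks partition the vertex set, so by subadditivity asking for the costs of all of them takes
time `O(t n)` (`runs_testProg`). If all blocks for `j = 0` are affordable, they are a sink
configuration, and one with the least possible number of sinks (`IsLab.card_le`). Otherwise a binary
search finds a position `j` such that the blocks for `j + 1` are affordable and those for `j` are
not; then the vertex at position `j` either shows that its chosen sink dies, or has to become a sink
itself (`IsLab.event`). Such a round takes `O(log n)` tests. Each round but the
last increases the number of sinks plus the number of dead sinks by one, and as soon as there are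
more than `k` sinks, the answer is "No". Hence there are at most `2 k + 1` rounds, and the time is
`O(k * t n * log n)`.

The algorithm is right because its sinks always extend to an optimal solution, which is part of the
invariant `GreedyInv`. When `u` becomes a sink (`GreedyInv.place`), what hangs at `u` is too
expensive for the parent of `u`. By the axioms on costs, every solution that uses the sinks placed
so far then has a further sink below `u` (`GreedyInv.exists_sink`); within the subtree of `u` the
solution can be exchanged for the current assignment with the sink `u`, and path monotonicity makes
`u` at least as good for the rest of the tree.

The machine programs are verified by a small program logic: `Prog.wp` treats straight-line code,
and `Runs.loop` treats loops, where a potential pays for the time of the rounds. Everything that a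
program does not write is preserved (`Exec.frame`).
-/

set_option linter.unusedSectionVars false

/-! ### Connected sets of vertices -/

section Subtrees

variable {V : Type} {G : SimpleGraph V}

theorem isSubtree_of_reach {U : Finset V} {s : V} (hs : s ∈ U)
    (h : ∀ x ∈ U, Relation.ReflTransGen (fun a b => G.Adj a b ∧ b ∈ U) x s) : IsSubtree G U := by
  have key : ∀ x, Relation.ReflTransGen (fun a b => G.Adj a b ∧ b ∈ U) x s →
      ∀ hx : x ∈ (U : Set V), (G.induce (U : Set V)).Reachable ⟨x, hx⟩ ⟨s, hs⟩ := by
    intro x hx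
    induction hx using Relation.ReflTransGen.head_induction_on with
    | refl => intro _; exact SimpleGraph.Reachable.refl _
    | head hab _ ih =>
      intro hx
      refine SimpleGraph.Reachable.trans (SimpleGraph.Adj.reachable ?_) (ih hab.2)
      simpa using hab.1
  rw [IsSubtree, SimpleGraph.connected_iff_exists_forall_reachable]
  exact ⟨⟨s, hs⟩, fun w => (key w.1 (h w.1 w.2) w.2).symm⟩

theorem IsSubtree.exists_path {U : Finset V} (h : IsSubtree G U) {x y : V} (hx : x ∈ U)
    (hy : y ∈ U) : ∃ p : G.Walk x y, p.IsPath ∧ ∀ z ∈ p.support, z ∈ U := by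
  classical
  obtain ⟨w⟩ := h.preconnected ⟨x, hx⟩ ⟨y, hy⟩
  let q : G.Walk x y := w.map (SimpleGraph.Embedding.induce (U : Set V)).toHom
  refine ⟨q.bypass, q.bypass_isPath, fun z hz => ?_⟩
  have hz' : z ∈ (w.map (SimpleGraph.Embedding.induce (U : Set V)).toHom).support :=
    q.support_bypass_subset_support hz
  rw [SimpleGraph.Walk.support_map] at hz'
  obtain ⟨a, -, rfl⟩ := List.mem_map.1 hz'
  exact a.2

theorem IsSubtree.reach {U : Finset V} (h : IsSubtree G U) {x y : V} (hx : x ∈ U)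
    (hy : y ∈ U) : Relation.ReflTransGen (fun a b => G.Adj a b ∧ b ∈ U) x y := by
  obtain ⟨p, -, hp⟩ := h.exists_path hx hy
  induction p with
  | nil => exact .refl
  | cons hab p ih =>
    have hb := hp _ (List.mem_cons_of_mem _ p.start_mem_support)
    exact .head ⟨hab, hb⟩ (ih hb hy fun z hz => hp z (List.mem_cons_of_mem _ hz))

theorem IsSubtree.reach_of_subset {U W : Finset V} (h : IsSubtree G U) (hUW : U ⊆ W) {x y : V}
    (hx : x ∈ U) (hy : y ∈ U) : Relation.ReflTransGen (fun a b => G.Adj a b ∧ b ∈ W) x y :=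
  Relation.ReflTransGen.mono (fun _ _ h => ⟨h.1, hUW h.2⟩) _ _ (h.reach hx hy)

theorem IsSubtree.finset_nonempty {U : Finset V} (h : IsSubtree G U) : U.Nonempty := by
  obtain ⟨x⟩ := SimpleGraph.Connected.nonempty h
  exact ⟨x.1, x.2⟩

end Subtrees

/-! ### Consequences of the cost axioms -/

section Cost

variable {V : Type} [Fintype V] [DecidableEq V] {G : SimpleGraph V} {f : Finset V → V → ℝ≥0∞}

theorem IsMinmaxMonotone.isSubtree_of_le (hf : IsMinmaxMonotone G f) {U : Finset V} {s : V}
    {T : ℝ≥0} (h : f U s ≤ T) : IsSubtree G U := by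
  by_contra hU
  rw [hf.not_subtree U s hU] at h
  simp at h

theorem IsMinmaxMonotone.mem_of_le (hf : IsMinmaxMonotone G f) {U : Finset V} {s : V}
    {T : ℝ≥0} (h : f U s ≤ T) : s ∈ U := by
  by_contra hU
  rw [hf.not_mem U s hU] at h
  simp at h

theorem isSubtree_insert_slice {U : Finset V} {s u : V} (hsu : G.Adj s u) :
    IsSubtree G (insert s (slice G U s u)) := by
  classical
  refine isSubtree_of_reach (s := s) (Finset.mem_insert_self _ _) fun x hx => ?_
  rcases Finset.mem_insert.1 hx with rfl | hx
  · exact .refl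
  simp only [slice, Finset.mem_filter, Finset.mem_univ, true_and] at hx
  obtain ⟨p, hp⟩ := hx
  -- every vertex of a walk that witnesses membership in the slice lies in the slice
  have hsl : ∀ z ∈ p.reverse.support, z ∈ insert s (slice G U s u) := by
    intro z hz
    rw [SimpleGraph.Walk.support_reverse, List.mem_reverse] at hz
    refine Finset.mem_insert_of_mem ?_
    simp only [slice, Finset.mem_filter, Finset.mem_univ, true_and]
    exact ⟨p.takeUntil z hz, fun y hy => hp y (p.support_takeUntil_subset_support hz hy)⟩
  have key : ∀ {a b : V} (q : G.Walk a b), (∀ z ∈ q.support, z ∈ insert s (slice G U s u)) →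
      Relation.ReflTransGen (fun a b => G.Adj a b ∧ b ∈ insert s (slice G U s u)) a b := by
    intro a b q hq
    induction q with
    | nil => exact .refl
    | cons hab q ih =>
      exact .head ⟨hab, hq _ (List.mem_cons_of_mem _ q.start_mem_support)⟩
        (ih fun z hz => hq z (List.mem_cons_of_mem _ hz))
  exact (key p.reverse hsl).tail ⟨hsu.symm, Finset.mem_insert_self _ _⟩

/-- Two blocks of the same sink `s` that touch only in `s` can be served together: each slice of the
union lies in one of them. -/
theorem IsMinmaxMonotone.union_le (hf : IsMinmaxMonotone G f) {A B : Finset V} {s : V} {T : ℝ≥0}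
    (hA : f A s ≤ T) (hB : f B s ≤ T)
    (hAB : ∀ a ∈ A, ∀ b ∈ B, a ≠ s → b ≠ s → ¬ G.Adj a b) : f (A ∪ B) s ≤ T := by
  classical
  have hsA := hf.mem_of_le hA
  have hsB := hf.mem_of_le hB
  have hU : IsSubtree G (A ∪ B) := by
    refine isSubtree_of_reach (s := s) (Finset.mem_union_left _ hsA) fun x hx => ?_
    rcases Finset.mem_union.1 hx with hx | hx
    · exact (hf.isSubtree_of_le hA).reach_of_subset Finset.subset_union_left hx hsA
    · exact (hf.isSubtree_of_le hB).reach_of_subset Finset.subset_union_right hx hsB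
  rw [hf.max_comp _ s hU (Finset.mem_union_left _ hsA)]
  refine Finset.sup_le fun u hu => ?_
  simp only [nbrsIn, Finset.mem_filter] at hu
  -- a walk in the union that avoids `s` never changes sides
  have side : ∀ C D : Finset V, (∀ a ∈ C, ∀ b ∈ D, a ≠ s → b ≠ s → ¬ G.Adj a b) →
      u ∈ C → slice G (C ∪ D) s u ⊆ C := by
    intro C D hCD huC w hw
    simp only [slice, Finset.mem_filter, Finset.mem_univ, true_and] at hw
    obtain ⟨p, hp⟩ := hw
    clear hu
    induction p with
    | nil => exact huC
    | cons hab p ih =>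
      have ha := hp _ List.mem_cons_self
      have hb := hp _ (List.mem_cons_of_mem _ p.start_mem_support)
      refine ih ?_ fun z hz => hp z (List.mem_cons_of_mem _ hz)
      rcases Finset.mem_union.1 hb.1 with h | h
      · exact h
      · exact absurd hab (hCD _ huC _ h ha.2 hb.2)
  rcases Finset.mem_union.1 hu.1 with h | h
  · refine (hf.set_mono _ A s (isSubtree_insert_slice hu.2)
      (Finset.mem_insert_self _ _) ?_).trans hA
    exact Finset.insert_subset hsA (side A B hAB h)
  · refine (hf.set_mono _ B s (isSubtree_insert_slice hu.2)
      (Finset.mem_insert_self _ _) ?_).trans hB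
    rw [Finset.union_comm]
    exact Finset.insert_subset hsB
      (side B A (fun a ha b hb has hbs hab => hAB b hb a ha hbs has hab.symm) h)

/-- Path monotonicity along a path that leaves `A` at once. -/
theorem IsMinmaxMonotone.path_le (hf : IsMinmaxMonotone G f) {P : Finset V} {v s : V}
    (p : G.Walk v s) (hp : p.IsPath) (hpP : ∀ z ∈ p.support, z ∈ P) :
    ∀ {A : Finset V}, IsSubtree G A → v ∈ A → A ⊆ P → (∀ z ∈ p.support, z ∈ A → z = v) →
      f A v ≤ f P s := by
  induction p with
  | nil => exact fun {A} hA hv hAP _ => hf.set_mono A P _ hA hv hAP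
  | @cons v v' s hadj p ih =>
    intro A hA hv hAP hz
    rw [SimpleGraph.Walk.cons_isPath_iff] at hp
    have hv'P : v' ∈ P := hpP _ (List.mem_cons_of_mem _ p.start_mem_support)
    have hv' : v' ∉ A := fun h => hadj.ne
      (hz v' (List.mem_cons_of_mem _ p.start_mem_support) h).symm
    have hins : IsSubtree G (insert v' A) := by
      refine isSubtree_of_reach (s := v') (Finset.mem_insert_self _ _) fun x hx => ?_
      rcases Finset.mem_insert.1 hx with rfl | hx
      · exact .refl
      · exact (hA.reach_of_subset (Finset.subset_insert _ _) hx hv).tail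
            ⟨hadj, Finset.mem_insert_self _ _⟩
    refine (hf.path_mono A v' v hA hv' hv hadj.symm).trans
      (ih hp.1 (fun z hz => hpP z (List.mem_cons_of_mem _ hz)) hins (Finset.mem_insert_self _ _)
        (Finset.insert_subset hv'P hAP) fun z hzp hzA => ?_)
    rcases Finset.mem_insert.1 hzA with h | h
    · exact h
    · have := hz z (List.mem_cons_of_mem _ hzp) h
      exact absurd (this ▸ hzp) hp.2

end Cost

/-! ### Rooted trees -/

/-- `G` is the tree that is rooted at `r` and has the parent function `par`; `pos` numbers the
vertices so that parents come before their children. The root is its own parent. -/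
structure IsRooted {V : Type} (G : SimpleGraph V) (r : V) (par : V → V) (pos : V → ℕ) : Prop where
  par_root : par r = r
  adj_iff : ∀ a b, G.Adj a b ↔ (a ≠ r ∧ b = par a) ∨ (b ≠ r ∧ a = par b)
  pos_inj : Function.Injective pos
  pos_par : ∀ v, v ≠ r → pos (par v) < pos v

/-- `Anc r par u x`: the vertex `u` is `x` or a proper ancestor of `x`. -/
def Anc {V : Type} (r : V) (par : V → V) (u x : V) : Prop :=
  Relation.ReflTransGen (fun a b => a ≠ r ∧ b = par a) x u

section Rooted

variable {V : Type} {G : SimpleGraph V} {r : V} {par : V → V} {pos : V → ℕ}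

theorem Anc.refl (u : V) : Anc r par u u := Relation.ReflTransGen.refl

theorem Anc.trans {u v w : V} (h : Anc r par u v) (h' : Anc r par v w) : Anc r par u w :=
  Relation.ReflTransGen.trans h' h

theorem Anc.step {u x : V} (hx : x ≠ r) (h : Anc r par u (par x)) : Anc r par u x :=
  Relation.ReflTransGen.head ⟨hx, rfl⟩ h

theorem Anc.par_self {x : V} (hx : x ≠ r) : Anc r par (par x) x := .step hx (.refl _)

theorem Anc.cases {u x : V} (h : Anc r par u x) : x = u ∨ (x ≠ r ∧ Anc r par u (par x)) := by
  rcases Relation.ReflTransGen.cases_head h with h | ⟨c, ⟨h1, rfl⟩, h2⟩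
  · exact .inl h
  · exact .inr ⟨h1, h2⟩

theorem Anc.par_of_ne {u x : V} (h : Anc r par u x) (hne : x ≠ u) : Anc r par u (par x) :=
  (h.cases.resolve_left hne).2

theorem Anc.total {u w x : V} (h : Anc r par u x) (h' : Anc r par w x) :
    Anc r par u w ∨ Anc r par w u := by
  rcases Relation.ReflTransGen.total_of_right_unique
    (fun a b c hb hc => hb.2.trans hc.2.symm) h h' with h | h
  · exact .inr h
  · exact .inl h

namespace IsRooted

variable (hr : IsRooted G r par pos)
include hr

theorem pos_le {u x : V} (h : Anc r par u x) : pos u ≤ pos x := by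
  induction h using Relation.ReflTransGen.head_induction_on with
  | refl => exact le_rfl
  | head hab _ ih => have := hr.pos_par _ hab.1; rw [← hab.2] at this; omega

theorem eq_of_anc {u x : V} (h : Anc r par u x) (h' : pos x ≤ pos u) : x = u :=
  hr.pos_inj (le_antisymm h' (hr.pos_le h))

theorem pos_lt {u x : V} (h : Anc r par u x) (hne : x ≠ u) : pos u < pos x :=
  lt_of_not_ge fun h' => hne (hr.eq_of_anc h h')

theorem not_anc_par {u : V} (hu : u ≠ r) : ¬ Anc r par u (par u) := fun h => by
  have := hr.pos_le h
  have := hr.pos_par u hu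
  omega

theorem anc_of_le {u w x : V} (h : Anc r par u x) (h' : Anc r par w x) (hle : pos u ≤ pos w) :
    Anc r par u w := by
  rcases h.total h' with h | h
  · exact h
  · rw [hr.eq_of_anc h hle]; exact .refl _

theorem anc_root (x : V) : Anc r par r x := by
  induction hx : pos x using Nat.strong_induction_on generalizing x with
  | _ m ih =>
    by_cases h : x = r
    · rw [h]; exact .refl _
    · exact .step h (ih _ (hx ▸ hr.pos_par x h) _ rfl)

theorem adj_par {x : V} (hx : x ≠ r) : G.Adj x (par x) := (hr.adj_iff _ _).2 (.inl ⟨hx, rfl⟩)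

/-- The only edge that leaves the set of descendants of `u` joins `u` to its parent. -/
theorem eq_of_adj {u a b : V} (ha : Anc r par u a) (hb : ¬ Anc r par u b) (hab : G.Adj a b) :
    a = u ∧ u ≠ r ∧ b = par u := by
  rcases (hr.adj_iff a b).1 hab with ⟨h1, rfl⟩ | ⟨h1, rfl⟩
  · by_cases h : a = u
    · subst h; exact ⟨rfl, h1, rfl⟩
    · exact absurd (ha.par_of_ne h) hb
  · exact absurd (Anc.step h1 ha) hb

/-- A connected set that meets both the descendants of `u` and their complement contains `u` and its
parent. -/
theorem mem_of_crossing {U : Finset V} (hU : IsSubtree G U) {u a b : V} (ha : a ∈ U) (hb : b ∈ U)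
    (hua : Anc r par u a) (hub : ¬ Anc r par u b) : u ∈ U ∧ u ≠ r ∧ par u ∈ U := by
  have h := hU.reach ha hb
  induction h using Relation.ReflTransGen.head_induction_on with
  | refl => exact absurd hua hub
  | @head x y hxy _ ih =>
    by_cases hy : Anc r par u y
    · exact ih hxy.2 hy
    · obtain ⟨rfl, h1, rfl⟩ := hr.eq_of_adj hua hy hxy.1
      exact ⟨ha, h1, hxy.2⟩

/-- A set is connected if it has a top element and contains the parent of each other element. -/
theorem isSubtree_of_top {U : Finset V} {t : V} (ht : t ∈ U)
    (h : ∀ x ∈ U, x ≠ t → x ≠ r ∧ par x ∈ U) : IsSubtree G U := by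
  refine isSubtree_of_reach ht fun x => ?_
  induction hx : pos x using Nat.strong_induction_on generalizing x with
  | _ m ih =>
    intro hxU
    by_cases hxt : x = t
    · rw [hxt]
    · obtain ⟨h1, h2⟩ := h x hxU hxt
      exact .head ⟨hr.adj_par h1, h2⟩ (ih _ (hx ▸ hr.pos_par x h1) _ rfl h2)

theorem exists_top {U : Finset V} (hU : IsSubtree G U) :
    ∃ t ∈ U, ∀ x ∈ U, Anc r par t x ∧ (x ≠ t → x ≠ r ∧ par x ∈ U) := by
  obtain ⟨t, ht, hmin⟩ := U.exists_min_image pos hU.finset_nonempty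
  have hpar : ∀ x ∈ U, x ≠ t → x ≠ r ∧ par x ∈ U := by
    intro x hx hxt
    have := hr.mem_of_crossing hU hx ht (.refl x)
      fun h => hxt (hr.eq_of_anc h (hmin x hx)).symm
    exact this.2
  refine ⟨t, ht, fun x hx => ⟨?_, hpar x hx⟩⟩
  induction hp : pos x using Nat.strong_induction_on generalizing x with
  | _ m ih =>
    by_cases hxt : x = t
    · rw [hxt]; exact .refl _
    · obtain ⟨h1, h2⟩ := hpar x hx hxt
      exact .step h1 (ih _ (hp ▸ hr.pos_par x h1) _ h2 rfl)

theorem isSubtree_filter_anc [DecidableEq V] {U : Finset V} (hU : IsSubtree G U) {u : V}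
    [DecidablePred (Anc r par u)] (hu : u ∈ U) : IsSubtree G (U.filter (Anc r par u)) := by
  obtain ⟨t, ht, h⟩ := hr.exists_top hU
  refine hr.isSubtree_of_top (t := u) (Finset.mem_filter.2 ⟨hu, .refl u⟩) fun x hx hxu => ?_
  rw [Finset.mem_filter] at hx ⊢
  have hxt : x ≠ t := by
    rintro rfl
    exact hxu (hr.eq_of_anc hx.2 (hr.pos_le (h u hu).1))
  exact ⟨((h x hx.1).2 hxt).1, ((h x hx.1).2 hxt).2, hx.2.par_of_ne hxu⟩

theorem isSubtree_filter_not_anc [DecidableEq V] {U : Finset V} (hU : IsSubtree G U) {u s : V}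
    [DecidablePred (Anc r par u)] (hs : s ∈ U) (hus : ¬ Anc r par u s) :
    IsSubtree G (U.filter fun x => ¬ Anc r par u x) := by
  obtain ⟨t, ht, h⟩ := hr.exists_top hU
  refine hr.isSubtree_of_top (t := t)
    (Finset.mem_filter.2 ⟨ht, fun h' => hus (h'.trans (h s hs).1)⟩) fun x hx hxt => ?_
  rw [Finset.mem_filter] at hx ⊢
  exact ⟨((h x hx.1).2 hxt).1, ((h x hx.1).2 hxt).2,
    fun h' => hx.2 (.step ((h x hx.1).2 hxt).1 h')⟩

end IsRooted

end Rooted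

section RootedCost

variable {V : Type} [Fintype V] [DecidableEq V] {G : SimpleGraph V} {f : Finset V → V → ℝ≥0∞}
  {r : V} {par : V → V} {pos : V → ℕ}

/-- If a sink `s` outside the subtree below `u` serves a connected set `D` below `u` with `u ∈ D`,
then the parent of `u` could serve `D` at no greater cost. -/
theorem IsRooted.cost_insert_par_le (hr : IsRooted G r par pos) (hf : IsMinmaxMonotone G f)
    {P D : Finset V} {u s : V} (hP : IsSubtree G P) (hs : s ∈ P) (hus : ¬ Anc r par u s)
    (hD : IsSubtree G D) (hu : u ∈ D) (hDP : D ⊆ P) (hDu : ∀ x ∈ D, Anc r par u x) :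
    f (insert (par u) D) (par u) ≤ f P s := by
  classical
  obtain ⟨-, hur, hv⟩ := hr.mem_of_crossing hP (hDP hu) hs (.refl u) hus
  have hvu := hr.not_anc_par hur
  obtain ⟨p, hp, hpP⟩ := (hr.isSubtree_filter_not_anc hP hs hus).exists_path
    (Finset.mem_filter.2 ⟨hv, hvu⟩) (Finset.mem_filter.2 ⟨hs, hus⟩)
  refine hf.path_le p hp (fun z hz => (Finset.mem_filter.1 (hpP z hz)).1) ?_
    (Finset.mem_insert_self _ _) (Finset.insert_subset hv hDP) fun z hz hzD => ?_
  · refine isSubtree_of_reach (s := par u) (Finset.mem_insert_self _ _) fun x hx => ?_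
    rcases Finset.mem_insert.1 hx with rfl | hx
    · exact .refl
    · exact (hD.reach_of_subset (Finset.subset_insert _ _) hx hu).tail
        ⟨hr.adj_par hur, Finset.mem_insert_self _ _⟩
  · rcases Finset.mem_insert.1 hzD with h | h
    · exact h
    · exact absurd (hDu z h) (Finset.mem_filter.1 (hpP z hz)).2

/-- If a sink `s` below `u` serves `u`, then `u` could serve the part of the block of `s` that is
not below `u` at no greater cost. -/
theorem IsRooted.cost_insert_not_anc_le (hr : IsRooted G r par pos) (hf : IsMinmaxMonotone G f)
    {P : Finset V} {u s : V} [DecidablePred (Anc r par u)] (hP : IsSubtree G P) (hs : s ∈ P)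
    (hus : Anc r par u s) (hu : u ∈ P) :
    f (insert u (P.filter fun x => ¬ Anc r par u x)) u ≤ f P s := by
  classical
  obtain ⟨p, hp, hpP⟩ := (hr.isSubtree_filter_anc hP hu).exists_path
    (Finset.mem_filter.2 ⟨hu, .refl u⟩) (Finset.mem_filter.2 ⟨hs, hus⟩)
  refine hf.path_le p hp (fun z hz => (Finset.mem_filter.1 (hpP z hz)).1) ?_
    (Finset.mem_insert_self _ _) (Finset.insert_subset hu (Finset.filter_subset _ _))
    fun z hz hzD => ?_
  · refine isSubtree_of_reach (s := u) (Finset.mem_insert_self _ _) fun x hx => ?_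
    rcases Finset.mem_insert.1 hx with rfl | hx
    · exact .refl
    have hx' := Finset.mem_filter.1 hx
    obtain ⟨-, hur, hv⟩ := hr.mem_of_crossing hP hu hx'.1 (.refl u) hx'.2
    exact ((hr.isSubtree_filter_not_anc hP hx'.1 hx'.2).reach_of_subset (Finset.subset_insert _ _) hx
      (Finset.mem_filter.2 ⟨hv, hr.not_anc_par hur⟩)).tail
      ⟨(hr.adj_par hur).symm, Finset.mem_insert_self _ _⟩
  · rcases Finset.mem_insert.1 hzD with h | h
    · exact h
    · exact absurd (Finset.mem_filter.1 (hpP z hz)).2 (Finset.mem_filter.1 h).2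

end RootedCost

/-- The parent function of a tree: the parent of a vertex other than `r` is its neighbour that is
nearer to `r`. -/
theorem SimpleGraph.IsTree.exists_parent {V : Type} {G : SimpleGraph V} (hG : G.IsTree) (r : V) :
    ∃ par : V → V, par r = r ∧ (∀ v, v ≠ r → G.dist r (par v) < G.dist r v) ∧
      ∀ a b, G.Adj a b ↔ (a ≠ r ∧ b = par a) ∨ (b ≠ r ∧ a = par b) := by
  classical
  have hex : ∀ v, ∃ p : G.Walk v r, p.IsPath := fun v => (hG.existsUnique_path v r).exists
  choose p hp using hex
  have hlen : ∀ v, (p v).length = G.dist r v := by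
    intro v
    obtain ⟨q, hq, hl⟩ := hG.connected.exists_path_of_dist v r
    rw [SimpleGraph.dist_comm, ← hl, (hG.existsUnique_path v r).unique (hp v) hq]
  have hcons : ∀ a b, G.Adj a b → G.dist r a < G.dist r b → b ≠ r ∧ a = (p b).snd := by
    intro a b hab hlt
    have hbr : b ≠ r := by rintro rfl; simp at hlt
    refine ⟨hbr, ?_⟩
    have hq : (SimpleGraph.Walk.cons hab.symm (p a)).IsPath := by
      rw [SimpleGraph.Walk.cons_isPath_iff]
      refine ⟨hp a, fun hb => ?_⟩
      have h1 := ((p a).takeUntil b hb)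
      have h2 := (p a).length_dropUntil_le_length hb
      have h3 := SimpleGraph.dist_le ((p a).dropUntil b hb)
      rw [SimpleGraph.dist_comm] at h3
      rw [hlen] at h2
      omega
    rw [(hG.existsUnique_path b r).unique (hp b) hq]
    simp
  have hsnd : ∀ v, v ≠ r → G.Adj v (p v).snd ∧ G.dist r (p v).snd < G.dist r v := by
    intro v hv
    have hnil : ¬ (p v).Nil := SimpleGraph.Walk.not_nil_of_ne hv
    refine ⟨SimpleGraph.Walk.adj_snd hnil, ?_⟩
    have h3 := SimpleGraph.dist_le (p v).tail
    rw [SimpleGraph.dist_comm] at h3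
    have h4 := SimpleGraph.Walk.length_tail_add_one hnil
    rw [hlen] at h4
    omega
  refine ⟨fun v => if v = r then r else (p v).snd, by simp, fun v hv => ?_, fun a b => ⟨?_, ?_⟩⟩
  · simpa [hv] using (hsnd v hv).2
  · intro hab
    rcases lt_or_gt_of_ne (hG.dist_ne_of_adj r hab) with h | h
    · have := hcons a b hab h
      exact .inr ⟨this.1, by simpa [this.1] using this.2⟩
    · have := hcons b a hab.symm h
      exact .inl ⟨this.1, by simpa [this.1] using this.2⟩
  · rintro (⟨h, rfl⟩ | ⟨h, rfl⟩)
    · simpa [h] using (hsnd a h).1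
    · simpa [h] using (hsnd b h).1.symm

/-! ### Hanging sets, chains and labels -/

section Greedy

variable {V : Type} [Fintype V] [DecidableEq V] {G : SimpleGraph V} {r : V} {par : V → V}
  {pos : V → ℕ}

open Classical in
/-- The vertices that hang at `w` when the vertices in `H` are served: `w` itself, and all
descendants of `w` from which one climbs to `w` through vertices outside `H` (the end `w` excepted).
Whoever serves `w` has to serve all of them, unless new sinks are placed. -/
noncomputable def hang (r : V) (par : V → V) (H : V → Prop) (w : V) : Finset V :=
  Finset.univ.filter fun x => Relation.ReflTransGen (fun a b => a ≠ r ∧ ¬ H a ∧ b = par a) x w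

open Classical in
/-- The block that the sink `s` serves if it serves all vertices on the way up to its ancestor `w`
and everything that hangs at these. -/
noncomputable def chain (r : V) (par : V → V) (H : V → Prop) (s w : V) : Finset V :=
  Finset.univ.filter fun x => ∃ y, Anc r par y s ∧ Anc r par w y ∧ x ∈ hang r par H y

/-- The state of the greedy algorithm is a function `fl`: the vertex `s` is a sink if
`fl s ≤ pos s`, and then it may serve its ancestors `w` with `fl s ≤ pos w`. -/
def Served (r : V) (par : V → V) (pos fl : V → ℕ) (w : V) : Prop :=
  ∃ s, Anc r par w s ∧ fl s ≤ pos w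

/-- `b` picks for each vertex `p` a sink below `p` that may serve `p` and reaches highest, if there
is one. The conditions are local: `b p` is `p` or the choice of a child. -/
structure IsBest (r : V) (par : V → V) (pos fl : V → ℕ) (b : V → V) : Prop where
  choice : ∀ p, b p = p ∨ ∃ c, c ≠ r ∧ par c = p ∧ b p = b c ∧ fl (b c) ≤ pos p
  le_self : ∀ p, fl (b p) ≤ fl p
  le_child : ∀ c, c ≠ r → fl (b c) ≤ pos (par c) → fl (b (par c)) ≤ fl (b c)

/-- The assignment of the vertices to sinks after the vertices `w` with `j ≤ pos w` have been
processed: a vertex that is not processed is a sink of its own, a served vertex is assigned to the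
chosen sink, and any other vertex is assigned like its parent. -/
def IsLab (r : V) (par : V → V) (pos fl : V → ℕ) (b : V → V) (j : ℕ) (lab : V → V) : Prop :=
  ∀ w, lab w = if pos w < j then w else if fl (b w) ≤ pos w then b w else
    if w = r then r else lab (par w)

/-- The set of vertices that `own` assigns to `s`. -/
def fiber (own : V → V) (s : V) : Finset V :=
  Finset.univ.filter fun x => own x = s

/-- All blocks of the assignment `own` of vertices to sinks cost at most `T`. As costs of
disconnected sets and of sinks outside of their sets are infinite, this makes the blocks a sink
configuration. -/
def Affordable (f : Finset V → V → ℝ≥0∞) (T : ℝ≥0) (own : V → V) : Prop :=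
  ∀ w, f (fiber own (own w)) (own w) ≤ T

@[simp] theorem mem_fiber {own : V → V} {s x : V} : x ∈ fiber own s ↔ own x = s := by
  simp [fiber]

theorem mem_chain {H : V → Prop} {s w x : V} : x ∈ chain r par H s w ↔
    ∃ y, Anc r par y s ∧ Anc r par w y ∧ x ∈ hang r par H y := by
  simp [chain]

theorem hang_self (H : V → Prop) (w : V) : w ∈ hang r par H w := by
  simp [hang, Relation.ReflTransGen.refl]

theorem hang_cases {H : V → Prop} {w x : V} (h : x ∈ hang r par H w) :
    x = w ∨ (x ≠ r ∧ ¬ H x ∧ par x ∈ hang r par H w) := by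
  simp only [hang, Finset.mem_filter, Finset.mem_univ, true_and] at h ⊢
  rcases Relation.ReflTransGen.cases_head h with h | ⟨c, ⟨h1, h2, rfl⟩, h3⟩
  · exact .inl h
  · exact .inr ⟨h1, h2, h3⟩

theorem hang_step {H : V → Prop} {w x : V} (hx : x ≠ r) (hH : ¬ H x)
    (h : par x ∈ hang r par H w) : x ∈ hang r par H w := by
  simp only [hang, Finset.mem_filter, Finset.mem_univ, true_and] at h ⊢
  exact .head ⟨hx, hH, rfl⟩ h

theorem chain_subset {H : V → Prop} {s w w' : V} (h : Anc r par w' w) :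
    chain r par H s w ⊆ chain r par H s w' := fun x hx => by
  rw [mem_chain] at hx ⊢
  obtain ⟨y, h1, h2, h3⟩ := hx
  exact ⟨y, h1, h.trans h2, h3⟩

theorem chain_step {H : V → Prop} {s w x : V} (hx : x ≠ r) (hH : ¬ H x)
    (h : par x ∈ chain r par H s w) : x ∈ chain r par H s w := by
  rw [mem_chain] at h ⊢
  obtain ⟨y, h1, h2, h3⟩ := h
  exact ⟨y, h1, h2, hang_step hx hH h3⟩

theorem mem_chain_of_anc {H : V → Prop} {s w x : V} (h1 : Anc r par x s) (h2 : Anc r par w x) :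
    x ∈ chain r par H s w := mem_chain.2 ⟨x, h1, h2, hang_self H x⟩

namespace IsRooted

variable (hr : IsRooted G r par pos)
include hr

theorem down_induction {C : V → Prop} (h : ∀ x, (∀ y, pos x < pos y → C y) → C x) (x : V) :
    C x := by
  induction hx : Finset.univ.sup pos - pos x using Nat.strong_induction_on generalizing x with
  | _ m ih =>
    refine h x fun y hy => ih _ ?_ y rfl
    have h1 : pos y ≤ Finset.univ.sup pos := Finset.le_sup (Finset.mem_univ y)
    omega

theorem up_induction {C : V → Prop} (h : ∀ x, (x ≠ r → C (par x)) → C x) (x : V) : C x := by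
  induction hx : pos x using Nat.strong_induction_on generalizing x with
  | _ m ih => exact h x fun hxr => ih _ (hx ▸ hr.pos_par x hxr) _ rfl

theorem anc_of_mem_hang {H : V → Prop} {w x : V} (h : x ∈ hang r par H w) : Anc r par w x := by
  induction x using hr.up_induction with
  | h x ih =>
    rcases hang_cases h with rfl | ⟨h1, -, h3⟩
    · exact .refl _
    · exact .step h1 (ih h1 h3)

theorem hang_congr {H H' : V → Prop} {w : V} (h : ∀ a, pos w < pos a → (H a ↔ H' a)) :
    hang r par H w = hang r par H' w := by
  have key : ∀ {H H' : V → Prop}, (∀ a, pos w < pos a → (H a ↔ H' a)) →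
      ∀ x, x ∈ hang r par H w → x ∈ hang r par H' w := by
    intro H H' h x hx
    induction x using hr.up_induction with
    | h x ih =>
      rcases hang_cases hx with rfl | ⟨h1, h2, h3⟩
      · exact hang_self _ _
      · have := hr.pos_le (hr.anc_of_mem_hang h3)
        have := hr.pos_par x h1
        exact hang_step h1 (fun hH => h2 ((h x (by omega)).2 hH)) (ih h1 h3)
  exact Finset.Subset.antisymm (key h) (key fun a ha => (h a ha).symm)

theorem chain_congr {H H' : V → Prop} {s w : V} (h : ∀ a, pos w < pos a → (H a ↔ H' a)) :
    chain r par H s w = chain r par H' s w := by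
  ext x
  rw [mem_chain, mem_chain]
  refine exists_congr fun y => and_congr_right fun _ => and_congr_right fun hy => ?_
  rw [hr.hang_congr fun a ha => h a ((hr.pos_le hy).trans_lt ha)]

theorem isSubtree_hang (H : V → Prop) (w : V) : IsSubtree G (hang r par H w) :=
  hr.isSubtree_of_top (hang_self H w) fun _ hx hxw =>
    ⟨((hang_cases hx).resolve_left hxw).1, ((hang_cases hx).resolve_left hxw).2.2⟩

theorem isSubtree_chain (H : V → Prop) {s w : V} (h : Anc r par w s) :
    IsSubtree G (chain r par H s w) := by
  refine hr.isSubtree_of_top (mem_chain_of_anc h (.refl w)) fun x hx hxw => ?_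
  obtain ⟨y, h1, h2, h3⟩ := mem_chain.1 hx
  rcases hang_cases h3 with rfl | ⟨h4, -, h5⟩
  · obtain ⟨h4, h5⟩ := h2.cases.resolve_left hxw
    exact ⟨h4, mem_chain_of_anc ((Anc.par_self h4).trans h1) h5⟩
  · exact ⟨h4, mem_chain.2 ⟨y, h1, h2, h5⟩⟩

theorem cost_chain_le {f : Finset V → V → ℝ≥0∞} (hf : IsMinmaxMonotone G f) (H : V → Prop)
    {s w w' : V} (h : Anc r par w s) (h' : Anc r par w' w) :
    f (chain r par H s w) s ≤ f (chain r par H s w') s :=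
  hf.set_mono _ _ _ (hr.isSubtree_chain H h) (mem_chain_of_anc (.refl s) h) (chain_subset h')

end IsRooted

section Best

variable (hr : IsRooted G r par pos) {fl : V → ℕ} {b : V → V} (hb : IsBest r par pos fl b)
include hr hb

theorem IsBest.anc (w : V) : Anc r par w (b w) := by
  induction w using hr.down_induction with
  | h w ih =>
    rcases hb.choice w with h | ⟨c, hc, rfl, h, -⟩
    · rw [h]; exact .refl w
    · rw [h]; exact (Anc.par_self hc).trans (ih c (hr.pos_par c hc))

theorem IsBest.le {w s : V} (h : Anc r par w s) (hs : fl s ≤ pos w) : fl (b w) ≤ fl s := by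
  induction h with
  | refl => exact hb.le_self s
  | @tail c _ hc hcw ih =>
    obtain ⟨h1, rfl⟩ := hcw
    have := ih (hs.trans (hr.pos_par c h1).le)
    exact (hb.le_child c h1 (this.trans hs)).trans this

theorem IsBest.served_iff (w : V) : Served r par pos fl w ↔ fl (b w) ≤ pos w :=
  ⟨fun ⟨_, h, hs⟩ => (hb.le hr h hs).trans hs, fun h => ⟨b w, hb.anc hr w, h⟩⟩

theorem IsBest.exists_child {w : V} (hw : fl (b w) ≤ pos w) (hne : b w ≠ w) :
    ∃ c, c ≠ r ∧ par c = w ∧ b c = b w ∧ fl (b c) ≤ pos c := by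
  obtain ⟨c, hc, rfl, h, hle⟩ := (hb.choice w).resolve_left hne
  exact ⟨c, hc, rfl, h.symm, hle.trans (hr.pos_par c hc).le⟩

/-- The choice does not change on the way from a served vertex down to its chosen sink. -/
theorem IsBest.eq_of_between {w y : V} (hw : fl (b w) ≤ pos w) (h1 : Anc r par w y)
    (h2 : Anc r par y (b w)) : b y = b w := by
  induction w using hr.down_induction with
  | h w ih =>
    by_cases hyw : y = w
    · rw [hyw]
    have hne : b w ≠ w := fun h => hyw (hr.eq_of_anc h1 (hr.pos_le (h ▸ h2)))
    obtain ⟨c, hc, rfl, hbc, hle⟩ := hb.exists_child hr hw hne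
    have hcs : Anc r par c (b (par c)) := hbc ▸ hb.anc hr c
    rw [← hbc] at h2 hcs ⊢
    refine ih c (hr.pos_par c hc) hle ?_ h2
    rcases hcs.total h2 with h | h
    · exact h
    by_cases hcy : c = y
    · rw [hcy]; exact .refl _
    · exact absurd (hr.eq_of_anc h1 (hr.pos_le (h.par_of_ne hcy))) hyw

end Best

/-! ### The assignment -/

section Lab

variable (hr : IsRooted G r par pos) {fl : V → ℕ} {b : V → V} (hb : IsBest r par pos fl b)
  {j : ℕ} {lab : V → V} (hl : IsLab r par pos fl b j lab)

include hl

theorem IsLab.of_lt {w : V} (hw : pos w < j) : lab w = w := by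
  rw [hl w, if_pos hw]

theorem IsLab.of_served {w : V} (hw : j ≤ pos w) (h : fl (b w) ≤ pos w) : lab w = b w := by
  rw [hl w, if_neg hw.not_gt, if_pos h]

theorem IsLab.of_not_served {w : V} (hw : j ≤ pos w) (h : ¬ fl (b w) ≤ pos w) (hwr : w ≠ r) :
    lab w = lab (par w) := by
  rw [hl w, if_neg hw.not_gt, if_neg h, if_neg hwr]

theorem IsLab.of_root (hw : j ≤ pos r) (h : ¬ fl (b r) ≤ pos r) : lab r = r := by
  rw [hl r, if_neg hw.not_gt, if_neg h, if_pos rfl]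

include hr hb

/-- A sink has no other sink below it that may serve it. -/
theorem IsLab.idem (hsole : ∀ q s, fl q ≤ pos q → Anc r par q s → fl s ≤ pos q → s = q) (w : V) :
    lab (lab w) = lab w := by
  induction w using hr.up_induction with
  | h w ih =>
    rcases lt_or_ge (pos w) j with hw | hw
    · rw [hl.of_lt hw, hl.of_lt hw]
    by_cases h : fl (b w) ≤ pos w
    · rw [hl.of_served hw h]
      have h1 := hr.pos_le (hb.anc hr w)
      have h2 : b (b w) = b w := hb.eq_of_between hr h (hb.anc hr w) (.refl _)
      rw [hl.of_served (hw.trans h1) (by rw [h2]; exact h.trans h1), h2]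
    by_cases hwr : w = r
    · subst hwr
      rw [hl.of_root hw h, hl.of_root hw h]
    · rw [hl.of_not_served hw h hwr]
      exact ih hwr

theorem IsLab.isSubtree (hsole : ∀ q s, fl q ≤ pos q → Anc r par q s → fl s ≤ pos q → s = q)
    (w : V) : IsSubtree G (fiber lab (lab w)) := by
  refine isSubtree_of_reach (s := lab w) (by simpa using hl.idem hr hb hsole w) fun x hx => ?_
  rw [mem_fiber] at hx
  have down : ∀ x, j ≤ pos x → fl (b x) ≤ pos x → Relation.ReflTransGen
      (fun a c => G.Adj a c ∧ c ∈ fiber lab (b x)) x (b x) := by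
    intro x
    induction x using hr.down_induction with
    | h x ih =>
      intro hx h
      by_cases hne : b x = x
      · rw [hne]
      obtain ⟨c, hc, rfl, hbc, hle⟩ := hb.exists_child hr h hne
      have hjc := hx.trans (hr.pos_par c hc).le
      rw [← hbc]
      exact .head ⟨(hr.adj_par hc).symm, by rw [mem_fiber, hl.of_served hjc hle]⟩
        (ih c (hr.pos_par c hc) hjc hle)
  rw [← hx]
  clear hx
  induction x using hr.up_induction with
  | h x ih =>
    rcases lt_or_ge (pos x) j with hx | hx
    · rw [hl.of_lt hx]
    by_cases h : fl (b x) ≤ pos x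
    · rw [hl.of_served hx h]; exact down x hx h
    by_cases hxr : x = r
    · subst hxr
      rw [hl.of_root hx h]
    · rw [hl.of_not_served hx h hxr]
      exact .head ⟨hr.adj_par hxr, by rw [mem_fiber]⟩ (ih hxr)

theorem IsLab.hang_subset {w : V} (hw : j ≤ pos w + 1) {x : V}
    (hx : x ∈ hang r par (Served r par pos fl) w) : lab x = lab w := by
  induction x using hr.up_induction with
  | h x ih =>
    rcases hang_cases hx with rfl | ⟨h1, h2, h3⟩
    · rfl
    · have := hr.pos_le (hr.anc_of_mem_hang h3)
      have := hr.pos_par x h1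
      rw [hb.served_iff hr] at h2
      rw [hl.of_not_served (by omega) h2 h1]
      exact ih h1 h3

theorem IsLab.chain_subset {w : V} (hw : j ≤ pos w) (h : fl (b w) ≤ pos w) :
    chain r par (Served r par pos fl) (b w) w ⊆ fiber lab (b w) := by
  intro x hx
  obtain ⟨y, h1, h2, h3⟩ := mem_chain.1 hx
  have hy := hr.pos_le h2
  have hby := hb.eq_of_between hr h h2 h1
  rw [mem_fiber, hl.hang_subset hr hb (by omega) h3, hl.of_served (hw.trans hy)
    (by rw [hby]; exact h.trans hy), hby]

theorem IsLab.mem_hang {u x : V} (hu : pos u < j) (hx : lab x = u) :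
    x ∈ hang r par (Served r par pos fl) u := by
  induction x using hr.up_induction with
  | h x ih =>
    rcases lt_or_ge (pos x) j with hxj | hxj
    · rw [hl.of_lt hxj] at hx; rw [hx]; exact hang_self _ _
    by_cases h : fl (b x) ≤ pos x
    · rw [hl.of_served hxj h] at hx
      have := hr.pos_le (hb.anc hr x)
      rw [hx] at this
      omega
    by_cases hxr : x = r
    · subst hxr
      rw [hl.of_root hxj h] at hx; rw [hx]; exact hang_self _ _
    · rw [hl.of_not_served hxj h hxr] at hx
      exact hang_step hxr (by rwa [hb.served_iff hr]) (ih hxr hx)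

theorem IsLab.mem_chain {u x : V} (hu : j = pos u) (h : fl (b u) ≤ pos u) (hx : lab x = b u) :
    x ∈ chain r par (Served r par pos fl) (b u) u := by
  have hbu := hr.pos_le (hb.anc hr u)
  induction x using hr.up_induction with
  | h x ih =>
    rcases lt_or_ge (pos x) j with hxj | hxj
    · rw [hl.of_lt hxj] at hx
      rw [hx] at hxj
      omega
    by_cases hs : fl (b x) ≤ pos x
    · rw [hl.of_served hxj hs] at hx
      have hxs : Anc r par x (b u) := hx ▸ hb.anc hr x
      exact mem_chain_of_anc hxs (hr.anc_of_le (hb.anc hr u) hxs (by omega))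
    by_cases hxr : x = r
    · rw [hxr] at hs hxj hx
      rw [hl.of_root hxj hs] at hx
      rw [← hx] at hbu
      have : u = r := hr.eq_of_anc (hr.anc_root u) hbu
      rw [this] at h
      exact absurd h hs
    · rw [hl.of_not_served hxj hs hxr] at hx
      exact chain_step hxr (by rwa [hb.served_iff hr]) (ih hxr hx)

/-- The sink of a vertex that is not served from below is not below it. -/
theorem IsLab.not_anc {w : V} (hw : j ≤ pos w) (h : ¬ fl (b w) ≤ pos w) (hwr : w ≠ r) :
    ¬ Anc r par w (lab w) := by
  induction w using hr.up_induction with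
  | h w ih =>
    rw [hl.of_not_served hw h hwr]
    intro hanc
    rcases lt_or_ge (pos (par w)) j with hp | hp
    · rw [hl.of_lt hp] at hanc
      exact hr.not_anc_par hwr hanc
    by_cases hs : fl (b (par w)) ≤ pos (par w)
    · rw [hl.of_served hp hs] at hanc
      have := hb.eq_of_between hr hs (Anc.par_self hwr) hanc
      exact h (by rw [this]; exact hs.trans (hr.pos_par w hwr).le)
    by_cases hpr : par w = r
    · rw [hpr] at hp hs hanc
      rw [hl.of_root hp hs] at hanc
      exact hr.not_anc_par hwr (by rwa [hpr])
    · exact ih hwr hp hs hpr ((Anc.par_self hwr).trans hanc)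

/-- Processing one more vertex `u` merges the block of `u` into another block. -/
theorem IsLab.eq_ite {lab' : V → V} {u : V} (hl' : IsLab r par pos fl b (pos u + 1) lab')
    (hu : j = pos u) (w : V) : lab w = if lab' w = u then lab u else lab' w := by
  induction w using hr.up_induction with
  | h w ih =>
    rcases lt_trichotomy (pos w) (pos u) with hw | hw | hw
    · have : w ≠ u := by rintro rfl; exact lt_irrefl _ hw
      rw [hl.of_lt (by omega), hl'.of_lt (by omega), if_neg this]
    · rw [hr.pos_inj hw, hl'.of_lt (by omega), if_pos rfl]
    by_cases h : fl (b w) ≤ pos w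
    · have h1 := hr.pos_le (hb.anc hr w)
      have : b w ≠ u := by intro h2; rw [h2] at h1; omega
      rw [hl.of_served (by omega) h, hl'.of_served (by omega) h, if_neg this]
    by_cases hwr : w = r
    · have := hr.pos_le (hr.anc_root u)
      rw [hwr] at hw
      omega
    · rw [hl.of_not_served (by omega) h hwr, hl'.of_not_served (by omega) h hwr]
      exact ih hwr

end Lab

end Greedy

/-! ### The invariant of the greedy algorithm -/

section Invariant

variable {V : Type} [Fintype V] [DecidableEq V] {G : SimpleGraph V} {f : Finset V → V → ℝ≥0∞}
  {r : V} {par : V → V} {pos : V → ℕ} {T : ℝ≥0}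

/-- The decision made at `y` is right: if `y` is served, then some sink below can afford it, and
otherwise the parent of `y` can afford what hangs at `y`. -/
def Settled (r : V) (par : V → V) (pos : V → ℕ) (f : Finset V → V → ℝ≥0∞) (T : ℝ≥0) (fl : V → ℕ)
    (y : V) : Prop :=
  (Served r par pos fl y → ∃ s, Anc r par y s ∧ fl s ≤ pos y ∧
    f (chain r par (Served r par pos fl) s y) s ≤ T) ∧
  (¬ Served r par pos fl y → y ≠ r →
    f (insert (par y) (hang r par (Served r par pos fl) y)) (par y) ≤ T)

/-- The invariant of the greedy algorithm. A sink `s` with `fl s = 0` is alive; otherwise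
`fl s = pos w + 1` for an ancestor `w` of `s`, the lowest one that `s` cannot afford to serve. -/
structure GreedyInv (G : SimpleGraph V) (r : V) (par : V → V) (pos : V → ℕ)
    (f : Finset V → V → ℝ≥0∞) (T : ℝ≥0) (fl : V → ℕ) : Prop where
  /-- a sink cannot be served by another sink below it -/
  sole : ∀ q s, fl q ≤ pos q → Anc r par q s → fl s ≤ pos q → s = q
  dead : ∀ s, fl s ≤ pos s → fl s ≠ 0 → ∃ w, fl s = pos w + 1 ∧ Anc r par w s ∧
    (T : ℝ≥0∞) < f (chain r par (Served r par pos fl) s w) s ∧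
    ∀ y, Anc r par y s → Anc r par w y → y ≠ w →
      f (chain r par (Served r par pos fl) s y) s ≤ T
  /-- above the frontier `F`, all decisions are final -/
  settled : ∃ F, (∀ s, fl s ≤ pos s → F ≤ pos s) ∧ (∀ s, fl s ≤ pos s → fl s ≠ 0 → F < fl s) ∧
    ∀ y, F < pos y → Settled r par pos f T fl y
  /-- the sinks are contained in some optimal set of sinks -/
  extends_opt : ∀ k, (∃ S P, IsFeasible G f k T S P) → ∃ own : V → V, Affordable f T own ∧
    (Finset.univ.image own).card ≤ k ∧ ∀ q, fl q ≤ pos q → own q = q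

theorem Affordable.idem (hf : IsMinmaxMonotone G f) {own : V → V} (h : Affordable f T own) (w : V) :
    own (own w) = own w := by
  simpa using hf.mem_of_le (h w)

theorem Affordable.isSubtree (hf : IsMinmaxMonotone G f) {own : V → V} (h : Affordable f T own)
    (w : V) : IsSubtree G (fiber own (own w)) :=
  hf.isSubtree_of_le (h w)

theorem Affordable.isFeasible (hf : IsMinmaxMonotone G f) {own : V → V} (h : Affordable f T own)
    {k : ℕ} (hk : (Finset.univ.image own).card ≤ k) :
    IsFeasible G f k T (Finset.univ.image own) (fiber own) := by
  refine ⟨⟨?_, ?_, ?_, ?_⟩, hk, ?_⟩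
  · intro s hs
    obtain ⟨w, -, rfl⟩ := Finset.mem_image.1 hs
    exact h.isSubtree hf w
  · intro s hs
    obtain ⟨w, -, rfl⟩ := Finset.mem_image.1 hs
    ext x
    simp only [Finset.mem_inter, Finset.mem_image, Finset.mem_univ, true_and, mem_fiber,
      Finset.mem_singleton]
    constructor
    · rintro ⟨⟨a, rfl⟩, h'⟩
      rwa [h.idem hf] at h'
    · rintro rfl
      exact ⟨⟨w, rfl⟩, h.idem hf w⟩
  · intro s _ s' _ hne
    rw [Finset.disjoint_left]
    intro x hx hx'
    rw [mem_fiber] at hx hx'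
    exact hne (hx.symm.trans hx')
  · exact fun v => ⟨own v, Finset.mem_image_of_mem _ (Finset.mem_univ v), by simp⟩
  · refine Finset.sup_le fun s hs => ?_
    obtain ⟨w, -, rfl⟩ := Finset.mem_image.1 hs
    exact h w

theorem IsFeasible.exists_affordable {k : ℕ} {S : Finset V} {P : V → Finset V}
    (h : IsFeasible G f k T S P) :
    ∃ own : V → V, Affordable f T own ∧ (Finset.univ.image own).card ≤ k := by
  obtain ⟨hc, hk, hcost⟩ := h
  choose own hS hP using hc.cover
  refine ⟨own, fun w => ?_, (Finset.card_le_card ?_).trans hk⟩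
  · have : fiber own (own w) = P (own w) := by
      ext x
      rw [mem_fiber]
      constructor
      · intro hx; rw [← hx]; exact hP x
      · intro hx
        by_contra hne
        exact Finset.disjoint_left.1 (hc.disjoint _ (hS x) _ (hS w) hne) (hP x) hx
    rw [this]
    exact (Finset.le_sup (f := fun s => f (P s) s) (hS w)).trans hcost
  · intro s hs
    obtain ⟨w, -, rfl⟩ := Finset.mem_image.1 hs
    exact hS w

theorem affordable_id (hf : IsMinmaxMonotone G f) : Affordable f T id := fun w => by
  have : fiber id (id w) = {w} := by ext x; simp
  rw [this, id, hf.singleton]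
  exact zero_le

theorem GreedyInv.initial {fl : V → ℕ} {N : ℕ} (hN : ∀ v, pos v < N) (hfl : ∀ v, fl v = N) :
    GreedyInv G r par pos f T fl := by
  have no : ∀ s, ¬ fl s ≤ pos s := fun s => by have := hN s; have := hfl s; omega
  refine ⟨fun q s h => absurd h (no q), fun s h => absurd h (no s),
    ⟨N, fun s h => absurd h (no s), fun s h => absurd h (no s), fun y hy => ?_⟩, ?_⟩
  · exact absurd hy (hN y).not_gt
  · rintro k ⟨S, P, h⟩
    obtain ⟨own, h1, h2⟩ := h.exists_affordable
    exact ⟨own, h1, h2, fun q h => absurd h (no q)⟩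

variable (hr : IsRooted G r par pos) (hf : IsMinmaxMonotone G f)
include hr hf

/-- If a vertex that hangs at `y` is not assigned like `y`, then on the way up to `y` there is an
unserved vertex that is assigned to a sink below it. -/
theorem exists_cut {own : V → V} (ho : Affordable f T own) {H : V → Prop} {y z : V}
    (hz : z ∈ hang r par H y) (hne : own z ≠ own y) :
    ∃ x, ¬ H x ∧ Anc r par y x ∧ pos y < pos x ∧ Anc r par x (own x) := by
  induction z using hr.up_induction with
  | h z ih =>
    rcases hang_cases hz with rfl | ⟨h1, h2, h3⟩
    · exact absurd rfl hne
    by_cases h : own (par z) = own y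
    · have hanc := hr.anc_of_mem_hang h3
      refine ⟨z, h2, .step h1 hanc, (hr.pos_le hanc).trans_lt (hr.pos_par z h1), ?_⟩
      by_contra hno
      have := (hr.mem_of_crossing (ho.isSubtree hf z) (a := z) (b := own z) (by simp)
        (by simpa using ho.idem hf z) (.refl z) hno).2.2
      rw [mem_fiber, h] at this
      exact hne this.symm
    · exact ih h1 h3 h

/-- If an unserved vertex `x` is assigned to a sink below it, then the assignment uses a sink below
`x` that the greedy algorithm has not placed. Either the sink of `x` is such a sink, or it is dead,
and then it cannot take over all that hangs below the vertex at which it died. -/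
theorem GreedyInv.exists_sink_of_anc {fl : V → ℕ} (hinv : GreedyInv G r par pos f T fl)
    {own : V → V} (ho : Affordable f T own) {x : V}
    (hx : ¬ Served r par pos fl x) (hanc : Anc r par x (own x)) :
    ∃ s, own s = s ∧ Anc r par x s ∧ ¬ fl s ≤ pos s := by
  induction x using hr.down_induction with
  | h x ih =>
    by_cases hs : fl (own x) ≤ pos (own x)
    swap
    · exact ⟨own x, ho.idem hf x, hanc, hs⟩
    have hsx : ¬ fl (own x) ≤ pos x := fun h => hx ⟨own x, hanc, h⟩
    obtain ⟨w, h1, h2, h3, -⟩ := hinv.dead (own x) hs (by omega)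
    have hxw : Anc r par x w := hr.anc_of_le hanc h2 (by omega)
    have hsub : ¬ chain r par (Served r par pos fl) (own x) w ⊆ fiber own (own x) := by
      intro hsub
      exact absurd ((hf.set_mono _ _ _ (hr.isSubtree_chain _ h2) (mem_chain_of_anc (.refl _) h2)
        hsub).trans (ho x)) h3.not_ge
    obtain ⟨z, hz, hzo⟩ := Finset.not_subset.1 hsub
    obtain ⟨y, hy1, hy2, hy3⟩ := mem_chain.1 hz
    have hxy := hxw.trans hy2
    have hyo : own y = own x := by
      by_cases hyx : y = x
      · rw [hyx]
      have := hr.mem_of_crossing (ho.isSubtree hf x) (u := y) (a := own x) (b := x)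
        (by simpa using ho.idem hf x) (by simp) hy1
        (fun h => hyx (hr.eq_of_anc hxy (hr.pos_le h)))
      simpa using this.1
    obtain ⟨x', hx1, hx2, hx3, hx4⟩ := exists_cut hr hf ho hy3
      (by rw [hyo]; simpa using hzo)
    obtain ⟨s, hs1, hs2, hs3⟩ := ih x' ((hr.pos_le hxy).trans_lt hx3) hx1 hx4
    exact ⟨s, hs1, (hxy.trans hx2).trans hs2, hs3⟩

/-- If what hangs at the unserved vertex `u` is too expensive for the parent of `u`, or if `u` is
the root, then every solution has a sink below `u` that has not been placed. -/
theorem GreedyInv.exists_sink {fl : V → ℕ} (hinv : GreedyInv G r par pos f T fl)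
    {own : V → V} (ho : Affordable f T own) {u : V} (hu : ¬ Served r par pos fl u)
    (hpeak : u ≠ r →
      (T : ℝ≥0∞) < f (insert (par u) (hang r par (Served r par pos fl) u)) (par u)) :
    ∃ s, own s = s ∧ Anc r par u s ∧ ¬ fl s ≤ pos s := by
  by_cases hanc : Anc r par u (own u)
  · exact hinv.exists_sink_of_anc hr hf ho hu hanc
  have hur : u ≠ r := by rintro rfl; exact hanc (hr.anc_root _)
  have hsub : ¬ hang r par (Served r par pos fl) u ⊆ fiber own (own u) := fun hsub =>
    absurd ((hr.cost_insert_par_le hf (ho.isSubtree hf u) (by simpa using ho.idem hf u) hanc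
      (hr.isSubtree_hang _ u) (hang_self _ u) hsub fun x hx => hr.anc_of_mem_hang hx).trans (ho u))
      (hpeak hur).not_ge
  obtain ⟨z, hz, hzo⟩ := Finset.not_subset.1 hsub
  obtain ⟨x, hx1, hx2, -, hx4⟩ := exists_cut hr hf ho hz (by simpa using hzo)
  obtain ⟨s, hs1, hs2, hs3⟩ := hinv.exists_sink_of_anc hr hf ho hx1 hx4
  exact ⟨s, hs1, hx2.trans hs2, hs3⟩

variable {fl : V → ℕ} {b : V → V} (hb : IsBest r par pos fl b) (hinv : GreedyInv G r par pos f T fl)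
  {j : ℕ} {lab : V → V} (hl : IsLab r par pos fl b j lab)
include hb hinv hl

theorem IsLab.sink_cases (w : V) : fl (lab w) ≤ pos (lab w) ∨ pos (lab w) < j ∨
    (lab w = r ∧ ¬ Served r par pos fl r) := by
  induction w using hr.up_induction with
  | h w ih =>
    rcases lt_or_ge (pos w) j with hw | hw
    · right; left; rwa [hl.of_lt hw]
    by_cases h : fl (b w) ≤ pos w
    · left
      rw [hl.of_served hw h]
      exact h.trans (hr.pos_le (hb.anc hr w))
    by_cases hwr : w = r
    · subst hwr
      exact .inr (.inr ⟨hl.of_root hw h, by rwa [hb.served_iff hr]⟩)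
    · rw [hl.of_not_served hw h hwr]
      exact ih hwr

theorem IsLab.sink_eq {q : V} (hq : fl q ≤ pos q) : lab q = q := by
  rcases lt_or_ge (pos q) j with hw | hw
  · exact hl.of_lt hw
  have h1 := (hb.le_self q).trans hq
  rw [hl.of_served hw h1]
  exact hinv.sole q _ hq (hb.anc hr q) h1

/-- If all blocks are affordable, then all processed vertices are settled. -/
theorem IsLab.settled (ha : Affordable f T lab) {y : V} (hy : j ≤ pos y) :
    Settled r par pos f T fl y := by
  constructor
  · intro h
    rw [hb.served_iff hr] at h
    refine ⟨b y, hb.anc hr y, h, ?_⟩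
    refine (hf.set_mono _ _ _ (hr.isSubtree_chain _ (hb.anc hr y))
      (mem_chain_of_anc (.refl _) (hb.anc hr y)) (hl.chain_subset hr hb hy h)).trans ?_
    have := ha y
    rwa [hl.of_served hy h] at this
  · intro h hyr
    rw [hb.served_iff hr] at h
    refine (hr.cost_insert_par_le hf (ha.isSubtree hf y) (by simpa using ha.idem hf y)
      (hl.not_anc hr hb hy h hyr) (hr.isSubtree_hang _ y) (hang_self _ y) (fun x hx => ?_)
      fun x hx => hr.anc_of_mem_hang hx).trans (ha y)
    rw [mem_fiber]
    exact hl.hang_subset hr hb (by omega) hx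

omit hl in
/-- If processing `u` creates a block that is too expensive, then either the chosen sink of `u`
cannot afford to serve `u`, or `u` is unserved and the parent of `u` cannot afford what hangs at
`u`. -/
theorem IsLab.event {u : V} {lab' : V → V} (hl : IsLab r par pos fl b (pos u) lab)
    (hl' : IsLab r par pos fl b (pos u + 1) lab') (ha' : Affordable f T lab')
    (ha : ¬ Affordable f T lab) :
    (fl (b u) ≤ pos u → b u ≠ u ∧
      (T : ℝ≥0∞) < f (chain r par (Served r par pos fl) (b u) u) (b u)) ∧
    (¬ fl (b u) ≤ pos u → u ≠ r ∧
      (T : ℝ≥0∞) < f (insert (par u) (hang r par (Served r par pos fl) u)) (par u)) := by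
  have hite := hl.eq_ite hr hb hl' rfl
  have hu' : lab' u = u := hl'.of_lt (by omega)
  have hne : lab u ≠ u := by
    intro h
    apply ha
    have : lab = lab' := by
      funext w
      rw [hite w]
      split_ifs with h'
      · rw [h, h']
      · rfl
    rwa [this]
  -- the block that became too expensive is that of `lab u`
  have hbad : (T : ℝ≥0∞) < f (fiber lab (lab u)) (lab u) := by
    by_contra hle
    apply ha
    intro w
    by_cases hw : lab w = lab u
    · rw [hw]; exact not_lt.1 hle
    have hwu : lab' w ≠ u := fun h => hw (by rw [hite w, if_pos h])
    have hlw : lab w = lab' w := by rw [hite w, if_neg hwu]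
    have : fiber lab (lab w) = fiber lab' (lab' w) := by
      ext x
      rw [mem_fiber, mem_fiber, ← hlw]
      by_cases hx : lab' x = u
      · constructor
        · intro h; rw [hite x, if_pos hx] at h; exact absurd h.symm hw
        · intro h; exact absurd (hlw.symm.trans (h.symm.trans hx)) hwu
      · rw [hite x, if_neg hx]
    rw [this, hlw]
    exact ha' w
  constructor
  · intro h
    rw [hl.of_served le_rfl h] at hne hbad
    refine ⟨hne, hbad.trans_le (hf.set_mono _ _ _ ?_ ?_ fun x hx => ?_)⟩
    · have := hl.isSubtree hr hb hinv.sole u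
      rwa [hl.of_served le_rfl h] at this
    · have := hl.idem hr hb hinv.sole u
      rw [hl.of_served le_rfl h] at this
      rwa [mem_fiber]
    · exact hl.mem_chain hr hb rfl h (mem_fiber.1 hx)
  · intro h
    have hur : u ≠ r := by
      rintro rfl
      exact hne (hl.of_root le_rfl h)
    refine ⟨hur, lt_of_not_ge fun hle => hbad.not_ge ?_⟩
    have hpu := hr.pos_par u hur
    have hlu : lab u = par u := by rw [hl.of_not_served le_rfl h hur, hl.of_lt hpu]
    have hpu' : lab' (par u) = par u := hl'.of_lt (by omega)
    have hpar : par u ≠ u := by intro h; rw [h] at hpu; exact lt_irrefl _ hpu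
    rw [hlu]
    have h1 := ha' (par u)
    rw [hpu'] at h1
    have hsub : fiber lab (par u) =
        fiber lab' (par u) ∪ insert (par u) (hang r par (Served r par pos fl) u) := by
      ext x
      simp only [mem_fiber, Finset.mem_union, Finset.mem_insert]
      constructor
      · intro hx
        by_cases hxu : lab' x = u
        · exact .inr (.inr (hl'.mem_hang hr hb (by omega) hxu))
        · rw [hite x, if_neg hxu] at hx; exact .inl hx
      · rintro (hx | rfl | hx)
        · have : lab' x ≠ u := by rw [hx]; exact hpar
          rw [hite x, if_neg this, hx]
        · rw [hl.of_lt hpu]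
        · rw [hl.hang_subset hr hb (by omega) hx, hlu]
    rw [hsub]
    refine hf.union_le h1 hle fun x hx y hy hxv hyv hadj => ?_
    have hy := hr.anc_of_mem_hang ((Finset.mem_insert.1 hy).resolve_left hyv)
    have hx' : ¬ Anc r par u x := by
      intro hux
      have hs := hf.isSubtree_of_le h1
      have := (hr.mem_of_crossing hs hx (by simpa using hpu') hux (hr.not_anc_par hur)).1
      rw [mem_fiber, hu'] at this
      exact hpar this.symm
    exact hxv (hr.eq_of_adj hy hx' hadj.symm).2.2

omit hl in
/-- Placing a sink. The exchange argument: below `u`, the assignment `own` is replaced by the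
current one, and `u` takes over whatever a sink below `u` serves outside. -/
theorem GreedyInv.place {u : V} (hl : IsLab r par pos fl b (pos u + 1) lab)
    (ha : Affordable f T lab) (hu : ¬ fl (b u) ≤ pos u)
    (hur : u ≠ r)
    (hpeak : (T : ℝ≥0∞) < f (insert (par u) (hang r par (Served r par pos fl) u)) (par u)) :
    GreedyInv G r par pos f T (Function.update fl u 0) := by
  classical
  have huH : ¬ Served r par pos fl u := by rwa [hb.served_iff hr]
  obtain ⟨F, hF1, hF2, hF3⟩ := hinv.settled
  -- the decision at `u` was wrong, so `u` does not lie above the frontier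
  have huF : pos u ≤ F := by
    by_contra h
    exact absurd ((hF3 u (by omega)).2 huH hur) hpeak.not_ge
  have hserved : ∀ a, pos u < pos a →
      (Served r par pos fl a ↔ Served r par pos (Function.update fl u 0) a) := by
    intro a ha
    refine exists_congr fun s => and_congr_right fun has => ?_
    have : s ≠ u := by rintro rfl; exact ha.not_ge (hr.pos_le has)
    rw [Function.update_of_ne this]
  have hnew : ∀ s, Function.update fl u 0 s ≤ pos s → s = u ∨ fl s ≤ pos s := by
    intro s hs
    by_cases hsu : s = u
    · exact .inl hsu
    · rw [Function.update_of_ne hsu] at hs; exact .inr hs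
  refine ⟨?_, ?_, ⟨pos u, ?_, ?_, ?_⟩, ?_⟩
  · intro q s hq hqs hs
    by_cases hsu : s = u
    · subst hsu
      rcases hnew q hq with h | h
      · exact h.symm
      · exact hr.eq_of_anc hqs (huF.trans (hF1 q h))
    · rw [Function.update_of_ne hsu] at hs
      rcases hnew q hq with rfl | h
      · exact absurd ⟨s, hqs, hs⟩ huH
      · exact hinv.sole q s h hqs hs
  · intro s hs hs0
    have hsu : s ≠ u := by rintro rfl; simp at hs0
    rw [Function.update_of_ne hsu] at hs hs0 ⊢
    obtain ⟨w, h1, h2, h3, h4⟩ := hinv.dead s hs hs0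
    have hFw := hF2 s hs hs0
    refine ⟨w, h1, h2, ?_, fun y hy1 hy2 hy3 => ?_⟩
    · rwa [← hr.chain_congr fun a ha => hserved a (by omega)]
    · have := hr.pos_le hy2
      rw [← hr.chain_congr fun a ha => hserved a (by omega)]
      exact h4 y hy1 hy2 hy3
  · intro s hs
    rcases hnew s hs with rfl | h
    · exact le_rfl
    · exact huF.trans (hF1 s h)
  · intro s hs hs0
    have hsu : s ≠ u := by rintro rfl; simp at hs0
    rw [Function.update_of_ne hsu] at hs hs0 ⊢
    exact huF.trans_lt (hF2 s hs hs0)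
  · intro y hy
    have hset := hl.settled hr hf hb hinv ha (y := y) (by omega)
    refine ⟨fun h => ?_, fun h hyr => ?_⟩
    · obtain ⟨s, h1, h2, h3⟩ := hset.1 ((hserved y hy).2 h)
      have : s ≠ u := by rintro rfl; exact hy.not_ge (hr.pos_le h1)
      refine ⟨s, h1, by rwa [Function.update_of_ne this], ?_⟩
      rwa [← hr.chain_congr fun a ha => hserved a (by omega)]
    · have := hset.2 (fun h' => h ((hserved y hy).1 h')) hyr
      rwa [← hr.hang_congr fun a ha => hserved a (by omega)]
  · intro k hk
    obtain ⟨own, ho, hcard, hQ⟩ := hinv.extends_opt k hk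
    obtain ⟨s', hs1, hs2, hs3⟩ := hinv.exists_sink hr hf ho huH fun _ => hpeak
    have hlu : lab u = u := hl.of_lt (by omega)
    have hpu : lab (par u) = par u := hl.of_lt (by have := hr.pos_par u hur; omega)
    -- blocks of the current assignment do not cross the edge above `u`
    have hA : ∀ w, Anc r par u w → Anc r par u (lab w) := by
      intro w hw
      by_contra hno
      have := (hr.mem_of_crossing (ha.isSubtree hf w) (a := w) (by simp)
        (by simpa using ha.idem hf w) hw hno).1
      rw [mem_fiber, hlu] at this
      exact hno (this ▸ .refl u)
    have hB : ∀ x, Anc r par u (lab x) → Anc r par u x := by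
      intro x hx
      by_contra hno
      obtain ⟨h1, -, h3⟩ := hr.mem_of_crossing (ha.isSubtree hf x) (b := x)
        (by simpa using ha.idem hf x) (by simp) hx hno
      rw [mem_fiber] at h1 h3
      rw [hlu] at h1
      rw [hpu, ← h1] at h3
      have := hr.not_anc_par hur
      rw [h3] at this
      exact this (.refl u)
    -- only the block of `own u` can reach from a sink below `u` to the rest of the tree
    have hC : ∀ x, ¬ Anc r par u x → Anc r par u (own x) → own x = own u := by
      intro x hx hx'
      have := (hr.mem_of_crossing (ho.isSubtree hf x) (b := x)
        (by simpa using ho.idem hf x) (by simp) hx' hx).1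
      exact (mem_fiber.1 this).symm
    set own' : V → V := fun w => if Anc r par u w then lab w else
      if Anc r par u (own w) then u else own w with hown'
    have hin : ∀ w, Anc r par u w → own' w = lab w := fun w hw => by simp [hown', hw]
    have hout1 : ∀ w, ¬ Anc r par u w → Anc r par u (own w) → own' w = u :=
      fun w hw hw' => by simp [hown', hw, hw']
    have hout2 : ∀ w, ¬ Anc r par u w → ¬ Anc r par u (own w) → own' w = own w :=
      fun w hw hw' => by simp [hown', hw, hw']
    have hcases : ∀ w, own' w = u ∨ (Anc r par u w ∧ own' w = lab w ∧ lab w ≠ u) ∨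
        (¬ Anc r par u w ∧ ¬ Anc r par u (own w) ∧ own' w = own w) := by
      intro w
      by_cases h1 : Anc r par u w
      · by_cases h2 : lab w = u
        · exact .inl ((hin w h1).trans h2)
        · exact .inr (.inl ⟨h1, hin w h1, h2⟩)
      · by_cases h2 : Anc r par u (own w)
        · exact .inl (hout1 w h1 h2)
        · exact .inr (.inr ⟨h1, h2, hout2 w h1 h2⟩)
    refine ⟨own', fun w => ?_, ?_, fun q hq => ?_⟩
    · rcases hcases w with h | ⟨h1, h2, h3⟩ | ⟨h1, h2, h3⟩
      · rw [h]
        by_cases hex : ∃ x, ¬ Anc r par u x ∧ Anc r par u (own x)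
        · obtain ⟨x0, hx0, hx0'⟩ := hex
          have hu0 := hC x0 hx0 hx0'
          have hfib : fiber own' u =
              fiber lab u ∪ insert u ((fiber own (own u)).filter fun x => ¬ Anc r par u x) := by
            ext x
            simp only [mem_fiber, Finset.mem_union, Finset.mem_insert, Finset.mem_filter]
            constructor
            · intro hx
              by_cases hux : Anc r par u x
              · rw [hin x hux] at hx; exact .inl hx
              by_cases hux' : Anc r par u (own x)
              · exact .inr (.inr ⟨hC x hux hux', hux⟩)
              · rw [hout2 x hux hux'] at hx
                rw [hx] at hux'
                exact absurd (.refl u) hux'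
            · rintro (hx | rfl | ⟨hx, hux⟩)
              · rw [hin x (hB x (by rw [hx]; exact .refl u)), hx]
              · rw [hin x (.refl x), hlu]
              · exact hout1 x hux (by rw [hx, ← hu0]; exact hx0')
          -- the two parts of the new block of `u` meet only in `u`; the upper part costs no more
          -- for `u` than the whole block costs for its old sink `own u` below `u`
          rw [hfib]
          refine hf.union_le (by have := ha u; rwa [hlu] at this)
            ((hr.cost_insert_not_anc_le hf (ho.isSubtree hf u)
              (by simpa using ho.idem hf u) (hu0 ▸ hx0') (by simp)).trans (ho u)) ?_
          intro a ha' c hc hau hcu hadj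
          rw [mem_fiber] at ha'
          have hc' := (Finset.mem_filter.1 ((Finset.mem_insert.1 hc).resolve_left hcu)).2
          exact hau (hr.eq_of_adj (hB a (by rw [ha']; exact .refl u)) hc' hadj).1
        · have hfib : fiber own' u = fiber lab u := by
            ext x
            rw [mem_fiber, mem_fiber]
            constructor
            · intro hx
              by_cases hux : Anc r par u x
              · rwa [hin x hux] at hx
              · rw [hout2 x hux fun h' => hex ⟨x, hux, h'⟩] at hx
                exact absurd ⟨x, hux, by rw [hx]; exact .refl u⟩ hex
            · intro hx
              rw [hin x (hB x (by rw [hx]; exact .refl u)), hx]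
          rw [hfib]
          have := ha u
          rwa [hlu] at this
      · have hfib : fiber own' (lab w) = fiber lab (lab w) := by
          ext x
          rw [mem_fiber, mem_fiber]
          have hw := hA w h1
          constructor
          · intro hx
            rcases hcases x with h | ⟨-, h, -⟩ | ⟨-, h, h'⟩
            · exact absurd (hx.symm.trans h) h3
            · rwa [h] at hx
            · rw [h'] at hx; rw [hx] at h; exact absurd hw h
          · intro hx
            rw [hin x (hB x (hx ▸ hw)), hx]
        rw [h2, hfib]
        exact ha w
      · have hfib : fiber own' (own w) =
            (fiber own (own w)).filter fun x => ¬ Anc r par u x := by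
          ext x
          rw [Finset.mem_filter, mem_fiber, mem_fiber]
          constructor
          · intro hx
            rcases hcases x with h | ⟨h4, h, -⟩ | ⟨h4, -, h'⟩
            · rw [← hx, h] at h2; exact absurd (.refl u) h2
            · rw [← hx, h] at h2; exact absurd (hA x h4) h2
            · rw [h'] at hx; exact ⟨hx, h4⟩
          · rintro ⟨hx, hux⟩
            rw [hout2 x hux (hx ▸ h2), hx]
        have hmem : own w ∈ fiber own (own w) := by simpa using ho.idem hf w
        rw [h3, hfib]
        exact (hf.set_mono _ _ _
          (hr.isSubtree_filter_not_anc (ho.isSubtree hf w) hmem h2)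
          (Finset.mem_filter.2 ⟨hmem, h2⟩) (Finset.filter_subset _ _)).trans (ho w)
    · -- `u` replaces the further sink `s'`
      have hsub : Finset.univ.image own' ⊆ insert u ((Finset.univ.image own).erase s') := by
        intro v hv
        obtain ⟨w, -, rfl⟩ := Finset.mem_image.1 hv
        rw [Finset.mem_insert, Finset.mem_erase]
        rcases hcases w with h | ⟨h1, h2, h3⟩ | ⟨h1, h2, h3⟩
        · exact .inl h
        · right
          have hw := hA w h1
          rw [h2]
          have hq : fl (lab w) ≤ pos (lab w) := by
            rcases hl.sink_cases hr hf hb hinv w with h | h | ⟨h, -⟩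
            · exact h
            · exact absurd (hr.eq_of_anc hw (by omega)) h3
            · rw [h] at hw
              exact absurd (hr.eq_of_anc (hr.anc_root u) (hr.pos_le hw)) hur
          exact ⟨fun h => hs3 (h ▸ hq), Finset.mem_image.2 ⟨lab w, Finset.mem_univ _, hQ _ hq⟩⟩
        · right
          rw [h3]
          exact ⟨fun h => h2 (h ▸ hs2), Finset.mem_image_of_mem _ (Finset.mem_univ w)⟩
      have hs' : s' ∈ Finset.univ.image own := Finset.mem_image.2 ⟨s', Finset.mem_univ _, hs1⟩
      have h1 := Finset.card_le_card hsub
      have h2 := Finset.card_insert_le u ((Finset.univ.image own).erase s')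
      have h3 := Finset.card_erase_add_one hs'
      omega
    · rcases hnew q hq with rfl | h
      · rw [hin q (.refl q), hlu]
      · by_cases huq : Anc r par u q
        · rw [hin q huq, hl.sink_eq hr hf hb hinv h]
        · have := hQ q h
          rw [hout2 q huq (by rwa [this]), this]

omit hl in
/-- Declaring a sink dead. This changes nothing at the vertices that have been processed, since a
vertex that `s` can no longer serve but that was settled has another sink that can afford it. -/
theorem GreedyInv.kill {u : V} (hl : IsLab r par pos fl b (pos u + 1) lab)
    (ha : Affordable f T lab) (hu : fl (b u) ≤ pos u) (hne : b u ≠ u)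
    (hbad : (T : ℝ≥0∞) < f (chain r par (Served r par pos fl) (b u) u) (b u)) :
    fl (b u) = 0 ∧ GreedyInv G r par pos f T (Function.update fl (b u) (pos u + 1)) := by
  obtain ⟨F, hF1, hF2, hF3⟩ := hinv.settled
  set s := b u with hs
  have hus : Anc r par u s := hb.anc hr u
  have hpos := hr.pos_lt hus hne
  have hs0 : fl s = 0 := by
    by_contra h0
    obtain ⟨w, h1, h2, -, h4⟩ := hinv.dead s (hu.trans hpos.le) h0
    have hwu : Anc r par w u := hr.anc_of_le h2 hus (by omega)
    refine hbad.not_ge (h4 u hus hwu ?_)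
    rintro rfl
    omega
  refine ⟨hs0, ?_⟩
  have hnews : Function.update fl s (pos u + 1) s = pos u + 1 := Function.update_self ..
  have hnewne : ∀ v, v ≠ s → Function.update fl s (pos u + 1) v = fl v :=
    fun v hv => Function.update_of_ne hv ..
  have hmono : ∀ v, fl v ≤ Function.update fl s (pos u + 1) v := by
    intro v
    by_cases hv : v = s
    · rw [hv, hs0]; exact Nat.zero_le _
    · rw [hnewne v hv]
  -- a vertex that `s` may have served before keeps a sink that can afford it
  have hwit : ∀ y, min F (pos u) < pos y → Served r par pos fl y → ∃ t, Anc r par y t ∧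
      Function.update fl s (pos u + 1) t ≤ pos y ∧
      f (chain r par (Served r par pos fl) t y) t ≤ T := by
    intro y hy hserv
    have hset : Settled r par pos f T fl y := by
      by_cases h : F < pos y
      · exact hF3 y h
      · exact hl.settled hr hf hb hinv ha (by omega)
    obtain ⟨t, h1, h2, h3⟩ := hset.1 hserv
    refine ⟨t, h1, ?_, h3⟩
    by_cases hts : t = s
    · subst hts
      rw [hnews]
      by_contra hlt
      have hyu : Anc r par y u := hr.anc_of_le h1 hus (by omega)
      exact hbad.not_ge ((hr.cost_chain_le hf _ hus hyu).trans h3)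
    · rwa [hnewne t hts]
  have hserved : ∀ y, min F (pos u) < pos y →
      (Served r par pos fl y ↔ Served r par pos (Function.update fl s (pos u + 1)) y) := by
    intro y hy
    constructor
    · intro h
      obtain ⟨t, h1, h2, -⟩ := hwit y hy h
      exact ⟨t, h1, h2⟩
    · rintro ⟨t, h1, h2⟩
      exact ⟨t, h1, (hmono t).trans h2⟩
  refine ⟨?_, ?_, ⟨min F (pos u), ?_, ?_, ?_⟩, ?_⟩
  · intro q t hq hqt ht
    exact hinv.sole q t ((hmono q).trans hq) hqt ((hmono t).trans ht)
  · intro t ht ht0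
    by_cases hts : t = s
    · subst hts
      refine ⟨u, hnews, hus, ?_, fun y hy1 hy2 hy3 => ?_⟩
      · rwa [← hr.chain_congr fun a ha => hserved a (by omega)]
      · have hy := hr.pos_lt hy2 hy3
        rw [← hr.chain_congr fun a ha => hserved a (by omega)]
        have hby := hb.eq_of_between hr hu hy2 (hs ▸ hy1)
        rw [← hs] at hby
        have hfy : fl (b y) ≤ pos y := by rw [hby]; omega
        have h1 := hl.chain_subset hr hb (w := y) (by omega) hfy
        have h2 := ha y
        rw [hl.of_served (by omega) hfy] at h2
        rw [hby] at h1 h2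
        exact (hf.set_mono _ _ _ (hr.isSubtree_chain _ hy1)
          (mem_chain_of_anc (.refl _) hy1) h1).trans h2
    · rw [hnewne t hts] at ht ht0 ⊢
      obtain ⟨w, h1, h2, h3, h4⟩ := hinv.dead t ht ht0
      have hFw := hF2 t ht ht0
      refine ⟨w, h1, h2, ?_, fun y hy1 hy2 hy3 => ?_⟩
      · rwa [← hr.chain_congr fun a ha => hserved a (by omega)]
      · have := hr.pos_le hy2
        rw [← hr.chain_congr fun a ha => hserved a (by omega)]
        exact h4 y hy1 hy2 hy3
  · intro t ht
    exact (min_le_left _ _).trans (hF1 t ((hmono t).trans ht))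
  · intro t ht ht0
    by_cases hts : t = s
    · rw [hts, hnews]; omega
    · rw [hnewne t hts] at ht ht0 ⊢
      exact (min_le_left _ _).trans_lt (hF2 t ht ht0)
  · intro y hy
    constructor
    · intro h
      obtain ⟨t, h1, h2, h3⟩ := hwit y hy ((hserved y hy).2 h)
      refine ⟨t, h1, h2, ?_⟩
      rwa [← hr.chain_congr fun a ha => hserved a (by omega)]
    · intro h hyr
      have hset : Settled r par pos f T fl y := by
        by_cases h : F < pos y
        · exact hF3 y h
        · exact hl.settled hr hf hb hinv ha (by omega)
      have := hset.2 (fun h' => h ((hserved y hy).1 h')) hyr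
      rwa [← hr.hang_congr fun a ha => hserved a (by omega)]
  · intro k hk
    obtain ⟨own, h1, h2, h3⟩ := hinv.extends_opt k hk
    exact ⟨own, h1, h2, fun q hq => h3 q ((hmono q).trans hq)⟩

/-- If all vertices have been processed and all blocks are affordable, the number of sinks is
minimal. -/
theorem IsLab.card_le (hj : j = 0) {k : ℕ} (hk : ∃ S P, IsFeasible G f k T S P) :
    (Finset.univ.image lab).card ≤ k := by
  obtain ⟨own, ho, hcard, hQ⟩ := hinv.extends_opt k hk
  have hmem : ∀ q, own q = q → q ∈ Finset.univ.image own := fun q hq =>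
    Finset.mem_image.2 ⟨q, Finset.mem_univ _, hq⟩
  by_cases hserv : Served r par pos fl r
  · refine (Finset.card_le_card fun v hv => ?_).trans hcard
    obtain ⟨w, -, rfl⟩ := Finset.mem_image.1 hv
    rcases hl.sink_cases hr hf hb hinv w with h | h | ⟨-, h⟩
    · exact hmem _ (hQ _ h)
    · omega
    · exact absurd hserv h
  · obtain ⟨s, hs1, -, hs3⟩ := hinv.exists_sink hr hf ho hserv fun h => absurd rfl h
    have hsub : Finset.univ.image lab ⊆ insert r ((Finset.univ.image own).erase s) := by
      intro v hv
      obtain ⟨w, -, rfl⟩ := Finset.mem_image.1 hv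
      rw [Finset.mem_insert, Finset.mem_erase]
      rcases hl.sink_cases hr hf hb hinv w with h | h | ⟨h, -⟩
      · exact .inr ⟨fun h' => hs3 (h' ▸ h), hmem _ (hQ _ h)⟩
      · omega
      · exact .inl h
    have h1 := Finset.card_le_card hsub
    have h2 := Finset.card_insert_le r ((Finset.univ.image own).erase s)
    have h3 := Finset.card_erase_add_one (hmem s hs1)
    omega

omit hr hf hb hl in
/-- Every solution has at least as many sinks as have been placed. -/
theorem GreedyInv.card_le {k : ℕ} (hk : ∃ S P, IsFeasible G f k T S P) :
    (Finset.univ.filter fun q => fl q ≤ pos q).card ≤ k := by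
  obtain ⟨own, -, hcard, hQ⟩ := hinv.extends_opt k hk
  refine (Finset.card_le_card fun q hq => ?_).trans hcard
  exact Finset.mem_image.2 ⟨q, Finset.mem_univ _, hQ q (Finset.mem_filter.1 hq).2⟩

end Invariant

/-! ### Reasoning about programs -/

section Machine

/-- Run the programs of a list one after the other. -/
def Prog.block : List Prog → Prog
  | [] => .skip
  | p :: l => .seq p (Prog.block l)

/-- The registers that a program writes. -/
def Prog.regs : Prog → List ℕ
  | .const x _ | .move x _ | .add x _ _ | .sub x _ _ | .half x _ | .load x _ _ => [x]
  | .skip | .store _ _ _ | .query _ _ _ _ => []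
  | .seq p q | .ite _ p q => p.regs ++ q.regs
  | .loop _ p => p.regs

/-- The arrays that a program writes. -/
def Prog.arrs : Prog → List ℕ
  | .store A _ _ => [A]
  | .skip | .const _ _ | .move _ _ | .add _ _ _ | .sub _ _ _ | .half _ _ | .load _ _ _
  | .query _ _ _ _ => []
  | .seq p q | .ite _ p q => p.arrs ++ q.arrs
  | .loop _ p => p.arrs

/-- The cost registers that a program writes. -/
def Prog.costs : Prog → List ℕ
  | .query c _ _ _ => [c]
  | .skip | .const _ _ | .move _ _ | .add _ _ _ | .sub _ _ _ | .half _ _ | .load _ _ _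
  | .store _ _ _ => []
  | .seq p q | .ite _ p q => p.costs ++ q.costs
  | .loop _ p => p.costs

/-- The memories `σ` and `σ'` agree on everything that `p` does not write. -/
structure Frame (p : Prog) (σ σ' : Memory) : Prop where
  reg : ∀ x, x ∉ p.regs → σ'.reg x = σ.reg x
  arr : ∀ A, A ∉ p.arrs → σ'.arr A = σ.arr A
  cost : ∀ c, c ∉ p.costs → σ'.cost c = σ.cost c

theorem Frame.refl (p : Prog) (σ : Memory) : Frame p σ σ :=
  ⟨fun _ _ => rfl, fun _ _ => rfl, fun _ _ => rfl⟩

theorem Frame.trans {p : Prog} {σ σ' σ'' : Memory} (h : Frame p σ σ') (h' : Frame p σ' σ'') :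
    Frame p σ σ'' :=
  ⟨fun x hx => (h'.reg x hx).trans (h.reg x hx), fun x hx => (h'.arr x hx).trans (h.arr x hx),
    fun x hx => (h'.cost x hx).trans (h.cost x hx)⟩

theorem Frame.mono {p q : Prog} {σ σ' : Memory} (h : Frame p σ σ') (hr : p.regs ⊆ q.regs)
    (ha : p.arrs ⊆ q.arrs) (hc : p.costs ⊆ q.costs) : Frame q σ σ' :=
  ⟨fun x hx => h.reg x fun h' => hx (hr h'), fun x hx => h.arr x fun h' => hx (ha h'),
    fun x hx => h.cost x fun h' => hx (hc h')⟩

variable {W : ℕ} {ask : List ℕ → ℕ → ℝ≥0∞ → Prop} {t : ℕ → ℝ}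

theorem Exec.frame {p : Prog} {σ σ' : Memory} {c : ℝ} (h : Exec W ask t p σ σ' c) :
    Frame p σ σ' := by
  induction h with
  | skip | ite_true | loop_done =>
    first
    | exact Frame.refl _ _
    | (rename_i ih; exact ih.mono (List.subset_append_left ..) (List.subset_append_left ..)
        (List.subset_append_left ..))
  | const | move | add | sub | half | load =>
    refine ⟨fun y hy => ?_, fun _ _ => rfl, fun _ _ => rfl⟩
    exact Function.update_of_ne (by simpa [Prog.regs] using hy) ..
  | store =>
    refine ⟨fun _ _ => rfl, fun B hB => ?_, fun _ _ => rfl⟩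
    exact Function.update_of_ne (by simpa [Prog.arrs] using hB) ..
  | query =>
    refine ⟨fun _ _ => rfl, fun _ _ => rfl, fun d hd => ?_⟩
    exact Function.update_of_ne (by simpa [Prog.costs] using hd) ..
  | seq p q σ σ' σ'' c c' _ _ ih ih' =>
    exact (ih.mono (List.subset_append_left ..) (List.subset_append_left ..)
      (List.subset_append_left ..)).trans (ih'.mono (List.subset_append_right ..)
      (List.subset_append_right ..) (List.subset_append_right ..))
  | ite_false b p q σ σ' c _ _ ih =>
    exact ih.mono (List.subset_append_right ..) (List.subset_append_right ..)
      (List.subset_append_right ..)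
  | loop_step b p σ σ' σ'' c c' _ _ _ ih ih' =>
    exact Frame.trans (ih.mono (List.Subset.refl _) (List.Subset.refl _) (List.Subset.refl _)) ih'

theorem Exec.nonneg (ht : ∀ m, 0 ≤ t m) {p : Prog} {σ σ' : Memory} {c : ℝ}
    (h : Exec W ask t p σ σ' c) : 0 ≤ c := by
  induction h with
  | query σ c A m s a h => have := ht (σ.reg m); positivity
  | _ => positivity

/-- Started in `σ`, the program `p` halts, and the final memory and the running time satisfy `Q`. -/
def Runs (W : ℕ) (ask : List ℕ → ℕ → ℝ≥0∞ → Prop) (t : ℕ → ℝ) (p : Prog) (σ : Memory)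
    (Q : Memory → ℝ → Prop) : Prop :=
  ∃ σ' c, Exec W ask t p σ σ' c ∧ Q σ' c

/-- The weakest precondition of straight-line code, with `c` for the time that has passed. -/
def Prog.wp (W : ℕ) : Prog → (Memory → ℝ → Prop) → Memory → ℝ → Prop
  | .skip, Q, σ, c => Q σ c
  | .const x a, Q, σ, c => a ≤ W ∧ Q (σ.setReg x a) (c + 1)
  | .move x y, Q, σ, c => Q (σ.setReg x (σ.reg y)) (c + 1)
  | .add x y z, Q, σ, c => σ.reg y + σ.reg z ≤ W ∧ Q (σ.setReg x (σ.reg y + σ.reg z)) (c + 1)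
  | .sub x y z, Q, σ, c => Q (σ.setReg x (σ.reg y - σ.reg z)) (c + 1)
  | .half x y, Q, σ, c => Q (σ.setReg x (σ.reg y / 2)) (c + 1)
  | .load x A i, Q, σ, c => Q (σ.setReg x (σ.arr A (σ.reg i))) (c + 1)
  | .store A i x, Q, σ, c => Q (σ.setArr A (σ.reg i) (σ.reg x)) (c + 1)
  | .query _ _ _ _, _, _, _ => False
  | .seq p q, Q, σ, c => p.wp W (q.wp W Q) σ c
  | .ite b p q, Q, σ, c => (b.Holds σ → p.wp W Q σ (c + 1)) ∧ (¬ b.Holds σ → q.wp W Q σ (c + 1))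
  | .loop _ _, _, _, _ => False

theorem Runs.of_wp {p : Prog} {Q : Memory → ℝ → Prop} {σ : Memory} (h : p.wp W Q σ 0) :
    Runs W ask t p σ Q := by
  have key : ∀ (p : Prog) (Q : Memory → ℝ → Prop) (σ : Memory) (c : ℝ), p.wp W Q σ c →
      Runs W ask t p σ fun σ' c' => Q σ' (c + c') := by
    intro p
    induction p with
    | skip => exact fun Q σ c h => ⟨_, _, .skip σ, by simpa [Prog.wp] using h⟩
    | const x a => exact fun Q σ c h => ⟨_, _, .const σ x a h.1, h.2⟩
    | move x y => exact fun Q σ c h => ⟨_, _, .move σ x y, h⟩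
    | add x y z => exact fun Q σ c h => ⟨_, _, .add σ x y z h.1, h.2⟩
    | sub x y z => exact fun Q σ c h => ⟨_, _, .sub σ x y z, h⟩
    | half x y => exact fun Q σ c h => ⟨_, _, .half σ x y, h⟩
    | load x A i => exact fun Q σ c h => ⟨_, _, .load σ x A i, h⟩
    | store A i x => exact fun Q σ c h => ⟨_, _, .store σ A i x, h⟩
    | query => exact fun Q σ c h => h.elim
    | seq p q ihp ihq =>
      intro Q σ c h
      obtain ⟨σ', c', h1, h2⟩ := ihp _ _ _ h
      obtain ⟨σ'', c'', h3, h4⟩ := ihq _ _ _ h2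
      exact ⟨_, _, .seq _ _ _ _ _ _ _ h1 h3, by simpa only [← add_assoc] using h4⟩
    | ite b p q ihp ihq =>
      intro Q σ c h
      by_cases hb : b.Holds σ
      · obtain ⟨σ', c', h1, h2⟩ := ihp _ _ _ (h.1 hb)
        exact ⟨_, _, .ite_true _ _ _ _ _ _ hb h1, by simpa only [← add_assoc] using h2⟩
      · obtain ⟨σ', c', h1, h2⟩ := ihq _ _ _ (h.2 hb)
        exact ⟨_, _, .ite_false _ _ _ _ _ _ hb h1, by simpa only [← add_assoc] using h2⟩
    | loop => exact fun Q σ c h => h.elim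
  simpa using key p Q σ 0 h

theorem Runs.nil {σ : Memory} {Q : Memory → ℝ → Prop} (h : Q σ 0) :
    Runs W ask t (.block []) σ Q := ⟨_, _, .skip σ, h⟩

/-- Sequential composition: the rest of the block runs in a memory that satisfies what is known
about the first program. -/
theorem Runs.cons {p : Prog} {l : List Prog} {σ : Memory} {R Q : Memory → ℝ → Prop}
    (h : Runs W ask t p σ R)
    (h' : ∀ σ' c, Frame p σ σ' → R σ' c → Runs W ask t (.block l) σ' fun σ'' c' => Q σ'' (c + c')) :
    Runs W ask t (.block (p :: l)) σ Q := by
  obtain ⟨σ', c, h1, h2⟩ := h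
  obtain ⟨σ'', c', h3, h4⟩ := h' σ' c h1.frame h2
  exact ⟨_, _, .seq _ _ _ _ _ _ _ h1 h3, h4⟩

theorem Runs.ite {b : Test} {p q : Prog} {σ : Memory} {Q : Memory → ℝ → Prop}
    (h : b.Holds σ → Runs W ask t p σ fun σ' c => Q σ' (1 + c))
    (h' : ¬ b.Holds σ → Runs W ask t q σ fun σ' c => Q σ' (1 + c)) :
    Runs W ask t (.ite b p q) σ Q := by
  by_cases hb : b.Holds σ
  · obtain ⟨σ', c, h1, h2⟩ := h hb
    exact ⟨_, _, .ite_true _ _ _ _ _ _ hb h1, h2⟩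
  · obtain ⟨σ', c, h1, h2⟩ := h' hb
    exact ⟨_, _, .ite_false _ _ _ _ _ _ hb h1, h2⟩

theorem Runs.query {c A m s : ℕ} {σ : Memory} {a : ℝ≥0∞} {Q : Memory → ℝ → Prop}
    (h : ask ((List.range (σ.reg m)).map (σ.arr A)) (σ.reg s) a)
    (hQ : Q (σ.setCost c a) (1 + t (σ.reg m))) : Runs W ask t (.query c A m s) σ Q :=
  ⟨_, _, .query σ c A m s a h, hQ⟩

/-- Loops are verified with an invariant and a potential `Φ` that pays for the running time: each
round lowers the potential by at least the time of the round. Since a round takes time at least `1`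
for its test, the loop terminates. -/
theorem Runs.loop (ht : ∀ m, 0 ≤ t m) {b : Test} {p : Prog} {σ₀ : Memory}
    {Q : Memory → ℝ → Prop} (Inv : Memory → Prop) (Φ : Memory → ℝ)
    (h₀ : Inv σ₀) (hΦ : ∀ σ, Inv σ → 0 ≤ Φ σ)
    (hstep : ∀ σ, Frame p σ₀ σ → Inv σ → b.Holds σ →
      Runs W ask t p σ fun σ' c => Inv σ' ∧ c + 1 + Φ σ' ≤ Φ σ)
    (hQ : ∀ σ c, Frame p σ₀ σ → Inv σ → ¬ b.Holds σ → c ≤ Φ σ₀ - Φ σ + 1 → Q σ c) :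
    Runs W ask t (.loop b p) σ₀ Q := by
  have key : ∀ (m : ℕ) (σ : Memory), Frame p σ₀ σ → Inv σ → Φ σ < m →
      Runs W ask t (.loop b p) σ fun σ' c =>
        Frame p σ₀ σ' ∧ Inv σ' ∧ ¬ b.Holds σ' ∧ c ≤ Φ σ - Φ σ' + 1 := by
    intro m
    induction m with
    | zero => exact fun σ _ h h' => absurd (hΦ σ h) (by simpa using h')
    | succ m ih =>
      intro σ hF hI hm
      by_cases hb : b.Holds σ
      · obtain ⟨σ', c, h1, h2, h3⟩ := hstep σ hF hI hb
        have hc := h1.nonneg ht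
        have hF' := hF.trans h1.frame
        obtain ⟨σ'', c', h4, h5, h6, h7, h8⟩ := ih σ' hF' h2 (by push_cast at hm; linarith)
        exact ⟨_, _, .loop_step _ _ _ _ _ _ _ hb h1 h4, h5, h6, h7, by linarith⟩
      · exact ⟨_, _, .loop_done _ _ _ hb, hF, hI, hb, by simp⟩
  obtain ⟨m, hm⟩ := exists_nat_gt (Φ σ₀)
  obtain ⟨σ, c, h1, h2, h3, h4, h5⟩ := key m σ₀ (Frame.refl _ _) h₀ hm
  exact ⟨σ, c, h1, hQ σ c h2 h3 h4 h5⟩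

/-- Run `p` for all values of register `i` below the value of register `m`; register `2` has to hold
the constant `1`. -/
def Prog.for (i m : ℕ) (p : Prog) : Prog :=
  .block [.const i 0, .loop (.lt i m) (.block [p, .add i i 2])]

theorem Runs.for (ht : ∀ m, 0 ≤ t m) {i m M : ℕ} {p : Prog} {σ₀ : Memory}
    {Q : Memory → ℝ → Prop} (Inv : ℕ → Memory → Prop) (K : ℕ → ℝ) (hK : ∀ j, 0 ≤ K j)
    (hi : i ∉ p.regs) (hm : m ∉ p.regs) (h2 : 2 ∉ p.regs) (hmi : m ≠ i) (h2i : 2 ≠ i)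
    (hM : σ₀.reg m = M) (hone : σ₀.reg 2 = 1) (hW : M ≤ W)
    (h₀ : Inv 0 (σ₀.setReg i 0))
    (hstep : ∀ j σ, j < M → Frame (.for i m p) σ₀ σ → σ.reg i = j → Inv j σ →
      Runs W ask t p σ fun σ' c => Inv (j + 1) (σ'.setReg i (j + 1)) ∧ c ≤ K j)
    (hQ : ∀ σ c, Frame (.for i m p) σ₀ σ → Inv M σ →
      c ≤ ∑ j ∈ Finset.range M, (K j + 2) + 2 → Q σ c) :
    Runs W ask t (.for i m p) σ₀ Q := by
  have hreg : (Prog.for i m p).regs = i :: (p.regs ++ [i]) := by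
    simp [Prog.for, Prog.block, Prog.regs]
  have harr : (Prog.for i m p).arrs = p.arrs := by
    simp [Prog.for, Prog.block, Prog.arrs]
  have hcost : (Prog.for i m p).costs = p.costs := by
    simp [Prog.for, Prog.block, Prog.costs]
  have hreg' : (Prog.block [p, .add i i 2]).regs = p.regs ++ [i] := by
    simp [Prog.block, Prog.regs]
  have harr' : (Prog.block [p, .add i i 2]).arrs = p.arrs := by
    simp [Prog.block, Prog.arrs]
  have hcost' : (Prog.block [p, .add i i 2]).costs = p.costs := by
    simp [Prog.block, Prog.costs]
  have hsub : ∀ σ, Frame (.block [p, .add i i 2]) (σ₀.setReg i 0) σ → Frame (.for i m p) σ₀ σ := by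
    intro σ h
    refine ⟨fun x hx => ?_, fun A hA => ?_, fun c hc => ?_⟩
    · rw [hreg] at hx
      rw [h.reg x (by rw [hreg']; exact fun h' => hx (List.mem_cons_of_mem _ h'))]
      exact Function.update_of_ne (fun h' => hx (by rw [h']; exact List.mem_cons_self)) ..
    · exact h.arr A (by rwa [harr', ← harr])
    · exact h.cost c (by rwa [hcost', ← hcost])
  refine Runs.cons (R := fun σ c => σ = σ₀.setReg i 0 ∧ c = 1)
    ⟨_, _, .const σ₀ i 0 (Nat.zero_le _), rfl, rfl⟩ ?_
  rintro _ _ - ⟨rfl, rfl⟩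
  refine Runs.cons (R := fun σ c => Frame (.for i m p) σ₀ σ ∧ Inv M σ ∧
    c ≤ ∑ j ∈ Finset.range M, (K j + 2) + 1) ?_ ?_
  · refine Runs.loop ht (fun σ => σ.reg i ≤ M ∧ Inv (σ.reg i) σ)
      (fun σ => ∑ j ∈ Finset.Ico (σ.reg i) M, (K j + 2)) ?_ ?_ ?_ ?_
    · have : (σ₀.setReg i 0).reg i = 0 := Function.update_self ..
      rw [this]
      exact ⟨Nat.zero_le _, h₀⟩
    · exact fun σ _ => Finset.sum_nonneg fun j _ => by have := hK j; positivity
    · intro σ hF ⟨_, hI⟩ hb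
      have hFF := hsub σ hF
      have hnm : ∀ x, x ≠ i → x ∉ p.regs → σ.reg x = σ₀.reg x := fun x hx hx' =>
        hFF.reg x (by rw [hreg]; simp [hx, hx'])
      have hlt : σ.reg i < M := by
        have h : σ.reg i < σ.reg m := hb
        rwa [hnm m hmi hm, hM] at h
      refine Runs.cons (hstep _ σ hlt hFF rfl hI) fun σ' c hF' ⟨h1, h2'⟩ => ?_
      have e1 : σ'.reg i = σ.reg i := hF'.reg i hi
      have e2 : σ'.reg 2 = 1 := by rw [hF'.reg 2 h2, hnm 2 h2i h2, hone]
      refine Runs.cons (R := fun σ'' c' => σ'' = σ'.setReg i (σ.reg i + 1) ∧ c' = 1)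
        ⟨_, _, .add σ' i i 2 (by rw [e1, e2]; omega), by rw [e1, e2], rfl⟩ ?_
      rintro _ _ - ⟨rfl, rfl⟩
      refine Runs.nil ?_
      have : (σ'.setReg i (σ.reg i + 1)).reg i = σ.reg i + 1 := Function.update_self ..
      rw [this, Finset.sum_eq_sum_Ico_succ_bot hlt]
      exact ⟨⟨hlt, h1⟩, by linarith⟩
    · intro σ c hF ⟨h1, h2'⟩ hb hc
      have hFF := hsub σ hF
      have hge : M ≤ σ.reg i := by
        have h : ¬ σ.reg i < σ.reg m := hb
        rwa [hFF.reg m (by rw [hreg]; simp [hmi, hm]), hM, not_lt] at h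
      have hM' : σ.reg i = M := le_antisymm h1 hge
      have : (σ₀.setReg i 0).reg i = 0 := Function.update_self ..
      rw [hM'] at h2' hc
      rw [this, Finset.Ico_self, Finset.sum_empty, Nat.Ico_zero_eq_range] at hc
      exact ⟨hFF, h2', by linarith⟩
  · intro σ c _ ⟨h1, h2', h3⟩
    exact Runs.nil (hQ σ _ h1 h2' (by linarith))

theorem Memory.setReg_reg (σ : Memory) (x a y : ℕ) :
    (σ.setReg x a).reg y = if y = x then a else σ.reg y := by
  simp [Memory.setReg, Function.update_apply]

theorem Memory.setReg_arr (σ : Memory) (x a : ℕ) : (σ.setReg x a).arr = σ.arr := rfl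

theorem Memory.setArr_reg (σ : Memory) (A i a : ℕ) : (σ.setArr A i a).reg = σ.reg := rfl

theorem Memory.setArr_arr (σ : Memory) (A i a B : ℕ) :
    (σ.setArr A i a).arr B = if B = A then Function.update (σ.arr A) i a else σ.arr B := by
  simp [Memory.setArr, Function.update_apply]

theorem Memory.setCost_reg (σ : Memory) (c : ℕ) (a : ℝ≥0∞) : (σ.setCost c a).reg = σ.reg := rfl

theorem Memory.setCost_cost (σ : Memory) (c : ℕ) (a : ℝ≥0∞) (d : ℕ) :
    (σ.setCost c a).cost d = if d = c then a else σ.cost d := by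
  simp [Memory.setCost, Function.update_apply]

end Machine

/-! ### Choosing the sinks

All programs below use the following registers and arrays; cost register `0` holds the threshold,
and registers that are not listed hold intermediate values.

* registers: `0`: `n`; `1`: `k`; `2`: the constant `1`; `3`: the position from which vertices are
  processed; `13`: whether a test has succeeded; `14`: the constant `0`; `15`: the answer; `16`:
  whether the computation goes on; `17`: the number of sinks; `18`, `19`: the bounds of the binary
  search; `20`: register `18` plus `1`
* arrays: `0`, `1`: offsets and adjacency lists; `2`: the assignment; `3`: parents; `4`: the
  vertices ordered by position; `5`: positions; `6`: `fl`; `7`: the chosen sinks; `8`, `9`: heads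
  and successors of linked lists; `10`: the block that is sent to the oracle
-/

section Programs

/-- The part of the memory that stays fixed once the tree has been searched: the registers `0`, `1`,
`2` and `14` hold `n`, `k`, `1` and `0`; the arrays `3`, `4` and `5` hold the parents, the vertices
in the order of their positions, and the positions. -/
structure Env {n : ℕ} (k : ℕ) (T : ℝ≥0) (par : Fin n → Fin n) (pos : Fin n → ℕ) (σ : Memory) :
    Prop where
  reg_n : σ.reg 0 = n
  reg_k : σ.reg 1 = k
  one : σ.reg 2 = 1
  zero : σ.reg 14 = 0
  cost : σ.cost 0 = T
  arr_par : ∀ v : Fin n, σ.arr 3 v = par v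
  arr_ord : ∀ v : Fin n, σ.arr 4 (pos v) = v
  arr_pos : ∀ v : Fin n, σ.arr 5 v = pos v

theorem Env.frame {n k : ℕ} {T : ℝ≥0} {par : Fin n → Fin n} {pos : Fin n → ℕ} {σ σ' : Memory}
    (h : Env k T par pos σ) {p : Prog} (hF : Frame p σ σ')
    (hreg : ∀ x ∈ [0, 1, 2, 14], x ∉ p.regs) (harr : ∀ A ∈ [3, 4, 5], A ∉ p.arrs)
    (hcost : 0 ∉ p.costs) : Env k T par pos σ' where
  reg_n := by rw [hF.reg 0 (hreg 0 (by simp)), h.reg_n]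
  reg_k := by rw [hF.reg 1 (hreg 1 (by simp)), h.reg_k]
  one := by rw [hF.reg 2 (hreg 2 (by simp)), h.one]
  zero := by rw [hF.reg 14 (hreg 14 (by simp)), h.zero]
  cost := by rw [hF.cost 0 hcost, h.cost]
  arr_par := by rw [hF.arr 3 (harr 3 (by simp))]; exact h.arr_par
  arr_ord := by rw [hF.arr 4 (harr 4 (by simp))]; exact h.arr_ord
  arr_pos := by rw [hF.arr 5 (harr 5 (by simp))]; exact h.arr_pos

/-- One step of the choice: the vertices at position `m` or later have offered their choices to
their parents. -/
structure IsBestFrom {V : Type} (r : V) (par : V → V) (pos fl : V → ℕ) (m : ℕ) (b : V → V) :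
    Prop where
  choice : ∀ p, b p = p ∨ ∃ c, c ≠ r ∧ par c = p ∧ m ≤ pos c ∧ b p = b c ∧ fl (b c) ≤ pos p
  le_self : ∀ p, fl (b p) ≤ fl p
  le_child : ∀ c, c ≠ r → m ≤ pos c → fl (b c) ≤ pos (par c) → fl (b (par c)) ≤ fl (b c)

theorem IsBestFrom.step {V : Type} [DecidableEq V] {G : SimpleGraph V} {r : V} {par : V → V}
    {pos fl : V → ℕ}
    (hr : IsRooted G r par pos) {w : V} {b : V → V}
    (h : IsBestFrom r par pos fl (pos w + 1) b) :
    IsBestFrom r par pos fl (pos w)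
      (if fl (b w) ≤ pos (par w) ∧ fl (b w) < fl (b (par w)) then
        Function.update b (par w) (b w) else b) := by
  split_ifs with hc
  · have hwr : w ≠ r := by
      rintro rfl
      rw [hr.par_root] at hc
      exact lt_irrefl _ hc.2
    have hpw := hr.pos_par w hwr
    have hne : ∀ c, pos w ≤ pos c → Function.update b (par w) (b w) c = b c := by
      intro c hcm
      exact Function.update_of_ne (by rintro rfl; omega) ..
    have hle : ∀ p, fl (Function.update b (par w) (b w) p) ≤ fl (b p) := by
      intro p
      by_cases hp : p = par w
      · rw [hp, Function.update_self]; exact hc.2.le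
      · rw [Function.update_of_ne hp]
    refine ⟨fun p => ?_, fun p => (hle p).trans (h.le_self p), fun c hcr hcm hc' => ?_⟩
    · by_cases hp : p = par w
      · subst hp
        refine .inr ⟨w, hwr, rfl, le_rfl, ?_, ?_⟩
        · rw [hne w le_rfl, Function.update_self]
        · rw [hne w le_rfl]; exact hc.1
      · rw [Function.update_of_ne hp]
        rcases h.choice p with h' | ⟨c, h1, h2, h3, h4, h5⟩
        · exact .inl h'
        · exact .inr ⟨c, h1, h2, by omega, by rw [h4, hne c (by omega)],
            by rwa [hne c (by omega)]⟩
    · rw [hne c hcm] at hc' ⊢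
      by_cases hcw : c = w
      · subst hcw
        rw [Function.update_self]
      · have : pos c ≠ pos w := fun h' => hcw (hr.pos_inj h')
        exact (hle _).trans (h.le_child c hcr (by omega) hc')
  · refine ⟨fun p => ?_, h.le_self, fun c hcr hcm hc' => ?_⟩
    · rcases h.choice p with h' | ⟨c, h1, h2, h3, h4, h5⟩
      · exact .inl h'
      · exact .inr ⟨c, h1, h2, by omega, h4, h5⟩
    · by_cases hcw : c = w
      · subst hcw
        exact not_lt.1 fun h' => hc ⟨hc', h'⟩
      · have : pos c ≠ pos w := fun h' => hcw (hr.pos_inj h')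
        exact h.le_child c hcr (by omega) hc'

/-- Fill array `7` with the chosen sinks, processing children before their parents. -/
def bestProg : Prog := .block [
  .for 4 0 (.store 7 4 4),
  .for 4 0 (.block [
    .sub 5 0 4,
    .sub 5 5 2,
    .load 6 4 5,
    .load 7 3 6,
    .load 8 7 6,
    .load 9 6 8,
    .load 10 5 7,
    .load 11 7 7,
    .load 11 6 11,
    .ite (.le 9 10) (.ite (.lt 9 11) (.store 7 7 8) .skip) .skip])]

variable {W : ℕ} {ask : List ℕ → ℕ → ℝ≥0∞ → Prop} {t : ℕ → ℝ} (ht : ∀ m, 0 ≤ t m)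
  {n k : ℕ} {T : ℝ≥0} {par : Fin n → Fin n} {pos : Fin n → ℕ} {r : Fin n}
  {G : SimpleGraph (Fin n)} (hr : IsRooted G r par pos) (hpos : ∀ v, pos v < n)
include ht hr hpos

omit ht in
theorem IsRooted.exists_pos_eq {i : ℕ} (hi : i < n) : ∃ v, pos v = i := by
  have hinj : Function.Injective fun v => (⟨pos v, hpos v⟩ : Fin n) := fun a b hab =>
    hr.pos_inj (by simpa using hab)
  obtain ⟨v, hv⟩ := (Finite.injective_iff_surjective.1 hinj) ⟨i, hi⟩
  exact ⟨v, by simpa using hv⟩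

theorem runs_bestProg {σ : Memory} {fl : Fin n → ℕ} (hW : n + 2 ≤ W) (hE : Env k T par pos σ)
    (hfl : ∀ v : Fin n, σ.arr 6 v = fl v) :
    Runs W ask t bestProg σ fun σ' c =>
      (∃ b, IsBest r par pos fl b ∧ ∀ v : Fin n, σ'.arr 7 v = b v) ∧ c ≤ 20 * n + 4 := by
  refine Runs.cons (R := fun σ' c => (∀ v : Fin n, σ'.arr 7 v = v) ∧ c ≤ 3 * n + 2) ?_ ?_
  · refine Runs.for ht (M := n) (fun j σ' => ∀ v : Fin n, (v : ℕ) < j → σ'.arr 7 v = v)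
      (fun _ => 1) (fun _ => by norm_num) (by decide) (by decide) (by decide) (by decide)
      (by decide) hE.reg_n hE.one (by omega) (by simp) ?_ ?_
    · intro j σ' hj hF hi hI
      apply Runs.of_wp
      simp only [Prog.wp, Memory.setReg_arr, Memory.setArr_arr, if_true, hi]
      refine ⟨fun v hv => ?_, by norm_num⟩
      rw [Function.update_apply]
      split_ifs with h
      · exact h.symm
      · exact hI v (by omega)
    · intro σ' c hF hI hc
      refine ⟨fun v => hI v v.2, hc.trans ?_⟩
      simp; linarith
  intro σ₁ c₁ hF₁ ⟨hb₁, hc₁⟩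
  have hE₁ := hE.frame hF₁ (by decide) (by decide) (by decide)
  have hfl₁ : ∀ v : Fin n, σ₁.arr 6 v = fl v := by rwa [hF₁.arr 6 (by decide)]
  refine Runs.cons (R := fun σ' c => (∃ b, IsBest r par pos fl b ∧ ∀ v : Fin n, σ'.arr 7 v = b v) ∧
    c ≤ 17 * n + 2) ?_ ?_
  · refine Runs.for ht (M := n)
      (fun j σ' => ∃ b, IsBestFrom r par pos fl (n - j) b ∧ ∀ v : Fin n, σ'.arr 7 v = b v)
      (fun _ => 15) (fun _ => by norm_num) (by decide) (by decide) (by decide) (by decide)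
      (by decide) hE₁.reg_n hE₁.one (by omega)
      ⟨id, ⟨fun p => .inl rfl, fun p => le_rfl, fun c _ hc => absurd (hpos c) (by simpa using hc)⟩,
        hb₁⟩ ?_ ?_
    · intro j σ' hj hF hi ⟨b, hb, hb7⟩
      have hE' := hE₁.frame hF (by decide) (by decide) (by decide)
      have hfl' : ∀ v : Fin n, σ'.arr 6 v = fl v := by rwa [hF.arr 6 (by decide)]
      obtain ⟨w, hw⟩ := hr.exists_pos_eq hpos (i := n - j - 1) (by omega)
      have hb' : IsBestFrom r par pos fl (pos w + 1) b := by
        rwa [hw, show n - j - 1 + 1 = n - j by omega]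
      have hs := hb'.step hr
      rw [hw, show n - j - 1 = n - (j + 1) by omega] at hs
      apply Runs.of_wp
      simp only [Prog.block, Prog.wp, Memory.setReg_reg, Memory.setReg_arr, Memory.setArr_arr,
        Test.Holds, if_true, hi, hE'.reg_n, hE'.one, ← hw, hE'.arr_ord, hE'.arr_par, hE'.arr_pos,
        hb7, hfl',
        reduceIte, Nat.reduceEqDiff]
      refine ⟨fun h1 => ⟨fun h2 => ⟨?_, by norm_num⟩, fun h2 => ⟨?_, by norm_num⟩⟩,
        fun h1 => ⟨?_, by norm_num⟩⟩
      · rw [if_pos ⟨h1, h2⟩] at hs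
        refine ⟨_, hs, fun v => ?_⟩
        rw [Function.update_apply, Function.update_apply]
        simp only [Fin.val_inj]
        split_ifs with h
        · rfl
        · exact hb7 v
      · rw [if_neg fun h => h2 h.2] at hs
        exact ⟨b, hs, fun _ => rfl⟩
      · rw [if_neg fun h => h1 h.1] at hs
        exact ⟨b, hs, fun _ => rfl⟩
    · intro σ' c hF ⟨b, hb, hb7⟩ hc
      rw [Nat.sub_self] at hb
      refine ⟨⟨b, ⟨fun p => ?_, hb.le_self, fun c hc => hb.le_child c hc (Nat.zero_le _)⟩, hb7⟩,
        hc.trans ?_⟩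
      · rcases hb.choice p with h' | ⟨c, h1, h2, h3, h4, h5⟩
        · exact .inl h'
        · exact .inr ⟨c, h1, h2, h4, h5⟩
      · simp; linarith
  · exact fun σ₂ c₂ _ ⟨h1, h2⟩ => Runs.nil ⟨h1, by linarith⟩

end Programs

/-! ### Testing an assignment -/

/-- The list `l` is stored as a linked list with the head `h`: `0` stands for the empty list, and
`a + 1` for the list that starts with `a` and continues from `next a`. -/
def Linked (next : ℕ → ℕ) : ℕ → List ℕ → Prop
  | h, [] => h = 0
  | h, a :: l => h = a + 1 ∧ Linked next (next a) l

theorem Linked.update {next : ℕ → ℕ} {i v : ℕ} {l : List ℕ} (hi : i ∉ l) :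
    ∀ {h : ℕ}, Linked next h l → Linked (Function.update next i v) h l := by
  induction l with
  | nil => exact fun h => h
  | cons a l ih =>
    intro h ⟨h1, h2⟩
    rw [List.mem_cons, not_or] at hi
    refine ⟨h1, ?_⟩
    rw [Function.update_of_ne (Ne.symm hi.1)]
    exact ih hi.2 h2

theorem List.sum_filter_pos (L : List ℕ) : (L.filter (0 < ·)).sum = L.sum := by
  induction L with
  | nil => rfl
  | cons a L ih =>
    by_cases h : 0 < a
    · simp [h, ih]
    · simp [ih, Nat.eq_zero_of_not_pos h]

theorem List.sum_map_filter_pos (t : ℕ → ℝ) (L : List ℕ) :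
    ((L.filter (0 < ·)).map t).sum = (L.map fun m => if m = 0 then 0 else t m).sum := by
  induction L with
  | nil => rfl
  | cons a L ih =>
    by_cases h : 0 < a
    · simp [h, ih, h.ne']
    · have := Nat.eq_zero_of_not_pos h
      subst this
      simpa using ih

section Programs

/-- Fill array `2` with the assignment after the vertices at the positions from `j` on have been
processed, where `j` is in register `3`. Array `8`, the heads of the blocks, is cleared. -/
def labProg : Prog := .block [
  .block [.const 5 0, .store 2 5 5],
  .for 4 0 (.block [
    .load 6 4 4,
    .store 8 4 14,
    .ite (.lt 4 3)
      (.store 2 6 6)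
      (.block [
        .load 8 7 6,
        .load 9 6 8,
        .ite (.le 9 4)
          (.store 2 6 8)
          (.block [.load 7 3 6, .load 8 2 7, .store 2 6 8])])])]

/-- Collect the blocks of the assignment as linked lists with heads in array `8` and successors in
array `9`. -/
def bucketProg : Prog := .block [
  .for 4 0 (.block [
    .load 6 2 4,
    .load 7 8 6,
    .store 9 4 7,
    .add 8 4 2,
    .store 8 6 8])]

/-- Copy the block with the head in register `6` to array `10`, and its size to register `7`. -/
def copyProg : Prog := .block [
  .const 7 0,
  .loop (.ne 6 14) (.block [
    .sub 6 6 2,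
    .store 10 7 6,
    .add 7 7 2,
    .load 6 9 6])]

/-- Ask for the costs of all blocks; register `13` is set to `1` if none of them exceeds the
threshold, and to `0` otherwise. -/
def queryProg : Prog := .block [
  .const 13 1,
  .for 4 0 (.block [
    .load 6 8 4,
    .ite (.eq 6 14)
      .skip
      (.block [
        copyProg,
        .query 1 10 7 4,
        .ite (.costLe 1 0) .skip (.const 13 0)])])]

/-- Test whether the assignment for the position in register `3` has affordable blocks. -/
def testProg : Prog := .block [labProg, bucketProg, queryProg]

variable {W : ℕ} {t : ℕ → ℝ} (ht : ∀ m, 0 ≤ t m)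
  {n k : ℕ} {T : ℝ≥0} {par : Fin n → Fin n} {pos : Fin n → ℕ} {r : Fin n}
  {G : SimpleGraph (Fin n)} {f : Finset (Fin n) → Fin n → ℝ≥0∞}
  (hr : IsRooted G r par pos) (hpos : ∀ v, pos v < n)

section
include hr hpos

theorem IsRooted.pos_root : pos r = 0 := by
  obtain ⟨v, hv⟩ := hr.exists_pos_eq hpos (i := 0) (Fin.pos r)
  have := hr.pos_le (hr.anc_root v)
  omega

end

variable {ask : List ℕ → ℕ → ℝ≥0∞ → Prop}
include ht

theorem runs_labProg (hr : IsRooted G r par pos) (hpos : ∀ v, pos v < n) (hr0 : (r : ℕ) = 0)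
    {σ : Memory} {fl : Fin n → ℕ} {b : Fin n → Fin n} {j : ℕ} (hW : n + 2 ≤ W)
    (hE : Env k T par pos σ) (hfl : ∀ v : Fin n, σ.arr 6 v = fl v)
    (hb7 : ∀ v : Fin n, σ.arr 7 v = b v) (hj : σ.reg 3 = j) :
    Runs W ask t labProg σ fun σ' c =>
      ((∃ lab, IsLab r par pos fl b j lab ∧ ∀ v : Fin n, σ'.arr 2 v = lab v) ∧
        ∀ x < n, σ'.arr 8 x = 0) ∧ c ≤ 11 * n + 4 := by
  refine Runs.cons (R := fun σ' c => σ'.arr 2 r = r ∧ c ≤ 2) ?_ ?_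
  · apply Runs.of_wp
    simp only [Prog.block, Prog.wp, Memory.setReg_reg, Memory.setArr_arr, if_true]
    refine ⟨Nat.zero_le _, ?_, by norm_num⟩
    rw [hr0, Function.update_self]
  intro σ₁ c₁ hF₁ ⟨h1, hc₁⟩
  have hE₁ := hE.frame hF₁ (by decide) (by decide) (by decide)
  refine Runs.cons (R := fun σ' c =>
      ((∃ lab, IsLab r par pos fl b j lab ∧ ∀ v : Fin n, σ'.arr 2 v = lab v) ∧
        ∀ x < n, σ'.arr 8 x = 0) ∧ c ≤ 11 * n + 2) ?_ ?_
  · let val : (ℕ → ℕ) → Fin n → ℕ := fun a w => if pos w < j then w else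
      if fl (b w) ≤ pos w then b w else if w = r then r else a (par w)
    refine Runs.for ht (M := n)
      (fun i σ' => (i = 0 → σ'.arr 2 r = r) ∧
        (∀ w : Fin n, pos w < i → σ'.arr 2 w = val (σ'.arr 2) w) ∧
        (∀ w : Fin n, pos w < i → σ'.arr 2 w < n) ∧ ∀ x < i, σ'.arr 8 x = 0)
      (fun _ => 9) (fun _ => by norm_num) (by decide) (by decide) (by decide) (by decide)
      (by decide) hE₁.reg_n hE₁.one (by omega) ⟨fun _ => h1, by simp, by simp, by simp⟩ ?_ ?_
    · intro i σ' hi hF hi4 ⟨hI0, hI1, hI2, hI3⟩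
      have hE' := hE₁.frame hF (by decide) (by decide) (by decide)
      have hfl' : ∀ v : Fin n, σ'.arr 6 v = fl v := by
        rwa [hF.arr 6 (by decide), hF₁.arr 6 (by decide)]
      have hb7' : ∀ v : Fin n, σ'.arr 7 v = b v := by
        rwa [hF.arr 7 (by decide), hF₁.arr 7 (by decide)]
      have hj' : σ'.reg 3 = j := by rw [hF.reg 3 (by decide), hF₁.reg 3 (by decide), hj]
      obtain ⟨w, hw⟩ := hr.exists_pos_eq hpos hi
      have key : ∀ c, c = val (σ'.arr 2) w → c < n →
          (False → Function.update (σ'.arr 2) w c r = r) ∧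
          (∀ v : Fin n, pos v < i + 1 → Function.update (σ'.arr 2) w c v =
            val (Function.update (σ'.arr 2) w c) v) ∧
          (∀ v : Fin n, pos v < i + 1 → Function.update (σ'.arr 2) w c v < n) ∧
          ∀ x < i + 1, Function.update (σ'.arr 8) i 0 x = 0 := by
        intro c hcv hlt
        have hval : ∀ v : Fin n, pos v < i + 1 →
            val (Function.update (σ'.arr 2) w c) v = val (σ'.arr 2) v := by
          intro v hv
          simp only [val]
          by_cases hvr : v = r
          · rw [if_pos hvr, if_pos hvr]
          · have := hr.pos_par v hvr
            have hne : (par v : ℕ) ≠ w := fun h => by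
              rw [Fin.val_inj] at h; rw [h] at this; omega
            rw [Function.update_of_ne hne]
        refine ⟨False.elim, fun v hv => ?_, fun v hv => ?_, fun x hx => ?_⟩
        · rw [hval v hv, Function.update_apply]
          simp only [Fin.val_inj]
          split_ifs with h
          · rw [h, hcv]
          · exact hI1 v (by have : pos v ≠ pos w := fun h' => h (hr.pos_inj h')
                            omega)
        · rw [Function.update_apply]
          simp only [Fin.val_inj]
          split_ifs with h
          · exact hlt
          · exact hI2 v (by have : pos v ≠ pos w := fun h' => h (hr.pos_inj h')
                            omega)
        · rw [Function.update_apply]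
          split_ifs with h
          · rfl
          · exact hI3 x (by omega)
      apply Runs.of_wp
      simp only [Prog.block, Prog.wp, Memory.setReg_reg, Memory.setReg_arr, Memory.setArr_arr,
        Memory.setArr_reg, Test.Holds, if_true, hi4, hj', hE'.zero, ← hw, hE'.arr_ord, hE'.arr_par,
        hb7', hfl', reduceIte, Nat.reduceEqDiff]
      rw [← hw] at key
      refine ⟨fun hlt => ⟨?_, by norm_num⟩, fun hge => ⟨fun hs => ⟨?_, by norm_num⟩,
        fun hs => ⟨?_, by norm_num⟩⟩⟩
      · have hv : val (σ'.arr 2) w = w := if_pos hlt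
        exact key _ hv.symm w.2
      · have hv : val (σ'.arr 2) w = b w := by simp only [val]; rw [if_neg hge, if_pos hs]
        exact key _ hv.symm (b w).2
      · have hv : val (σ'.arr 2) w = σ'.arr 2 (par w) := by
          simp only [val]; rw [if_neg hge, if_neg hs]
          split_ifs with hwr
          · subst hwr
            rw [hr.par_root, hI0 (by rw [← hw]; exact hr.pos_root hpos)]
          · rfl
        have hlt : σ'.arr 2 (par w) < n := by
          by_cases hwr : w = r
          · subst hwr
            rw [hr.par_root, hI0 (by rw [← hw]; exact hr.pos_root hpos)]
            exact w.2
          · exact hI2 _ (by rw [← hw]; exact hr.pos_par w hwr)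
        exact key _ hv.symm hlt
    · rintro σ' c - ⟨-, hI1, hI2, hI3⟩ hc
      refine ⟨⟨⟨fun v => ⟨σ'.arr 2 v, hI2 v (hpos v)⟩, fun w => ?_, fun v => rfl⟩, hI3⟩,
        hc.trans ?_⟩
      · apply Fin.ext
        refine (hI1 w (hpos w)).trans ?_
        simp only [val]
        split_ifs <;> rfl
      · simp; linarith
  · exact fun σ₂ c₂ _ ⟨h1, h2⟩ => Runs.nil ⟨h1, by linarith⟩

theorem runs_bucketProg {σ : Memory} {lab : Fin n → Fin n} (hW : n + 2 ≤ W)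
    (hE : Env k T par pos σ) (hlab : ∀ v : Fin n, σ.arr 2 v = lab v)
    (hhead : ∀ x < n, σ.arr 8 x = 0) :
    Runs W ask t bucketProg σ fun σ' c =>
      (∀ x : Fin n, ∃ l : List (Fin n), l.Nodup ∧ (∀ v, v ∈ l ↔ lab v = x) ∧
        Linked (σ'.arr 9) (σ'.arr 8 x) (l.map Fin.val)) ∧ c ≤ 7 * n + 2 := by
  refine Runs.cons (R := fun σ' c =>
      (∀ x : Fin n, ∃ l : List (Fin n), l.Nodup ∧ (∀ v, v ∈ l ↔ lab v = x) ∧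
        Linked (σ'.arr 9) (σ'.arr 8 x) (l.map Fin.val)) ∧ c ≤ 7 * n + 2) ?_
    fun σ₂ c₂ _ ⟨h1, h2⟩ => Runs.nil ⟨h1, by linarith⟩
  refine Runs.for ht (M := n)
    (fun i σ' => ∀ x : Fin n, ∃ l : List (Fin n), l.Nodup ∧
      (∀ v, v ∈ l ↔ (v : ℕ) < i ∧ lab v = x) ∧ Linked (σ'.arr 9) (σ'.arr 8 x) (l.map Fin.val))
    (fun _ => 5) (fun _ => by norm_num) (by decide) (by decide) (by decide) (by decide)
    (by decide) hE.reg_n hE.one (by omega)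
    (fun x => ⟨[], List.nodup_nil, by simp, hhead x x.2⟩) ?_ ?_
  · intro i σ' hi hF hi4 hI
    have hE' := hE.frame hF (by decide) (by decide) (by decide)
    obtain ⟨w, rfl⟩ : ∃ w : Fin n, (w : ℕ) = i := ⟨⟨i, hi⟩, rfl⟩
    have hlab' : ∀ v : Fin n, σ'.arr 2 v = lab v := by rwa [hF.arr 2 (by decide)]
    apply Runs.of_wp
    simp only [Prog.block, Prog.wp, Memory.setReg_reg, Memory.setReg_arr, Memory.setArr_arr,
      Memory.setArr_reg, if_true, hi4, hE'.one, hlab', reduceIte, Nat.reduceEqDiff]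
    refine ⟨by omega, fun x => ?_, by norm_num⟩
    obtain ⟨l, h1, h2, h3⟩ := hI x
    have hwl : w ∉ l := fun h => lt_irrefl _ ((h2 w).1 h).1
    have h3' := Linked.update (i := (w : ℕ)) (v := σ'.arr 8 (lab w)) (l := l.map Fin.val)
      (by simpa [Fin.val_inj] using hwl) h3
    rw [Function.update_apply]
    simp only [Fin.val_inj]
    split_ifs with hx
    · subst hx
      refine ⟨w :: l, List.nodup_cons.2 ⟨hwl, h1⟩, fun v => ?_, rfl, ?_⟩
      · rw [List.mem_cons, h2, Nat.lt_succ_iff_lt_or_eq, Fin.val_inj]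
        constructor
        · rintro (rfl | ⟨h, h'⟩)
          · exact ⟨.inr rfl, rfl⟩
          · exact ⟨.inl h, h'⟩
        · rintro ⟨h | h, h'⟩
          · exact .inr ⟨h, h'⟩
          · exact .inl h
      · rwa [Function.update_self]
    · refine ⟨l, h1, fun v => ?_, h3'⟩
      rw [h2, Nat.lt_succ_iff_lt_or_eq, Fin.val_inj]
      constructor
      · exact fun h => ⟨.inl h.1, h.2⟩
      · rintro ⟨h | rfl, h'⟩
        · exact ⟨h, h'⟩
        · exact absurd h'.symm hx
  · intro σ' c _ hI hc
    refine ⟨fun x => ?_, hc.trans ?_⟩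
    · obtain ⟨l, h1, h2, h3⟩ := hI x
      exact ⟨l, h1, fun v => by rw [h2]; simp, h3⟩
    · simp; linarith

theorem runs_copyProg {σ : Memory} {l : List ℕ} (hW : l.length ≤ W) (hone : σ.reg 2 = 1)
    (hzero : σ.reg 14 = 0) (hl : Linked (σ.arr 9) (σ.reg 6) l) :
    Runs W ask t copyProg σ fun σ' c => σ'.reg 7 = l.length ∧
      (List.range l.length).map (σ'.arr 10) = l ∧ c ≤ 5 * l.length + 2 := by
  refine Runs.cons (R := fun σ' c => σ'.reg 7 = 0 ∧ c = 1)
    ⟨_, _, .const σ 7 0 (Nat.zero_le _), by simp [Memory.setReg], rfl⟩ ?_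
  intro σ₁ c₁ hF₁ ⟨h7, hc₁⟩
  refine Runs.cons (R := fun σ' c => σ'.reg 7 = l.length ∧
      (List.range l.length).map (σ'.arr 10) = l ∧ c ≤ 5 * l.length + 1) ?_
    fun σ₂ c₂ _ ⟨h1, h2, h3⟩ => Runs.nil ⟨h1, h2, by linarith⟩
  refine Runs.loop ht
    (fun σ' => ∃ l₁ l₂, l = l₁ ++ l₂ ∧ σ'.reg 7 = l₁.length ∧
      (List.range l₁.length).map (σ'.arr 10) = l₁ ∧ Linked (σ'.arr 9) (σ'.reg 6) l₂)
    (fun σ' => 5 * ((l.length : ℝ) - σ'.reg 7)) ?_ ?_ ?_ ?_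
  · refine ⟨[], l, rfl, h7, rfl, ?_⟩
    rwa [hF₁.arr 9 (by decide), hF₁.reg 6 (by decide)]
  · rintro σ' ⟨l₁, l₂, rfl, h, -, -⟩
    rw [h, List.length_append]
    push_cast
    linarith [(Nat.cast_nonneg l₂.length : (0 : ℝ) ≤ _)]
  · rintro σ' hF ⟨l₁, l₂, rfl, h1, h2, h3⟩ hb
    have hone' : σ'.reg 2 = 1 := by rw [hF.reg 2 (by decide), hF₁.reg 2 (by decide), hone]
    have hzero' : σ'.reg 14 = 0 := by rw [hF.reg 14 (by decide), hF₁.reg 14 (by decide), hzero]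
    cases l₂ with
    | nil => exact absurd (h3.trans hzero'.symm) hb
    | cons a l₂ =>
      rw [List.length_append, List.length_cons] at hW
      apply Runs.of_wp
      simp only [Prog.block, Prog.wp, Memory.setReg_reg, Memory.setReg_arr, Memory.setArr_arr,
        Memory.setArr_reg, if_true, hone', h1, h3.1, reduceIte, Nat.reduceEqDiff,
        Nat.add_sub_cancel]
      refine ⟨by omega, ⟨l₁ ++ [a], l₂, by simp, by simp, ?_, h3.2⟩, ?_⟩
      · rw [List.length_append, List.length_singleton, List.range_succ, List.map_append]
        congr 1
        · rw [← h2]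
          simp only [List.length_map, List.length_range]
          refine List.map_congr_left fun i hi => ?_
          rw [List.mem_range] at hi
          exact Function.update_of_ne hi.ne ..
        · simp
      · push_cast
        linarith
  · rintro σ' c hF ⟨l₁, l₂, h0, h1, h2, h3⟩ hb hc
    have hzero' : σ'.reg 14 = 0 := by rw [hF.reg 14 (by decide), hF₁.reg 14 (by decide), hzero]
    have hb' : σ'.reg 6 = 0 := (not_not.1 hb).trans hzero'
    cases l₂ with
    | cons a l₂ => rw [hb'] at h3; exact absurd h3.1 (by omega)
    | nil =>
      rw [List.append_nil] at h0
      subst h0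
      refine ⟨h1, h2, ?_⟩
      rw [h7, h1] at hc
      push_cast at hc
      linarith

/-- The total time of the queries for the blocks of an assignment. -/
theorem sum_blocks_le {lab : Fin n → Fin n} {Y : ℝ}
    (hY : ∀ l : List ℕ, (∀ m ∈ l, 0 < m) → l.sum = n → (l.map t).sum ≤ Y) :
    ∑ j ∈ Finset.range n, (5 * ((Finset.univ.filter fun v => (lab v : ℕ) = j).card : ℝ) +
      if (Finset.univ.filter fun v => (lab v : ℕ) = j).card = 0 then 0 else
        t (Finset.univ.filter fun v => (lab v : ℕ) = j).card) ≤ 5 * n + Y := by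
  set m : ℕ → ℕ := fun j => (Finset.univ.filter fun v => (lab v : ℕ) = j).card with hm
  have hsum : ∑ j ∈ Finset.range n, m j = n := by
    have := Finset.card_eq_sum_card_fiberwise (s := (Finset.univ : Finset (Fin n)))
      (f := fun v => (lab v : ℕ)) (t := Finset.range n) (fun v _ => by simp)
    rw [Finset.card_univ, Fintype.card_fin] at this
    exact this.symm
  have hlist : ((List.range n).map m).sum = n := by
    have h : ((List.range n).map m).sum = ∑ j ∈ Finset.range n, m j := rfl
    rw [h, hsum]
  have h := hY (((List.range n).map m).filter (0 < ·))
    (fun a ha => by simpa using (List.mem_filter.1 ha).2)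
    (by rw [List.sum_filter_pos, hlist])
  rw [List.sum_map_filter_pos, List.map_map] at h
  have h' : (List.map ((fun m => if m = 0 then 0 else t m) ∘ m) (List.range n)).sum =
      ∑ j ∈ Finset.range n, if m j = 0 then 0 else t (m j) := rfl
  rw [h'] at h
  rw [Finset.sum_add_distrib, ← Finset.mul_sum]
  have : (∑ j ∈ Finset.range n, (m j : ℝ)) = n := by
    exact_mod_cast congrArg (Nat.cast (R := ℝ)) hsum
  rw [this]
  linarith

open Classical in
theorem runs_queryProg {σ : Memory} {lab : Fin n → Fin n} {Y : ℝ} (hW : n + 2 ≤ W)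
    (hY : ∀ l : List ℕ, (∀ m ∈ l, 0 < m) → l.sum = n → (l.map t).sum ≤ Y)
    (hE : Env k T par pos σ)
    (hidem : ∀ w, lab (lab w) = lab w) (hsub : ∀ w, IsSubtree G (fiber lab (lab w)))
    (hlist : ∀ x : Fin n, ∃ l : List (Fin n), l.Nodup ∧ (∀ v, v ∈ l ↔ lab v = x) ∧
        Linked (σ.arr 9) (σ.arr 8 x) (l.map Fin.val)) :
    Runs W (OneSinkOracle G f) t queryProg σ fun σ' c =>
      σ'.reg 13 = (if Affordable f T lab then 1 else 0) ∧ c ≤ 15 * n + Y + 3 := by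
  refine Runs.cons (R := fun σ' c => σ'.reg 13 = 1 ∧ c = 1)
    ⟨_, _, .const σ 13 1 (by omega), by simp [Memory.setReg], rfl⟩ ?_
  intro σ₁ c₁ hF₁ ⟨h13, hc₁⟩
  have hE₁ := hE.frame hF₁ (by decide) (by decide) (by decide)
  refine Runs.cons (R := fun σ' c => σ'.reg 13 = (if Affordable f T lab then 1 else 0) ∧
      c ≤ 15 * n + Y + 2) ?_ fun σ₂ c₂ _ ⟨h1, h2⟩ => Runs.nil ⟨h1, by linarith⟩
  let m : ℕ → ℕ := fun j => (Finset.univ.filter fun v => (lab v : ℕ) = j).card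
  refine Runs.for ht (M := n)
    (fun i σ' => σ'.reg 13 =
      if ∀ w, (lab w : ℕ) < i → f (fiber lab (lab w)) (lab w) ≤ T then 1 else 0)
    (fun j => 8 + (5 * (m j : ℝ) + if m j = 0 then 0 else t (m j)))
    (fun j => by
      have := ht (m j)
      split_ifs <;> positivity)
    (by decide) (by decide) (by decide) (by decide)
    (by decide) hE₁.reg_n hE₁.one (by omega) (by simp [Memory.setReg_reg, h13]) ?_ ?_
  · intro i σ' hi hF hi4 hI
    have hE' := hE₁.frame hF (by decide) (by decide) (by decide)
    obtain ⟨x, rfl⟩ : ∃ x : Fin n, (x : ℕ) = i := ⟨⟨i, hi⟩, rfl⟩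
    have h8 : σ'.arr 8 = σ.arr 8 := by rw [hF.arr 8 (by decide), hF₁.arr 8 (by decide)]
    have h9 : σ'.arr 9 = σ.arr 9 := by rw [hF.arr 9 (by decide), hF₁.arr 9 (by decide)]
    obtain ⟨l, hnd, hmem, hlink⟩ := hlist x
    have hfib : l.toFinset = fiber lab x := by ext v; simp [hmem]
    have hlen : m x = l.length := by
      rw [← List.toFinset_card_of_nodup hnd, hfib]
      simp only [m, fiber, Fin.val_inj]
    refine Runs.cons (R := fun τ c => τ = σ'.setReg 6 (σ.arr 8 x) ∧ c = 1)
      ⟨_, _, .load σ' 6 8 4, by rw [hi4, h8], rfl⟩ ?_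
    rintro _ _ - ⟨rfl, rfl⟩
    refine Runs.cons (R := fun τ c => τ.reg 13 = (if ∀ w, (lab w : ℕ) < x + 1 →
        f (fiber lab (lab w)) (lab w) ≤ T then 1 else 0) ∧
        c ≤ 7 + (5 * (m x : ℝ) + if m x = 0 then 0 else t (m x))) ?_
      fun τ c _ ⟨h1, h2⟩ => Runs.nil ⟨by simpa [Memory.setReg_reg] using h1, by linarith⟩
    refine Runs.ite (fun hb => ?_) fun hb => ?_
    · -- the block is empty
      have hb' : σ.arr 8 x = 0 := by
        simpa [Test.Holds, Memory.setReg_reg, hE'.zero] using hb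
      have hnil : l = [] := by
        cases l with
        | nil => rfl
        | cons a l => rw [hb'] at hlink; exact absurd hlink.1 (by omega)
      apply Runs.of_wp
      simp only [Prog.wp, Memory.setReg_reg, reduceIte, Nat.reduceEqDiff]
      constructor
      · rw [hI]
        congr 1
        refine propext (forall_congr' fun w => ?_)
        have : (lab w : ℕ) ≠ x := by
          rw [Ne, Fin.val_inj, ← hmem w, hnil]; simp
        have h2 : (lab w : ℕ) < x + 1 ↔ (lab w : ℕ) < x := by omega
        rw [h2]
      · have := ht (m x)
        split_ifs <;> · have : (0 : ℝ) ≤ m x := by positivity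
                        linarith
    · have hb' : σ.arr 8 x ≠ 0 := by
        simpa [Test.Holds, Memory.setReg_reg, hE'.zero] using hb
      have hne : l ≠ [] := by
        rintro rfl
        exact hb' hlink
      obtain ⟨w, hw⟩ := List.exists_mem_of_ne_nil l hne
      rw [hmem] at hw
      have hm0 : m x ≠ 0 := by rw [hlen]; simpa using hne
      rw [if_neg hm0, hlen]
      have hln : l.length ≤ n := by
        rw [← List.toFinset_card_of_nodup hnd]
        simpa using Finset.card_le_univ l.toFinset
      refine Runs.cons (runs_copyProg ht (l := l.map Fin.val) (by simpa using by omega)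
        (by simpa [Memory.setReg_reg] using hE'.one) (by simpa [Memory.setReg_reg] using hE'.zero)
        (by simpa [Memory.setReg_reg, Memory.setReg_arr, h9] using hlink)) ?_
      rintro τ c hFτ ⟨h7, h10, hc⟩
      rw [List.length_map] at h7 h10 hc
      have h4 : τ.reg 4 = x := by
        rw [hFτ.reg 4 (by decide)]; simpa [Memory.setReg_reg] using hi4
      have h13' : τ.reg 13 = σ'.reg 13 := by
        rw [hFτ.reg 13 (by decide)]; simp [Memory.setReg_reg]
      have hcost : τ.cost 0 = T := by
        rw [hFτ.cost 0 (by decide)]; exact hE'.cost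
      refine Runs.cons (R := fun τ' c' => τ' = τ.setCost 1 (f (fiber lab x) x) ∧
        c' = 1 + t l.length) (Runs.query (a := f (fiber lab x) x) ?_ ⟨rfl, by rw [h7]⟩) ?_
      · rw [h7, h10, h4, ← hfib]
        refine OneSinkOracle.answer l x hnd ?_ ?_
        · rw [hfib, ← hw]; exact hsub w
        · rw [hmem, ← hw]; exact hidem w
      rintro _ _ - ⟨rfl, rfl⟩
      apply Runs.of_wp
      simp only [Prog.block, Prog.wp, Test.Holds, Memory.setCost_cost, Memory.setReg_reg,
        Memory.setCost_reg, zero_ne_one, if_false, if_true, hcost, h13', hI]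
      have hiff : (∀ v, (lab v : ℕ) < x + 1 → f (fiber lab (lab v)) (lab v) ≤ T) ↔
          (∀ v, (lab v : ℕ) < x → f (fiber lab (lab v)) (lab v) ≤ T) ∧
            f (fiber lab x) x ≤ T := by
        constructor
        · refine fun h => ⟨fun v hv => h v (by omega), ?_⟩
          have := h w (by rw [hw]; omega)
          rwa [hw] at this
        · rintro ⟨h, h'⟩ v hv
          rcases Nat.lt_succ_iff_lt_or_eq.1 hv with hv | hv
          · exact h v hv
          · rw [Fin.val_inj] at hv; rwa [hv]
      simp only [hiff]
      refine ⟨fun h => ⟨?_, by linarith⟩, fun h => ⟨by omega, ?_, by linarith⟩⟩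
      · simp [h]
      · simp [h]
  · intro σ' c _ hI hc
    have hsum := sum_blocks_le ht (lab := lab) hY
    refine ⟨?_, hc.trans ?_⟩
    · rw [hI]
      congr 1
      exact propext ⟨fun h w => h w (lab w).2, fun h w _ => h w⟩
    · have : ∑ j ∈ Finset.range n, (8 + (5 * (m j : ℝ) + if m j = 0 then 0 else t (m j)) + 2) =
          10 * n + ∑ j ∈ Finset.range n, (5 * (m j : ℝ) + if m j = 0 then 0 else t (m j)) := by
        rw [Finset.sum_congr rfl fun j _ => show _ = 10 + (5 * (m j : ℝ) +
          if m j = 0 then 0 else t (m j)) by ring, Finset.sum_add_distrib]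
        simp [mul_comm]
      rw [this]
      linarith

open Classical in
theorem runs_testProg (hr : IsRooted G r par pos) (hpos : ∀ v, pos v < n) (hr0 : (r : ℕ) = 0)
    {σ : Memory} {fl : Fin n → ℕ} {b : Fin n → Fin n} {j : ℕ} {Y : ℝ} (hW : n + 2 ≤ W)
    (hY : ∀ l : List ℕ, (∀ m ∈ l, 0 < m) → l.sum = n → (l.map t).sum ≤ Y)
    (hE : Env k T par pos σ) (hfl : ∀ v : Fin n, σ.arr 6 v = fl v)
    (hb : IsBest r par pos fl b) (hb7 : ∀ v : Fin n, σ.arr 7 v = b v)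
    (hsole : ∀ q s, fl q ≤ pos q → Anc r par q s → fl s ≤ pos q → s = q) (hj : σ.reg 3 = j) :
    Runs W (OneSinkOracle G f) t testProg σ fun σ' c =>
      (∃ lab, IsLab r par pos fl b j lab ∧ (∀ v : Fin n, σ'.arr 2 v = lab v) ∧
        σ'.reg 13 = if Affordable f T lab then 1 else 0) ∧ c ≤ 33 * n + Y + 9 := by
  refine Runs.cons (runs_labProg ht hr hpos hr0 hW hE hfl hb7 hj) ?_
  rintro σ₁ c₁ hF₁ ⟨⟨⟨lab, hl, hlab⟩, hhead⟩, hc₁⟩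
  have hE₁ := hE.frame hF₁ (by decide) (by decide) (by decide)
  refine Runs.cons (runs_bucketProg ht hW hE₁ hlab hhead) ?_
  rintro σ₂ c₂ hF₂ ⟨hlist, hc₂⟩
  have hE₂ := hE₁.frame hF₂ (by decide) (by decide) (by decide)
  refine Runs.cons (runs_queryProg ht (f := f) hW hY hE₂ (hl.idem hr hb hsole)
    (hl.isSubtree hr hb hsole) hlist) ?_
  rintro σ₃ c₃ hF₃ ⟨h13, hc₃⟩
  refine Runs.nil ⟨⟨lab, hl, fun v => ?_, h13⟩, by linarith⟩
  rw [hF₃.arr 2 (by decide), hF₂.arr 2 (by decide), hlab]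

end Programs

/-! ### Rounds of the greedy algorithm -/

section Programs

/-- Find, by binary search, a position `j` (in register `18`) such that the assignment for `j + 1`
has affordable blocks and that for `j` has not. Register `20` holds `j + 1`. -/
def searchProg : Prog := .block [
  .block [.const 18 0, .move 19 0, .add 20 18 2],
  .loop (.lt 20 19) (.block [
    .block [.add 3 18 19, .half 3 3],
    testProg,
    .block [.ite (.ne 13 14) (.move 19 3) (.move 18 3), .add 20 18 2]])]

/-- Let `u` be the vertex at the position in register `18`. If `u` is served, its sink is declared
dead; otherwise `u` becomes a sink. Register `17` counts the sinks; if there are more than `k` of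
them, register `16` is set to `0`, which ends the computation. -/
def eventProg : Prog := .block [
  .load 6 4 18,
  .load 7 7 6,
  .load 8 6 7,
  .ite (.le 8 18)
    (.store 6 7 20)
    (.block [
      .store 6 6 14,
      .add 17 17 2,
      .ite (.lt 1 17) (.const 16 0) .skip])]

/-- Count the sinks of the assignment in array `2`. -/
def countProg : Prog := .block [
  .const 5 0,
  .for 4 0 (.block [
    .load 6 2 4,
    .ite (.eq 6 4) (.add 5 5 2) .skip])]

/-- One round: if all blocks of the assignment for position `0` are affordable, the computation
ends; otherwise a sink is placed or declared dead. Register `15` receives the answer. -/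
def roundProg : Prog := .block [
  bestProg,
  .const 3 0,
  testProg,
  .ite (.ne 13 14)
    (.block [
      countProg,
      .block [.ite (.le 5 1) (.const 15 1) .skip, .const 16 0]])
    (.block [searchProg, eventProg])]

/-- The number of sinks that have been placed. -/
def sinkCount {n : ℕ} (pos fl : Fin n → ℕ) : ℕ := (Finset.univ.filter fun v => fl v ≤ pos v).card

/-- The number of sinks that have been declared dead. -/
def deadCount {n : ℕ} (pos fl : Fin n → ℕ) : ℕ :=
  (Finset.univ.filter fun v => fl v ≤ pos v ∧ fl v ≠ 0).card

theorem deadCount_le_sinkCount {n : ℕ} (pos fl : Fin n → ℕ) :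
    deadCount pos fl ≤ sinkCount pos fl :=
  Finset.card_le_card fun v hv => by
    simp only [Finset.mem_filter] at hv ⊢
    exact ⟨hv.1, hv.2.1⟩

theorem sinkCount_place {n : ℕ} {pos fl : Fin n → ℕ} {u : Fin n} (hu : ¬ fl u ≤ pos u) :
    sinkCount pos (Function.update fl u 0) = sinkCount pos fl + 1 := by
  have : (Finset.univ.filter fun v => Function.update fl u 0 v ≤ pos v) =
      insert u (Finset.univ.filter fun v => fl v ≤ pos v) := by
    ext v
    by_cases h : v = u
    · subst h; simp
    · simp [h]
  rw [sinkCount, this, Finset.card_insert_of_notMem (by simpa using hu), sinkCount]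

theorem deadCount_place {n : ℕ} {pos fl : Fin n → ℕ} {u : Fin n} (hu : ¬ fl u ≤ pos u) :
    deadCount pos (Function.update fl u 0) = deadCount pos fl := by
  rw [deadCount, deadCount]
  congr 1
  ext v
  by_cases h : v = u
  · subst h; simp; omega
  · simp [h]

theorem sinkCount_kill {n : ℕ} {pos fl : Fin n → ℕ} {s : Fin n} {m : ℕ} (hs : fl s = 0)
    (hm : m ≤ pos s) : sinkCount pos (Function.update fl s m) = sinkCount pos fl := by
  rw [sinkCount, sinkCount]
  congr 1
  ext v
  by_cases h : v = s
  · subst h; simp [hs, hm]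
  · simp [h]

theorem deadCount_kill {n : ℕ} {pos fl : Fin n → ℕ} {s : Fin n} {m : ℕ} (hs : fl s = 0)
    (hm : m ≤ pos s) (hm0 : m ≠ 0) :
    deadCount pos (Function.update fl s m) = deadCount pos fl + 1 := by
  have : (Finset.univ.filter fun v => Function.update fl s m v ≤ pos v ∧
      Function.update fl s m v ≠ 0) =
      insert s (Finset.univ.filter fun v => fl v ≤ pos v ∧ fl v ≠ 0) := by
    ext v
    by_cases h : v = s
    · subst h; simp [hm, hm0]
    · simp [h]
  rw [deadCount, this, Finset.card_insert_of_notMem (by simp [hs]), deadCount]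

variable {W : ℕ} {t : ℕ → ℝ} (ht : ∀ m, 0 ≤ t m)
  {n k : ℕ} {T : ℝ≥0} {par : Fin n → Fin n} {pos : Fin n → ℕ} {r : Fin n}
  {G : SimpleGraph (Fin n)} {f : Finset (Fin n) → Fin n → ℝ≥0∞}
  {ask : List ℕ → ℕ → ℝ≥0∞ → Prop} {Y : ℝ}
include ht

theorem runs_countProg {σ : Memory} {lab : Fin n → Fin n} (hW : n + 2 ≤ W)
    (hE : Env k T par pos σ) (hlab : ∀ v : Fin n, σ.arr 2 v = lab v) :
    Runs W ask t countProg σ fun σ' c =>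
      σ'.reg 5 = (Finset.univ.filter fun v => lab v = v).card ∧ c ≤ 5 * n + 3 := by
  refine Runs.cons (R := fun σ' c => σ'.reg 5 = 0 ∧ c = 1)
    ⟨_, _, .const σ 5 0 (Nat.zero_le _), by simp [Memory.setReg], rfl⟩ ?_
  intro σ₁ c₁ hF₁ ⟨h5, hc₁⟩
  have hE₁ := hE.frame hF₁ (by decide) (by decide) (by decide)
  refine Runs.cons (R := fun σ' c => σ'.reg 5 = (Finset.univ.filter fun v => lab v = v).card ∧
    c ≤ 5 * n + 2) ?_ fun σ₂ c₂ _ ⟨h1, h2⟩ => Runs.nil ⟨h1, by linarith⟩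
  refine Runs.for ht (M := n)
    (fun i σ' => σ'.reg 5 = (Finset.univ.filter fun v : Fin n => (v : ℕ) < i ∧ lab v = v).card)
    (fun _ => 3) (fun _ => by norm_num) (by decide) (by decide) (by decide) (by decide)
    (by decide) hE₁.reg_n hE₁.one (by omega) (by simp [Memory.setReg_reg, h5]) ?_ ?_
  · intro i σ' hi hF hi4 hI
    have hE' := hE₁.frame hF (by decide) (by decide) (by decide)
    have hlab' : ∀ v : Fin n, σ'.arr 2 v = lab v := by
      rwa [hF.arr 2 (by decide), hF₁.arr 2 (by decide)]
    obtain ⟨w, rfl⟩ : ∃ w : Fin n, (w : ℕ) = i := ⟨⟨i, hi⟩, rfl⟩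
    have hle : (Finset.univ.filter fun v : Fin n => (v : ℕ) < w ∧ lab v = v).card ≤ n := by
      simpa using Finset.card_le_univ (Finset.univ.filter fun v : Fin n => (v : ℕ) < w ∧ lab v = v)
    apply Runs.of_wp
    simp only [Prog.block, Prog.wp, Memory.setReg_reg, Test.Holds, if_true, hi4, hE'.one, hlab',
      hI, reduceIte, Nat.reduceEqDiff, Fin.val_inj]
    refine ⟨fun h => ⟨by omega, ?_, by norm_num⟩, fun h => ⟨?_, by norm_num⟩⟩
    · rw [← Finset.card_insert_of_notMem (a := w) (by simp)]
      congr 1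
      ext v
      simp only [Finset.mem_insert, Finset.mem_filter, Finset.mem_univ, true_and,
        Nat.lt_succ_iff_lt_or_eq, Fin.val_inj]
      constructor
      · rintro (rfl | ⟨h1, h2⟩)
        · exact ⟨.inr rfl, h⟩
        · exact ⟨.inl h1, h2⟩
      · rintro ⟨h1 | h1, h2⟩
        · exact .inr ⟨h1, h2⟩
        · exact .inl h1
    · congr 1
      ext v
      simp only [Finset.mem_filter, Finset.mem_univ, true_and, Nat.lt_succ_iff_lt_or_eq,
        Fin.val_inj]
      constructor
      · exact fun ⟨h1, h2⟩ => ⟨.inl h1, h2⟩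
      · rintro ⟨h1 | rfl, h2⟩
        · exact ⟨h1, h2⟩
        · exact absurd h2 h
  · intro σ' c _ hI hc
    refine ⟨by rw [hI]; simp, hc.trans ?_⟩
    simp; linarith

variable (hr : IsRooted G r par pos) (hpos : ∀ v, pos v < n) (hr0 : (r : ℕ) = 0)
  (hf : IsMinmaxMonotone G f) (hW : 2 * n + 2 ≤ W) (hkW : k + 1 ≤ W)
  (hY : ∀ l : List ℕ, (∀ m ∈ l, 0 < m) → l.sum = n → (l.map t).sum ≤ Y) (hY0 : 0 ≤ Y)
include hr hpos hr0 hf hW hY hY0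

theorem runs_searchProg {σ : Memory} {fl : Fin n → ℕ} {b : Fin n → Fin n}
    (hE : Env k T par pos σ) (hfl : ∀ v : Fin n, σ.arr 6 v = fl v)
    (hb : IsBest r par pos fl b) (hb7 : ∀ v : Fin n, σ.arr 7 v = b v)
    (hsole : ∀ q s, fl q ≤ pos q → Anc r par q s → fl s ≤ pos q → s = q)
    (hbad : ∃ lab, IsLab r par pos fl b 0 lab ∧ ¬ Affordable f T lab) :
    Runs W (OneSinkOracle G f) t searchProg σ fun σ' c =>
      (∃ j < n, σ'.reg 18 = j ∧ σ'.reg 20 = j + 1 ∧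
        (∃ lab, IsLab r par pos fl b j lab ∧ ¬ Affordable f T lab) ∧
        ∃ lab, IsLab r par pos fl b (j + 1) lab ∧ Affordable f T lab) ∧
      c ≤ (33 * n + Y + 15) * Nat.clog 2 n + 4 := by
  refine Runs.cons (R := fun σ' c => σ'.reg 18 = 0 ∧ σ'.reg 19 = n ∧ σ'.reg 20 = 1 ∧ c = 3) ?_ ?_
  · apply Runs.of_wp
    simp only [Prog.block, Prog.wp, Memory.setReg_reg, if_true, hE.reg_n, hE.one, reduceIte,
      Nat.reduceEqDiff, OfNat.zero_ne_ofNat]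
    exact ⟨Nat.zero_le _, by omega, trivial, trivial, trivial, by norm_num⟩
  rintro σ₁ c₁ hF₁ ⟨h18, h19, h20, hc₁⟩
  have hE₁ := hE.frame hF₁ (by decide) (by decide) (by decide)
  refine Runs.cons (R := fun σ' c => (∃ j < n, σ'.reg 18 = j ∧ σ'.reg 20 = j + 1 ∧
        (∃ lab, IsLab r par pos fl b j lab ∧ ¬ Affordable f T lab) ∧
        ∃ lab, IsLab r par pos fl b (j + 1) lab ∧ Affordable f T lab) ∧
      c ≤ (33 * n + Y + 15) * Nat.clog 2 n + 1) ?_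
    fun σ₂ c₂ _ ⟨h1, h2⟩ => Runs.nil ⟨h1, by linarith⟩
  have hK : (0 : ℝ) ≤ 33 * n + Y + 15 := by positivity
  refine Runs.loop ht
    (fun σ' => σ'.reg 18 < σ'.reg 19 ∧ σ'.reg 19 ≤ n ∧ σ'.reg 20 = σ'.reg 18 + 1 ∧
      (∃ lab, IsLab r par pos fl b (σ'.reg 18) lab ∧ ¬ Affordable f T lab) ∧
      ∃ lab, IsLab r par pos fl b (σ'.reg 19) lab ∧ Affordable f T lab)
    (fun σ' => (33 * n + Y + 15) * Nat.clog 2 (σ'.reg 19 - σ'.reg 18)) ?_ ?_ ?_ ?_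
  · rw [h18, h19, h20]
    exact ⟨Fin.pos r, le_rfl, rfl, hbad, id, fun w => by rw [if_pos (hpos w)]; rfl,
      affordable_id hf⟩
  · intro σ' _
    positivity
  · rintro σ' hF ⟨h1, h2, h3, h4, h5⟩ hlt
    have hlt' : σ'.reg 18 + 1 < σ'.reg 19 := by
      have : σ'.reg 20 < σ'.reg 19 := hlt
      omega
    have hE' := hE₁.frame hF (by decide) (by decide) (by decide)
    set g := σ'.reg 19 with hg
    set a := σ'.reg 18 with ha
    refine Runs.cons (R := fun τ c => τ.reg 3 = (a + g) / 2 ∧ c = 2) ?_ ?_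
    · apply Runs.of_wp
      simp only [Prog.block, Prog.wp, Memory.setReg_reg, if_true]
      exact ⟨by omega, rfl, by norm_num⟩
    rintro τ₁ c₁' hFτ₁ ⟨hτ3, hc₁'⟩
    have hEτ₁ := hE'.frame hFτ₁ (by decide) (by decide) (by decide)
    refine Runs.cons (runs_testProg ht (f := f) (b := b) (fl := fl) hr hpos hr0 (by omega) hY hEτ₁
      (by rwa [hFτ₁.arr 6 (by decide), hF.arr 6 (by decide), hF₁.arr 6 (by decide)]) hb
      (by rwa [hFτ₁.arr 7 (by decide), hF.arr 7 (by decide), hF₁.arr 7 (by decide)]) hsole hτ3) ?_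
    rintro τ₂ c₂' hFτ₂ ⟨⟨lab, hl, -, h13⟩, hc₂'⟩
    have hEτ₂ := hEτ₁.frame hFτ₂ (by decide) (by decide) (by decide)
    have e18 : τ₂.reg 18 = a := by rw [hFτ₂.reg 18 (by decide), hFτ₁.reg 18 (by decide)]
    have e19 : τ₂.reg 19 = g := by rw [hFτ₂.reg 19 (by decide), hFτ₁.reg 19 (by decide)]
    have e3 : τ₂.reg 3 = (a + g) / 2 := by rw [hFτ₂.reg 3 (by decide), hτ3]
    -- the length of the search interval is halved, up to rounding
    have hlog : ∀ d, d ≤ (g - a + 1) / 2 → (33 * n + Y + 15) * (Nat.clog 2 d : ℝ) +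
        (33 * n + Y + 15) ≤ (33 * n + Y + 15) * (Nat.clog 2 (g - a) : ℝ) := by
      intro d hd
      have h := Nat.clog_of_two_le (b := 2) (n := g - a) (by norm_num) (by omega)
      have h' : Nat.clog 2 d ≤ Nat.clog 2 ((g - a + 2 - 1) / 2) :=
        Nat.clog_mono_right 2 (by omega)
      have h'' : (Nat.clog 2 d : ℝ) + 1 ≤ Nat.clog 2 (g - a) := by
        rw [h]; exact_mod_cast Nat.succ_le_succ h'
      nlinarith
    refine Runs.cons (R := fun τ c => (τ.reg 18 < τ.reg 19 ∧ τ.reg 19 ≤ n ∧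
        τ.reg 20 = τ.reg 18 + 1 ∧
        (∃ lab, IsLab r par pos fl b (τ.reg 18) lab ∧ ¬ Affordable f T lab) ∧
        ∃ lab, IsLab r par pos fl b (τ.reg 19) lab ∧ Affordable f T lab) ∧
        τ.reg 19 - τ.reg 18 ≤ (g - a + 1) / 2 ∧ c = 3) ?_ ?_
    · apply Runs.of_wp
      simp only [Prog.block, Prog.wp, Test.Holds, Memory.setReg_reg, reduceIte, Nat.reduceEqDiff,
        e18, e19, e3, h13, hEτ₂.one, hEτ₂.zero]
      refine ⟨fun h => ⟨by omega, ⟨by omega, by omega, trivial, h4, lab, hl, ?_⟩, by omega,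
        by norm_num⟩, fun h => ⟨by omega, ⟨by omega, by omega, trivial, ⟨lab, hl, ?_⟩, h5⟩,
        by omega, by norm_num⟩⟩
      · by_contra hno; simp [hno] at h
      · intro hyes; simp [hyes] at h
    · rintro τ₃ c₃' - ⟨hI, hd, hc₃'⟩
      refine Runs.nil ⟨hI, ?_⟩
      have := hlog _ hd
      linarith
  · rintro σ' c hF ⟨h1, h2, h3, h4, h5⟩ hge hc
    have hge' : ¬ σ'.reg 20 < σ'.reg 19 := hge
    have h6 : σ'.reg 19 = σ'.reg 18 + 1 := by omega
    refine ⟨⟨σ'.reg 18, by omega, rfl, h3, h4, h6 ▸ h5⟩, ?_⟩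
    rw [h18, h19, Nat.sub_zero] at hc
    have : 0 ≤ (33 * (n : ℝ) + Y + 15) * Nat.clog 2 (σ'.reg 19 - σ'.reg 18) := by positivity
    linarith

/-- The answer in register `15` is right; if it is positive, array `2` holds a solution. -/
def IsAnswer (G : SimpleGraph (Fin n)) (f : Finset (Fin n) → Fin n → ℝ≥0∞) (k : ℕ) (T : ℝ≥0)
    (σ : Memory) : Prop :=
  (σ.reg 15 = 1 ∧ ∃ S P, IsFeasible G f k T S P ∧
    ∀ s ∈ S, ∀ v ∈ P s, σ.arr 2 (v : ℕ) = (s : ℕ)) ∨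
  (σ.reg 15 = 0 ∧ ¬ ∃ S P, IsFeasible G f k T S P)

include hkW in
theorem runs_roundProg {σ : Memory} {fl : Fin n → ℕ}
    (hE : Env k T par pos σ) (hfl : ∀ v : Fin n, σ.arr 6 v = fl v)
    (hinv : GreedyInv G r par pos f T fl) (hsinks : σ.reg 17 = sinkCount pos fl)
    (hk : sinkCount pos fl ≤ k) (h15 : σ.reg 15 = 0) :
    Runs W (OneSinkOracle G f) t roundProg σ fun σ' c =>
      ((σ'.reg 16 = 0 ∧ IsAnswer G f k T σ') ∨
        (σ'.reg 16 = σ.reg 16 ∧ ∃ fl' : Fin n → ℕ, (∀ v : Fin n, σ'.arr 6 v = fl' v) ∧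
          GreedyInv G r par pos f T fl' ∧ σ'.reg 17 = sinkCount pos fl' ∧ sinkCount pos fl' ≤ k ∧
          σ'.reg 15 = 0 ∧ sinkCount pos fl' + deadCount pos fl' =
            sinkCount pos fl + deadCount pos fl + 1)) ∧
      c ≤ (33 * n + Y + 15) * Nat.clog 2 n + 60 * n + Y + 40 := by
  classical
  have hclog : 0 ≤ (33 * (n : ℝ) + Y + 15) * Nat.clog 2 n := by positivity
  refine Runs.cons (runs_bestProg ht hr hpos (by omega) hE hfl) ?_
  rintro σ₁ c₁ hF₁ ⟨⟨b, hb, hb7⟩, hc₁⟩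
  have hE₁ := hE.frame hF₁ (by decide) (by decide) (by decide)
  refine Runs.cons (R := fun σ' c => σ'.reg 3 = 0 ∧ c = 1)
    ⟨_, _, .const σ₁ 3 0 (Nat.zero_le _), by simp [Memory.setReg], rfl⟩ ?_
  rintro σ₂ c₂ hF₂ ⟨h3, hc₂⟩
  have hE₂ := hE₁.frame hF₂ (by decide) (by decide) (by decide)
  refine Runs.cons (runs_testProg ht (f := f) (b := b) (fl := fl) hr hpos hr0 (by omega) hY hE₂
    (by rwa [hF₂.arr 6 (by decide), hF₁.arr 6 (by decide)]) hb
    (by rwa [hF₂.arr 7 (by decide)]) hinv.sole h3) ?_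
  rintro σ₃ c₃ hF₃ ⟨⟨lab, hl, hlab, h13⟩, hc₃⟩
  have hE₃ := hE₂.frame hF₃ (by decide) (by decide) (by decide)
  have hfl₃ : ∀ v : Fin n, σ₃.arr 6 v = fl v := by
    rwa [hF₃.arr 6 (by decide), hF₂.arr 6 (by decide), hF₁.arr 6 (by decide)]
  have hb7₃ : ∀ v : Fin n, σ₃.arr 7 v = b v := by
    rwa [hF₃.arr 7 (by decide), hF₂.arr 7 (by decide)]
  have hreg₃ : ∀ x ∈ [15, 16, 17], σ₃.reg x = σ.reg x := by
    intro x hx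
    have h1 : x ∉ testProg.regs := by revert x; decide
    have h2 : x ∉ (Prog.const 3 0).regs := by revert x; decide
    have h3 : x ∉ bestProg.regs := by revert x; decide
    rw [hF₃.reg x h1, hF₂.reg x h2, hF₁.reg x h3]
  refine Runs.cons (R := fun σ' c => ((σ'.reg 16 = 0 ∧ IsAnswer G f k T σ') ∨
        (σ'.reg 16 = σ.reg 16 ∧ ∃ fl' : Fin n → ℕ, (∀ v : Fin n, σ'.arr 6 v = fl' v) ∧
          GreedyInv G r par pos f T fl' ∧ σ'.reg 17 = sinkCount pos fl' ∧ sinkCount pos fl' ≤ k ∧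
          σ'.reg 15 = 0 ∧ sinkCount pos fl' + deadCount pos fl' =
            sinkCount pos fl + deadCount pos fl + 1)) ∧
      c ≤ (33 * n + Y + 15) * Nat.clog 2 n + 5 * n + 20) ?_
    fun σ' c _ ⟨h1, h2⟩ => Runs.nil ⟨h1, by linarith⟩
  refine Runs.ite (fun hok => ?_) fun hok => ?_
  · have haff : Affordable f T lab := by
      by_contra hno
      have h : σ₃.reg 13 ≠ σ₃.reg 14 := hok
      rw [h13, if_neg hno, hE₃.zero] at h
      exact h rfl
    refine Runs.cons (runs_countProg ht (by omega) hE₃ hlab) ?_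
    rintro σ₄ c₄ hF₄ ⟨h5, hc₄⟩
    have hE₄ := hE₃.frame hF₄ (by decide) (by decide) (by decide)
    have himage : (Finset.univ.filter fun v => lab v = v) = Finset.univ.image lab := by
      ext v
      simp only [Finset.mem_filter, Finset.mem_univ, true_and, Finset.mem_image]
      exact ⟨fun h => ⟨v, h⟩, fun ⟨w, hw⟩ => hw ▸ haff.idem hf w⟩
    rw [himage] at h5
    have h15' : σ₄.reg 15 = 0 := by
      rw [hF₄.reg 15 (by decide), hreg₃ 15 (by simp), h15]
    have hlab' : ∀ v : Fin n, σ₄.arr 2 v = lab v := by rwa [hF₄.arr 2 (by decide)]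
    refine Runs.cons (R := fun σ' c => (σ'.reg 16 = 0 ∧ IsAnswer G f k T σ') ∧ c ≤ 3) ?_
      fun σ' c _ ⟨h1, h2⟩ => Runs.nil ⟨.inl h1, by linarith⟩
    apply Runs.of_wp
    simp only [Prog.block, Prog.wp, Test.Holds, IsAnswer, Memory.setReg_reg, Memory.setReg_arr,
      reduceIte, Nat.reduceEqDiff, h5, hE₄.reg_k, h15']
    refine ⟨fun hle => ⟨by omega, Nat.zero_le _, ⟨trivial, .inl ⟨trivial, _, _,
      haff.isFeasible hf hle, ?_⟩⟩, by norm_num⟩, fun hgt => ⟨Nat.zero_le _, ⟨trivial,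
      .inr ⟨trivial, fun h => hgt (hl.card_le hr hf hb hinv rfl h)⟩⟩, by norm_num⟩⟩
    intro s _ v hv
    rw [hlab', mem_fiber.1 hv]
  · have hnaff : ¬ Affordable f T lab := by
      intro hyes
      have h : ¬ σ₃.reg 13 ≠ σ₃.reg 14 := hok
      rw [h13, if_pos hyes, hE₃.zero] at h
      exact h one_ne_zero
    refine Runs.cons (runs_searchProg ht hr hpos hr0 hf hW hY hY0 hE₃ hfl₃ hb hb7₃ hinv.sole
      ⟨lab, hl, hnaff⟩) ?_
    rintro σ₄ c₄ hF₄ ⟨⟨j, hj, h18, h20, ⟨lab₀, hl₀, ha₀⟩, lab₁, hl₁, ha₁⟩, hc₄⟩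
    have hE₄ := hE₃.frame hF₄ (by decide) (by decide) (by decide)
    have hfl₄ : ∀ v : Fin n, σ₄.arr 6 v = fl v := by rwa [hF₄.arr 6 (by decide)]
    have hb7₄ : ∀ v : Fin n, σ₄.arr 7 v = b v := by rwa [hF₄.arr 7 (by decide)]
    have h15₄ : σ₄.reg 15 = 0 := by
      rw [hF₄.reg 15 (by decide), hreg₃ 15 (by simp), h15]
    have h16₄ : σ₄.reg 16 = σ.reg 16 := by
      rw [hF₄.reg 16 (by decide), hreg₃ 16 (by simp)]
    have h17₄ : σ₄.reg 17 = sinkCount pos fl := by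
      rw [hF₄.reg 17 (by decide), hreg₃ 17 (by simp), hsinks]
    obtain ⟨u, rfl⟩ := hr.exists_pos_eq hpos hj
    obtain ⟨hev₁, hev₂⟩ := IsLab.event hr hf hb hinv hl₀ hl₁ ha₁ ha₀
    refine Runs.cons (R := fun σ' c => ((σ'.reg 16 = 0 ∧ IsAnswer G f k T σ') ∨
        (σ'.reg 16 = σ.reg 16 ∧ ∃ fl' : Fin n → ℕ, (∀ v : Fin n, σ'.arr 6 v = fl' v) ∧
          GreedyInv G r par pos f T fl' ∧ σ'.reg 17 = sinkCount pos fl' ∧ sinkCount pos fl' ≤ k ∧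
          σ'.reg 15 = 0 ∧ sinkCount pos fl' + deadCount pos fl' =
            sinkCount pos fl + deadCount pos fl + 1)) ∧ c ≤ 8) ?_
      fun σ' c _ ⟨h1, h2⟩ => Runs.nil ⟨h1, by linarith⟩
    -- updates of arrays and of functions on `Fin n` correspond
    have hupd : ∀ (s : Fin n) (a : ℕ) (v : Fin n),
        Function.update (σ₄.arr 6) (s : ℕ) a (v : ℕ) = Function.update fl s a v := by
      intro s a v
      rw [Function.update_apply, Function.update_apply, hfl₄]
      simp only [Fin.val_inj]
    apply Runs.of_wp
    simp only [eventProg, Prog.block, Prog.wp, Test.Holds, IsAnswer, Memory.setReg_reg,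
      Memory.setReg_arr, Memory.setArr_arr, Memory.setArr_reg, reduceIte, Nat.reduceEqDiff, h18,
      h20, h15₄, h16₄, h17₄, hE₄.arr_ord, hE₄.reg_k, hE₄.one, hE₄.zero, hb7₄, hfl₄, hupd]
    refine ⟨fun hs => ?_, fun hs => ?_⟩
    · obtain ⟨hne, hbad⟩ := hev₁ hs
      obtain ⟨h0, hinv'⟩ := hinv.kill hr hf hb hl₁ ha₁ hs hne hbad
      have hlt := hr.pos_lt (hb.anc hr u) hne
      refine ⟨.inr ⟨trivial, _, fun v => rfl, hinv', ?_, ?_, trivial, ?_⟩, by norm_num⟩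
      · rw [sinkCount_kill h0 hlt]
      · rwa [sinkCount_kill h0 hlt]
      · rw [sinkCount_kill h0 hlt, deadCount_kill h0 hlt (by omega)]; omega
    · obtain ⟨hur, hbad⟩ := hev₂ hs
      have hinv' := hinv.place hr hf hb hl₁ ha₁ hs hur hbad
      have hu : ¬ fl u ≤ pos u := fun h => hs ((hb.le_self u).trans h)
      have hcard : sinkCount pos (Function.update fl u 0) = sinkCount pos fl + 1 :=
        sinkCount_place hu
      refine ⟨by omega, fun hgt => ⟨Nat.zero_le _, .inl ⟨trivial, .inr ⟨trivial, fun h => ?_⟩⟩,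
        by norm_num⟩, fun hle => ⟨.inr ⟨trivial, _, fun v => rfl, hinv', ?_, ?_, trivial, ?_⟩,
        by norm_num⟩⟩
      · have := hinv'.card_le h
        rw [← sinkCount, hcard] at this
        omega
      · rw [hcard]
      · rw [hcard]; omega
      · rw [hcard, deadCount_place hu]; omega

end Programs

/-! ### Breadth-first search -/

section Search

theorem IsAdjacencyList.off_le {n : ℕ} {G : SimpleGraph (Fin n)} {off adj : ℕ → ℕ}
    (h : IsAdjacencyList G off adj) {a b : ℕ} (hab : a ≤ b) (hb : b ≤ n) : off a ≤ off b := by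
  induction b, hab using Nat.le_induction with
  | base => exact le_rfl
  | succ b _ ih => exact (ih (by omega)).trans (h.mono ⟨b, hb⟩)

theorem IsAdjacencyList.off_le_mul {n : ℕ} {G : SimpleGraph (Fin n)} {off adj : ℕ → ℕ}
    (h : IsAdjacencyList G off adj) {a : ℕ} (ha : a ≤ n) : off a ≤ a * n := by
  induction a with
  | zero => rw [h.zero]; exact Nat.zero_le _
  | succ a ih =>
    have hlt : ∀ j, j < off (a + 1) → adj j < n := fun j hj =>
      h.lt j (hj.trans_le (h.off_le ha le_rfl))
    -- the list of a vertex has no repetitions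
    have hcard : (Finset.Ico (off a) (off (a + 1))).card ≤ (Finset.range n).card := by
      refine Finset.card_le_card_of_injOn adj (fun j hj => ?_) fun i hi j hj hij => ?_
      · simp only [Finset.coe_Ico, Set.mem_Ico] at hj
        simpa using hlt j hj.2
      · simp only [Finset.coe_Ico, Set.mem_Ico] at hi hj
        exact h.inj ⟨a, ha⟩ i j hi.1 hi.2 hj.1 hj.2 hij
    rw [Nat.card_Ico, Finset.card_range] at hcard
    have := ih (by omega)
    rw [Nat.succ_mul]
    omega

/-- The state of a breadth-first search of a rooted tree: `l` is the list of the vertices that have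
been reached, in the order of their discovery. All children of the first `i` vertices have been
reached, and so have those children of the next vertex that satisfy `seen`. -/
structure IsQueue {n : ℕ} (r : Fin n) (par : Fin n → Fin n) (l : List (Fin n)) (i : ℕ)
    (seen : Fin n → Prop) : Prop where
  nodup : l.Nodup
  idx_root : l.idxOf r = 0
  root_mem : r ∈ l
  le_length : i ≤ l.length
  mem_iff : ∀ v, v ≠ r → (v ∈ l ↔ l.idxOf (par v) < i ∨ l.idxOf (par v) = i ∧ seen v)
  idx_par : ∀ v ∈ l, v ≠ r → l.idxOf (par v) < l.idxOf v

variable {n : ℕ} {r : Fin n} {par : Fin n → Fin n} {l : List (Fin n)} {i : ℕ}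
  {seen seen' : Fin n → Prop}

theorem IsQueue.length_le (h : IsQueue r par l i seen) : l.length ≤ n := by
  simpa using h.nodup.length_le_card

theorem IsQueue.init (r : Fin n) (par : Fin n → Fin n) :
    IsQueue r par [r] 0 fun _ => False where
  nodup := List.nodup_singleton r
  idx_root := by simp
  root_mem := by simp
  le_length := by simp
  mem_iff v hv := by simp [hv]
  idx_par v hv hvr := absurd (List.mem_singleton.1 hv) hvr

theorem IsQueue.congr (h : IsQueue r par l i seen)
    (h' : ∀ v, v ≠ r → l.idxOf (par v) = i → (seen v ↔ seen' v)) : IsQueue r par l i seen' :=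
  { h with
    mem_iff := fun v hv => by
      rw [h.mem_iff v hv]
      have := h' v hv
      tauto }

theorem IsQueue.next (h : IsQueue r par l i seen) (hi : i < l.length)
    (hs : ∀ v, v ≠ r → l.idxOf (par v) = i → seen v) : IsQueue r par l (i + 1) fun _ => False :=
  { h with
    le_length := hi
    mem_iff := fun v hv => by
      rw [h.mem_iff v hv, Nat.lt_succ_iff_lt_or_eq]
      have := hs v hv
      tauto }

theorem IsQueue.push (h : IsQueue r par l i seen) (hi : i < l.length) {w : Fin n} (hw : w ∉ l)
    (hwp : l.idxOf (par w) = i) : IsQueue r par (l ++ [w]) i fun v => seen v ∨ v = w := by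
  have hmem : ∀ v, v ∈ l → (l ++ [w]).idxOf v = l.idxOf v := fun v hv =>
    List.idxOf_append_of_mem hv
  have hnot : ∀ v, v ∉ l → l.length ≤ (l ++ [w]).idxOf v := fun v hv => by
    rw [List.idxOf_append_of_notMem hv]; exact Nat.le_add_right _ _
  have hidx : ∀ v m, m < l.length → ((l ++ [w]).idxOf v = m ↔ l.idxOf v = m) := fun v m hm => by
    by_cases hv : v ∈ l
    · rw [hmem v hv]
    · have := hnot v hv
      rw [List.idxOf_of_notMem hv]
      omega
  have hlt : ∀ v m, m < l.length → ((l ++ [w]).idxOf v < m ↔ l.idxOf v < m) := fun v m hm => by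
    by_cases hv : v ∈ l
    · rw [hmem v hv]
    · have := hnot v hv
      rw [List.idxOf_of_notMem hv]
      omega
  have hpos : 0 < l.length := by omega
  refine ⟨?_, (hidx r 0 hpos).2 h.idx_root, by simp [h.root_mem], ?_, fun v hv => ?_,
    fun v hv hvr => ?_⟩
  · rw [List.nodup_append]
    refine ⟨h.nodup, List.nodup_singleton w, ?_⟩
    rintro a ha b hb rfl
    exact hw (List.mem_singleton.1 hb ▸ ha)
  · rw [List.length_append]; omega
  · rw [List.mem_append, List.mem_singleton, h.mem_iff v hv, hlt _ _ hi, hidx _ _ hi]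
    constructor
    · rintro ((h1 | ⟨h1, h2⟩) | rfl)
      · exact .inl h1
      · exact .inr ⟨h1, .inl h2⟩
      · exact .inr ⟨hwp, .inr rfl⟩
    · rintro (h1 | ⟨h1, h2 | h2⟩)
      · exact .inl (.inl h1)
      · exact .inl (.inr ⟨h1, h2⟩)
      · exact .inr h2
  · rw [List.mem_append, List.mem_singleton] at hv
    by_cases hv' : v ∈ l
    · have hp := h.idx_par v hv' hvr
      have hlen := List.idxOf_lt_length_of_mem hv'
      rw [hmem v hv']
      exact (hlt _ _ hlen).2 hp
    · have hvw : v = w := hv.resolve_left hv'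
      have := hnot v hv'
      rw [hvw] at this ⊢
      rw [(hidx _ _ hi).2 hwp]
      omega

theorem IsQueue.mem_of_length_le {G : SimpleGraph (Fin n)}
    (hd : ∀ v, v ≠ r → G.dist r (par v) < G.dist r v)
    (h : IsQueue r par l i seen) (hi : l.length ≤ i) (v : Fin n) : v ∈ l := by
  have key : ∀ m v, G.dist r v < m → v ∈ l := by
    intro m
    induction m with
    | zero => exact fun v hv => absurd hv (Nat.not_lt_zero _)
    | succ m ih =>
      intro v hv
      by_cases hvr : v = r
      · exact hvr ▸ h.root_mem
      · have := hd v hvr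
        exact (h.mem_iff v hvr).2
          (.inl ((List.idxOf_lt_length_of_mem (ih (par v) (by omega))).trans_le hi))
  exact key _ v (Nat.lt_succ_self _)

/-- Look at the neighbour in cell `j` of the adjacency list of `u` (registers `7` and `6`): unless
it is the parent of `u` (register `10`), it is a new vertex. -/
def neighborProg : Prog := .block [
  .load 11 1 7,
  .ite (.eq 11 10) .skip (.block [
    .store 3 11 6,
    .store 4 5 11,
    .store 5 11 5,
    .add 5 5 2]),
  .add 7 7 2]

/-- Search the tree from the root `0`. Register `5` counts the vertices that have been reached and
register `4` those of them whose adjacency list has been read. -/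
def bfsProg : Prog := .block [
  .block [.const 2 1, .const 4 0, .const 5 1],
  .loop (.lt 4 5) (.block [
    .block [.load 6 4 4, .load 7 0 6, .add 8 6 2, .load 9 0 8, .load 10 3 6],
    .loop (.lt 7 9) neighborProg,
    .add 4 4 2])]

/-- The arrays `3`, `4` and `5` describe the state `l` of the search. -/
structure IsStored (par : Fin n → Fin n) (l : List (Fin n)) (σ : Memory) : Prop where
  count : σ.reg 5 = l.length
  arr_par : ∀ v ∈ l, σ.arr 3 v = par v
  arr_ord : ∀ v ∈ l, σ.arr 4 (l.idxOf v) = v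
  arr_pos : ∀ v ∈ l, σ.arr 5 v = l.idxOf v

theorem IsStored.congr {σ σ' : Memory} (h : IsStored par l σ) (h5 : σ'.reg 5 = σ.reg 5)
    (ha : ∀ A ∈ [3, 4, 5], σ'.arr A = σ.arr A) : IsStored par l σ' where
  count := by rw [h5, h.count]
  arr_par := by rw [ha 3 (by simp)]; exact h.arr_par
  arr_ord := by rw [ha 4 (by simp)]; exact h.arr_ord
  arr_pos := by rw [ha 5 (by simp)]; exact h.arr_pos

theorem IsStored.push {σ σ' : Memory} (h : IsStored par l σ) {w : Fin n} (hw : w ∉ l)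
    (h5 : σ'.reg 5 = σ.reg 5 + 1)
    (ha3 : σ'.arr 3 = Function.update (σ.arr 3) w (par w))
    (ha4 : σ'.arr 4 = Function.update (σ.arr 4) l.length w)
    (ha5 : σ'.arr 5 = Function.update (σ.arr 5) w l.length) : IsStored par (l ++ [w]) σ' := by
  have hmem : ∀ v, v ∈ l → (l ++ [w]).idxOf v = l.idxOf v := fun v hv =>
    List.idxOf_append_of_mem hv
  have hw' : (l ++ [w]).idxOf w = l.length := by
    rw [List.idxOf_append_of_notMem hw]; simp
  have hne : ∀ v ∈ l, (v : ℕ) ≠ w := fun v hv h' => hw (Fin.ext h' ▸ hv)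
  refine ⟨by rw [h5, h.count]; simp, ?_, ?_, ?_⟩
  all_goals
    intro v hv
    rw [List.mem_append, List.mem_singleton] at hv
  · rw [ha3]
    rcases hv with hv | rfl
    · rw [Function.update_of_ne (hne v hv), h.arr_par v hv]
    · rw [Function.update_self]
  · rw [ha4]
    rcases hv with hv | rfl
    · rw [hmem v hv, Function.update_of_ne (List.idxOf_lt_length_of_mem hv).ne, h.arr_ord v hv]
    · rw [hw', Function.update_self]
  · rw [ha5]
    rcases hv with hv | rfl
    · rw [hmem v hv, Function.update_of_ne (hne v hv), h.arr_pos v hv]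
    · rw [hw', Function.update_self]

variable {W : ℕ} {ask : List ℕ → ℕ → ℝ≥0∞ → Prop} {t : ℕ → ℝ} (ht : ∀ m, 0 ≤ t m)
  {G : SimpleGraph (Fin n)} {off adj : ℕ → ℕ} (hadj : IsAdjacencyList G off adj)
  (hpr : par r = r) (hd : ∀ v, v ≠ r → G.dist r (par v) < G.dist r v)
  (hpar : ∀ a b, G.Adj a b ↔ (a ≠ r ∧ b = par a) ∨ (b ≠ r ∧ a = par b))
  (hW : n * n + n + 1 ≤ W)
include ht hadj hpr hd hpar hW

/-- Reading the adjacency list of `u` takes time proportional to the number of new vertices, since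
all neighbours but the parent of `u` are new. -/
theorem runs_neighbors {σ : Memory} {u : Fin n} (hq : IsQueue r par l i fun _ => False)
    (hi : i < l.length) (hu : l.idxOf u = i) (hst : IsStored par l σ)
    (h2 : σ.reg 2 = 1) (h6 : σ.reg 6 = u) (h7 : σ.reg 7 = off u) (h9 : σ.reg 9 = off (u + 1))
    (h10 : σ.reg 10 = par u) (hcells : ∀ j < off n, σ.arr 1 j = adj j) :
    Runs W ask t (.loop (.lt 7 9) neighborProg) σ fun σ' c =>
      (∃ l', IsQueue r par l' (i + 1) (fun _ => False) ∧ IsStored par l' σ') ∧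
      c + 8 * (n - σ'.reg 5) ≤ 8 * (n - σ.reg 5) + 9 := by
  classical
  have hul : u ∈ l := List.idxOf_lt_length_iff.1 (hu ▸ hi)
  have hle : off (u + 1) ≤ off n := hadj.off_le u.2 le_rfl
  have hleW : off n ≤ n * n := hadj.off_le_mul le_rfl
  have huadj : ∀ j, off u ≤ j → j < off (u + 1) → ∀ w : Fin n, adj j = w → G.Adj u w :=
    fun j h1 h2 w h3 => (hadj.adj_iff u w).2 ⟨j, h1, h2, h3⟩
  refine Runs.loop ht
    (fun σ' => off u ≤ σ'.reg 7 ∧ σ'.reg 7 ≤ off (u + 1) ∧ ∃ l', i < l'.length ∧ l'.idxOf u = i ∧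
      IsQueue r par l' i (fun v => ∃ j, off u ≤ j ∧ j < σ'.reg 7 ∧ adj j = v) ∧
      IsStored par l' σ')
    (fun σ' => 8 * (n - σ'.reg 5) +
      if ∃ j, off u ≤ j ∧ j < σ'.reg 7 ∧ adj j = par u then 0 else 8) ?_ ?_ ?_ ?_
  · rw [h7]
    refine ⟨le_rfl, hadj.mono u, l, hi, hu, hq.congr fun v _ _ => ?_, hst⟩
    exact ⟨False.elim, fun ⟨j, h1, h2, _⟩ => absurd h1 (by omega)⟩
  · rintro σ' ⟨-, -, l', -, -, hq', hst'⟩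
    have : (σ'.reg 5 : ℝ) ≤ n := by rw [hst'.count]; exact_mod_cast hq'.length_le
    have h0 : (0 : ℝ) ≤ 8 * (n - σ'.reg 5) := by linarith
    split_ifs <;> linarith
  · rintro σ' hF ⟨h7a, h7b, l', hi', hu', hq', hst'⟩ hlt
    have e2 : σ'.reg 2 = 1 := by rw [hF.reg 2 (by decide), h2]
    have e6 : σ'.reg 6 = u := by rw [hF.reg 6 (by decide), h6]
    have e9 : σ'.reg 9 = off (u + 1) := by rw [hF.reg 9 (by decide), h9]
    have e10 : σ'.reg 10 = par u := by rw [hF.reg 10 (by decide), h10]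
    have hlt' : σ'.reg 7 < off (u + 1) := by
      have : σ'.reg 7 < σ'.reg 9 := hlt
      omega
    obtain ⟨w, hw⟩ : ∃ w : Fin n, adj (σ'.reg 7) = w :=
      ⟨⟨_, hadj.lt _ (hlt'.trans_le hle)⟩, rfl⟩
    have hcell : σ'.arr 1 (σ'.reg 7) = w := by
      rw [hF.arr 1 (by decide), hcells _ (by omega), hw]
    have huw := huadj _ h7a hlt' w hw
    have hul' : u ∈ l' := List.idxOf_lt_length_iff.1 (hu' ▸ hi')
    have hpi : ∀ v, l'.idxOf (par v) = i ↔ par v = u := fun v => by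
      rw [← hu', eq_comm, List.idxOf_inj hul', eq_comm]
    have hseen : ∀ v : Fin n, (∃ j, off u ≤ j ∧ j < σ'.reg 7 + 1 ∧ adj j = v) ↔
        (∃ j, off u ≤ j ∧ j < σ'.reg 7 ∧ adj j = v) ∨ v = w := by
      intro v
      constructor
      · rintro ⟨j, h1, h2, h3⟩
        by_cases hj : j = σ'.reg 7
        · rw [hj, hw] at h3; exact .inr (Fin.ext h3.symm)
        · exact .inl ⟨j, h1, by omega, h3⟩
      · rintro (⟨j, h1, h2, h3⟩ | rfl)
        · exact ⟨j, h1, by omega, h3⟩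
        · exact ⟨_, h7a, Nat.lt_succ_self _, hw⟩
    have hnew : ¬ ∃ j, off u ≤ j ∧ j < σ'.reg 7 ∧ adj j = w := by
      rintro ⟨j, h1, h2, h3⟩
      exact h2.ne (hadj.inj u _ _ h1 (by omega) h7a hlt' (h3.trans hw.symm))
    have hlen : l'.length ≤ n := hq'.length_le
    have hn2 : u.1 < n := u.2
    refine Runs.of_wp ?_
    simp only [neighborProg, Prog.block, Prog.wp, Test.Holds, Memory.setReg_reg,
      Memory.setArr_reg, reduceIte, Nat.reduceEqDiff, hcell, e2, e6, e10,
      hst'.count, Fin.val_inj]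
    refine ⟨fun hwp => ⟨by omega, ⟨by omega, by omega, l', hi', hu', ?_, ?_⟩, ?_⟩,
      fun hwp => ⟨by omega, by omega, ⟨by omega, by omega, l' ++ [w], ?_, ?_, ?_, ?_⟩, ?_⟩⟩
    · refine hq'.congr fun v hv hvi => ?_
      rw [hseen v]
      refine ⟨.inl, fun h => h.resolve_right ?_⟩
      -- the parent of `u` is not a child of `u`
      rintro rfl
      rw [hpi] at hvi
      by_cases hur : u = r
      · rw [hur, hpr] at hwp; exact hv hwp
      · have h1 := hd u hur
        have h2 := hd v hv
        rw [hvi, hwp] at h2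
        omega
    · refine hst'.congr ?_ fun A _ => rfl
      simp [Memory.setReg_reg]
    · rw [if_pos ((hseen _).2 (.inr hwp.symm)), if_neg (hwp ▸ hnew)]
      linarith
    all_goals
      obtain ⟨hwr, hpw⟩ : w ≠ r ∧ u = par w := by
        rcases (hpar u w).1 huw with h | h
        · exact absurd h.2 hwp
        · exact h
      have hwi : l'.idxOf (par w) = i := by rw [← hpw, hu']
      have hwl : w ∉ l' := fun h => by
        rcases (hq'.mem_iff w hwr).1 h with h1 | h1
        · omega
        · exact hnew h1.2
    · simp; omega
    · rw [List.idxOf_append_of_mem hul', hu']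
    · exact (hq'.push hi' hwl hwi).congr fun v _ _ => (hseen v).symm
    · refine hst'.push hwl ?_ ?_ ?_ ?_
      all_goals simp [Memory.setReg_reg, Memory.setReg_arr, Memory.setArr_arr, hst'.count, ← hpw]
    · have hmono : (if ∃ j, off u ≤ j ∧ j < σ'.reg 7 + 1 ∧ adj j = par u then (0 : ℝ) else 8) ≤
          if ∃ j, off u ≤ j ∧ j < σ'.reg 7 ∧ adj j = par u then (0 : ℝ) else 8 := by
        split_ifs with h1 h2 h2
        · exact le_rfl
        · norm_num
        · exact absurd ((hseen _).2 (.inl h2)) h1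
        · exact le_rfl
      push_cast
      linarith
  · rintro σ' c hF ⟨h7a, h7b, l', hi', hu', hq', hst'⟩ hge hc
    have e9 : σ'.reg 9 = off (u + 1) := by rw [hF.reg 9 (by decide), h9]
    have hge' : ¬ σ'.reg 7 < σ'.reg 9 := hge
    have h7e : σ'.reg 7 = off (u + 1) := by omega
    have hul' : u ∈ l' := List.idxOf_lt_length_iff.1 (hu' ▸ hi')
    refine ⟨⟨l', hq'.next hi' fun v hv hvi => ?_, hst'⟩, ?_⟩
    · have hpv : par v = u := by
        rw [← hu', eq_comm, List.idxOf_inj hul'] at hvi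
        exact hvi.symm
      rw [h7e]
      exact (hadj.adj_iff u v).1 ((hpar u v).2 (.inr ⟨hv, hpv.symm⟩))
    · have h1 : (if ∃ j, off u ≤ j ∧ j < σ.reg 7 ∧ adj j = par u then (0 : ℝ) else 8) ≤ 8 := by
        split_ifs <;> norm_num
      have h2 : (0 : ℝ) ≤ if ∃ j, off u ≤ j ∧ j < σ'.reg 7 ∧ adj j = par u then (0 : ℝ) else 8 := by
        split_ifs <;> norm_num
      linarith

theorem runs_bfsProg {k : ℕ} {T : ℝ≥0} (hr0 : (r : ℕ) = 0) :
    Runs W ask t bfsProg (initialMemory n k T off adj) fun σ' c =>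
      (∃ pos : Fin n → ℕ, (∀ v, pos v < n) ∧ IsRooted G r par pos ∧ Env k T par pos σ') ∧
      c ≤ 24 * n + 4 := by
  have hn : 0 < n := Fin.pos r
  refine Runs.cons (R := fun σ' c => IsStored par [r] σ' ∧ σ'.reg 2 = 1 ∧ σ'.reg 4 = 0 ∧ c = 3)
    ?_ ?_
  · refine Runs.of_wp ?_
    simp only [Prog.block, Prog.wp, Memory.setReg_reg, reduceIte, Nat.reduceEqDiff]
    refine ⟨by omega, Nat.zero_le _, by omega, ⟨?_, ?_, ?_, ?_⟩, trivial, trivial, by norm_num⟩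
    · simp [Memory.setReg_reg]
    all_goals
      intro v hv
      rw [List.mem_singleton] at hv
      subst hv
      simp [Memory.setReg_arr, initialMemory, hpr, hr0]
  rintro σ₁ c₁ hF₁ ⟨hst₁, h2₁, h4₁, hc₁⟩
  have hreg : ∀ x ∈ [0, 1, 14], σ₁.reg x = (initialMemory n k T off adj).reg x := by
    intro x hx
    refine hF₁.reg x ?_
    revert x
    decide
  refine Runs.cons (R := fun σ' c => (∃ l, IsQueue r par l l.length (fun _ => False) ∧
      IsStored par l σ') ∧ c ≤ 24 * n + 1) ?_ ?_
  · refine Runs.loop ht (fun σ' => ∃ l, IsQueue r par l (σ'.reg 4) (fun _ => False) ∧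
      IsStored par l σ') (fun σ' => 8 * (n - σ'.reg 5) + 16 * (n - σ'.reg 4)) ?_ ?_ ?_ ?_
    · exact ⟨[r], h4₁ ▸ IsQueue.init r par, hst₁⟩
    · rintro σ' ⟨l, hq, hst⟩
      have h1 : (σ'.reg 5 : ℝ) ≤ n := by rw [hst.count]; exact_mod_cast hq.length_le
      have h2 : (σ'.reg 4 : ℝ) ≤ n := by exact_mod_cast hq.le_length.trans hq.length_le
      linarith
    · rintro σ' hF ⟨l, hq, hst⟩ hlt
      have hi : σ'.reg 4 < l.length := by
        have : σ'.reg 4 < σ'.reg 5 := hlt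
        rwa [hst.count] at this
      have e2 : σ'.reg 2 = 1 := by rw [hF.reg 2 (by decide), h2₁]
      obtain ⟨u, hul, hu⟩ : ∃ u ∈ l, l.idxOf u = σ'.reg 4 :=
        ⟨l[σ'.reg 4], List.getElem_mem hi, hq.nodup.idxOf_getElem _ hi⟩
      have hoff : ∀ m ≤ n, σ'.arr 0 m = off m := by
        intro m hm
        rw [hF.arr 0 (by decide), hF₁.arr 0 (by decide)]
        simp [initialMemory, hm]
      have hcells : ∀ j < off n, σ'.arr 1 j = adj j := by
        intro j hj
        rw [hF.arr 1 (by decide), hF₁.arr 1 (by decide)]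
        simp [initialMemory, hj]
      have hn2 : u.1 < n := u.2
      refine Runs.cons (R := fun τ c => τ.reg 6 = u ∧ τ.reg 7 = off u ∧ τ.reg 9 = off (u + 1) ∧
        τ.reg 10 = par u ∧ c = 5) ?_ ?_
      · refine Runs.of_wp ?_
        simp only [Prog.block, Prog.wp, Memory.setReg_reg, Memory.setReg_arr, reduceIte,
          Nat.reduceEqDiff, ← hu, hst.arr_ord u hul, e2, hoff u u.2.le, hoff (u + 1) u.2,
          hst.arr_par u hul]
        exact ⟨by omega, trivial, trivial, trivial, trivial, by norm_num⟩
      rintro τ₁ d₁ hG₁ ⟨g6, g7, g9, g10, hd₁⟩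
      refine Runs.cons (runs_neighbors ht hadj hpr hd hpar hW hq hi hu
        (hst.congr (hG₁.reg 5 (by decide)) fun A hA => hG₁.arr A (by revert A; decide))
        (by rw [hG₁.reg 2 (by decide), e2]) g6 g7 g9 g10
        (by rwa [hG₁.arr 1 (by decide)])) ?_
      rintro τ₂ d₂ hG₂ ⟨⟨l', hq', hst'⟩, hd₂⟩
      have g4 : τ₂.reg 4 = σ'.reg 4 := by rw [hG₂.reg 4 (by decide), hG₁.reg 4 (by decide)]
      have g2 : τ₂.reg 2 = 1 := by rw [hG₂.reg 2 (by decide), hG₁.reg 2 (by decide), e2]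
      have g5 : τ₁.reg 5 = σ'.reg 5 := hG₁.reg 5 (by decide)
      have hlen := hq'.length_le
      have hlen' := hq'.le_length
      refine Runs.of_wp ?_
      simp only [Prog.block, Prog.wp, Memory.setReg_reg, reduceIte, Nat.reduceEqDiff, g4, g2]
      refine ⟨by omega, ⟨l', hq', hst'.congr ?_ fun A _ => rfl⟩, ?_⟩
      · simp [Memory.setReg_reg]
      · rw [g5] at hd₂
        push_cast
        linarith
    · rintro σ' c - ⟨l, hq, hst⟩ hge hc
      have hge' : ¬ σ'.reg 4 < σ'.reg 5 := hge
      rw [hst.count] at hge'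
      have h4 : σ'.reg 4 = l.length := le_antisymm hq.le_length (not_lt.1 hge')
      refine ⟨⟨l, h4 ▸ hq, hst⟩, ?_⟩
      have h1 : (σ'.reg 5 : ℝ) ≤ n := by rw [hst.count]; exact_mod_cast hq.length_le
      have h2 : (σ'.reg 4 : ℝ) ≤ n := by rw [h4]; exact_mod_cast hq.length_le
      have h3 : (0 : ℝ) ≤ σ₁.reg 5 := Nat.cast_nonneg _
      rw [h4₁] at hc
      push_cast at hc
      linarith
  · rintro σ₂ c₂ hF₂ ⟨⟨l, hq, hst⟩, hc₂⟩
    have hall := hq.mem_of_length_le (G := G) hd le_rfl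
    refine Runs.nil ⟨⟨fun v => l.idxOf v, fun v => ?_, ⟨hpr, hpar, fun a b hab => ?_,
      fun v hv => hq.idx_par v (hall v) hv⟩, ?_⟩, by linarith⟩
    · exact (List.idxOf_lt_length_of_mem (hall v)).trans_le hq.length_le
    · exact (List.idxOf_inj (hall a)).1 hab
    · refine ⟨?_, ?_, ?_, ?_, ?_, fun v => hst.arr_par v (hall v),
        fun v => hst.arr_ord v (hall v), fun v => hst.arr_pos v (hall v)⟩
      · rw [hF₂.reg 0 (by decide), hreg 0 (by simp)]; simp [initialMemory]
      · rw [hF₂.reg 1 (by decide), hreg 1 (by simp)]; simp [initialMemory]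
      · rw [hF₂.reg 2 (by decide), h2₁]
      · rw [hF₂.reg 14 (by decide), hreg 14 (by simp)]; simp [initialMemory]
      · rw [hF₂.cost 0 (by decide), hF₁.cost 0 (by decide)]; simp [initialMemory]

end Search

/-! ### The whole algorithm -/

section Main

/-- The program for the bounded cost problem: search the tree, start without sinks, and play rounds
until register `16` is `0`. -/
def sinkProg : Prog := .block [
  bfsProg,
  .for 4 0 (.store 6 4 0),
  .const 16 1,
  .loop (.ne 16 14) roundProg,
  .move 0 15]

variable {W : ℕ} {t : ℕ → ℝ} {n k : ℕ} {T : ℝ≥0} {G : SimpleGraph (Fin n)}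
  {f : Finset (Fin n) → Fin n → ℝ≥0∞} {off adj : ℕ → ℕ} {Y : ℝ}

/-- Each round adds `1` to the number of sinks plus the number of dead sinks, which is at most `2 k`
before the round; this bounds the number of rounds. -/
theorem runs_sinkProg (ht : ∀ m, 0 ≤ t m) (hG : G.IsTree) (hf : IsMinmaxMonotone G f)
    (hadj : IsAdjacencyList G off adj) (hW : n * n + 2 * n + k + 2 ≤ W)
    (hY : ∀ l : List ℕ, (∀ m ∈ l, 0 < m) → l.sum = n → (l.map t).sum ≤ Y) (hY0 : 0 ≤ Y) :
    Runs W (OneSinkOracle G f) t sinkProg (initialMemory n k T off adj) fun σ c =>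
      IsSolution G f k T σ ∧
      c ≤ (2 * k + 1) * ((33 * n + Y + 15) * Nat.clog 2 n + 60 * n + Y + 41) + 27 * n + 10 := by
  have hn : 0 < n := by
    have := hG.connected.nonempty
    exact Fin.pos (Classical.arbitrary (Fin n))
  have hW₁ : 2 * n + 2 ≤ W := by omega
  have hW₂ : k + 1 ≤ W := by omega
  set r : Fin n := ⟨0, hn⟩ with hr
  obtain ⟨par, hpr, hd, hpar⟩ := hG.exists_parent r
  refine Runs.cons (runs_bfsProg ht hadj hpr hd hpar (by omega) rfl) ?_
  rintro σ₁ c₁ hF₁ ⟨⟨pos, hpos, hroot, hE₁⟩, hc₁⟩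
  have hreg₁ : ∀ x ∈ [15, 17], σ₁.reg x = 0 := by
    intro x hx
    rw [hF₁.reg x (by revert x; decide)]
    have : x ≠ 0 ∧ x ≠ 1 := by revert x; decide
    simp [initialMemory, this]
  refine Runs.cons (R := fun σ' c => (∀ v : Fin n, σ'.arr 6 v = n) ∧ c ≤ 3 * n + 2) ?_ ?_
  · refine Runs.for ht (M := n) (fun j σ' => ∀ v : Fin n, (v : ℕ) < j → σ'.arr 6 v = n)
      (fun _ => 1) (fun _ => by norm_num) (by decide) (by decide) (by decide) (by decide)
      (by decide) hE₁.reg_n hE₁.one (by omega) (by simp) ?_ ?_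
    · intro j σ' hj hF hi hI
      have hE' := hE₁.frame hF (by decide) (by decide) (by decide)
      apply Runs.of_wp
      simp only [Prog.wp, Memory.setReg_arr, Memory.setArr_arr, if_true, hi, hE'.reg_n]
      refine ⟨fun v hv => ?_, by norm_num⟩
      rw [Function.update_apply]
      split_ifs with h
      · rfl
      · exact hI v (by omega)
    · intro σ' c hF hI hc
      refine ⟨fun v => hI v v.2, hc.trans ?_⟩
      simp; linarith
  rintro σ₂ c₂ hF₂ ⟨hfl₂, hc₂⟩
  have hE₂ := hE₁.frame hF₂ (by decide) (by decide) (by decide)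
  refine Runs.cons (R := fun σ' c => σ'.reg 16 = 1 ∧ c = 1)
    ⟨_, _, .const σ₂ 16 1 (by omega), by simp [Memory.setReg], rfl⟩ ?_
  rintro σ₃ c₃ hF₃ ⟨h16, hc₃⟩
  have hE₃ := hE₂.frame hF₃ (by decide) (by decide) (by decide)
  have hfl₃ : ∀ v : Fin n, σ₃.arr 6 v = n := by rwa [hF₃.arr 6 (by decide)]
  have hreg₃ : ∀ x ∈ [15, 17], σ₃.reg x = 0 := by
    intro x hx
    rw [hF₃.reg x (by revert x; decide), hF₂.reg x (by revert x; decide), hreg₁ x hx]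
  have hnone : sinkCount pos (fun _ => n) = 0 := by
    rw [sinkCount, Finset.card_eq_zero, Finset.filter_eq_empty_iff]
    exact fun v _ => not_le.2 (hpos v)
  set R : ℝ := (33 * n + Y + 15) * Nat.clog 2 n + 60 * n + Y + 41 with hR
  have hR0 : 0 ≤ R := by positivity
  have hmeas : ∀ fl : Fin n → ℕ, sinkCount pos fl ≤ k →
      ((sinkCount pos fl + deadCount pos fl : ℕ) : ℝ) ≤ 2 * k := by
    intro fl hk
    have := deadCount_le_sinkCount pos fl
    exact_mod_cast (by omega : sinkCount pos fl + deadCount pos fl ≤ 2 * k)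
  refine Runs.cons (R := fun σ' c => IsAnswer G f k T σ' ∧ c ≤ (2 * k + 1) * R + 1) ?_ ?_
  · refine Runs.loop ht
      (fun σ' => (σ'.reg 16 = 0 ∧ IsAnswer G f k T σ') ∨ (σ'.reg 16 = 1 ∧ ∃ fl : Fin n → ℕ,
        (∀ v : Fin n, σ'.arr 6 v = fl v) ∧ GreedyInv G r par pos f T fl ∧
        σ'.reg 17 = sinkCount pos fl ∧ sinkCount pos fl ≤ k ∧ σ'.reg 15 = 0))
      (fun σ' => if σ'.reg 16 = 0 then 0 else
        R * (2 * k + 1 - (sinkCount pos (fun v : Fin n => σ'.arr 6 v) +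
          deadCount pos (fun v : Fin n => σ'.arr 6 v) : ℕ))) ?_ ?_ ?_ ?_
    · exact .inr ⟨h16, _, hfl₃, .initial hpos fun _ => rfl,
        by rw [hnone, hreg₃ 17 (by simp)], by omega, hreg₃ 15 (by simp)⟩
    · rintro σ' (⟨h0, -⟩ | ⟨h1, fl, hfl, -, -, hk, -⟩)
      · rw [if_pos h0]
      · rw [if_neg (by omega), funext hfl]
        have := hmeas fl hk
        exact mul_nonneg hR0 (by linarith)
    · rintro σ' hF hI hb
      have hE' := hE₃.frame hF (by decide) (by decide) (by decide)
      have hb' : σ'.reg 16 ≠ 0 := by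
        have h : σ'.reg 16 ≠ σ'.reg 14 := hb
        rwa [hE'.zero] at h
      obtain ⟨h1, fl, hfl, hinv, h17, hk, h15⟩ := hI.resolve_left fun h => hb' h.1
      obtain ⟨σ'', c, hex, hpost, hc⟩ := runs_roundProg ht hroot hpos rfl hf hW₁ hW₂
        hY hY0 hE' hfl hinv h17 hk h15
      refine ⟨σ'', c, hex, ?_⟩
      have hc' : c + 1 ≤ R := by linarith
      rw [if_neg hb', funext hfl]
      have hm := hmeas fl hk
      rcases hpost with ⟨h0, hans⟩ | ⟨h0, fl', hfl', hinv', h17', hk', h15', hsum⟩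
      · refine ⟨.inl ⟨h0, hans⟩, ?_⟩
        rw [if_pos h0]
        nlinarith
      · refine ⟨.inr ⟨by omega, fl', hfl', hinv', h17', hk', h15'⟩, ?_⟩
        rw [if_neg (by omega), funext hfl', hsum]
        push_cast
        linarith
    · rintro σ' c hF hI hb hc
      have hE' := hE₃.frame hF (by decide) (by decide) (by decide)
      have hb' : σ'.reg 16 = 0 := by
        by_contra h
        exact hb (show σ'.reg 16 ≠ σ'.reg 14 by rwa [hE'.zero])
      have hans : IsAnswer G f k T σ' := by
        rcases hI with h | h
        · exact h.2
        · omega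
      refine ⟨hans, hc.trans ?_⟩
      rw [if_pos hb', if_neg (by omega)]
      have : (0 : ℝ) ≤ (sinkCount pos (fun v : Fin n => σ₃.arr 6 v) +
          deadCount pos (fun v : Fin n => σ₃.arr 6 v) : ℕ) := Nat.cast_nonneg _
      nlinarith
  · rintro σ₄ c₄ - ⟨hans, hc₄⟩
    refine Runs.of_wp ?_
    simp only [Prog.block, Prog.wp]
    refine ⟨?_, by linarith⟩
    rcases hans with ⟨h1, h2⟩ | ⟨h1, h2⟩
    · exact .inl ⟨by rw [Memory.setReg_reg, if_pos rfl, h1], h2⟩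
    · exact .inr ⟨by rw [Memory.setReg_reg, if_pos rfl, h1], h2⟩

theorem length_le_sum {l : List ℕ} (hl : ∀ m ∈ l, 0 < m) : l.length ≤ l.sum := by
  induction l with
  | nil => simp
  | cons a l ih =>
    have h1 := hl a List.mem_cons_self
    have h2 := ih fun m hm => hl m (List.mem_cons_of_mem _ hm)
    rw [List.length_cons, List.sum_cons]
    omega

theorem AsymptoticallySubadditive.sum_le_mul (ht : AsymptoticallySubadditive t) {l : List ℕ}
    (hl : ∀ m ∈ l, 0 < m) (hn : l.sum = n) : (l.map t).sum ≤ n * t n := by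
  have h1 : (l.map t).sum ≤ (l.map t).length • t n := by
    refine List.sum_le_card_nsmul _ _ fun x hx => ?_
    obtain ⟨m, hm, rfl⟩ := List.mem_map.1 hx
    exact ht.mono (hn ▸ List.single_le_sum (fun _ _ => Nat.zero_le _) m hm)
  rw [List.length_map, nsmul_eq_mul] at h1
  have h2 : (l.length : ℝ) ≤ n := by exact_mod_cast hn ▸ length_le_sum hl
  exact h1.trans (mul_le_mul_of_nonneg_right h2 (ht.nonneg n))

theorem AsymptoticallySubadditive.exists_linear (ht : AsymptoticallySubadditive t) :
    ∃ (C : ℝ) (N : ℕ), 0 ≤ C ∧ ∀ n, N ≤ n → (n : ℝ) ≤ C * t n := by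
  obtain ⟨C, hC, h⟩ := ht.linear.exists_nonneg
  obtain ⟨N, hN⟩ := Filter.eventually_atTop.1 h.bound
  refine ⟨C, N, hC, fun n hn => ?_⟩
  simpa [abs_of_nonneg (ht.nonneg n)] using hN n hn

theorem clog_two_le (hn : 2 ≤ n) : (Nat.clog 2 n : ℝ) ≤ 4 * Real.log n := by
  have hlog2 := Real.log_two_gt_d9
  have hlog : Real.log 2 ≤ Real.log n := Real.log_le_log (by norm_num) (by exact_mod_cast hn)
  have h1 : (2 : ℝ) ^ (Nat.clog 2 n - 1) ≤ n := by
    exact_mod_cast (Nat.pow_pred_clog_lt_self (b := 2) (by norm_num) (by omega)).le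
  have h2 := Real.log_le_log (by positivity) h1
  rw [Real.log_pow] at h2
  have h3 : (Nat.clog 2 n : ℝ) ≤ (Nat.clog 2 n - 1 : ℕ) + 1 := by
    exact_mod_cast (by omega : Nat.clog 2 n ≤ Nat.clog 2 n - 1 + 1)
  have h4 : (0 : ℝ) ≤ (Nat.clog 2 n - 1 : ℕ) := Nat.cast_nonneg _
  nlinarith

theorem theorem2 :
    ∃ (prog : Prog) (d : ℕ), ∀ t : ℕ → ℝ, AsymptoticallySubadditive t →
      ∃ (C : ℝ) (N : ℕ), ∀ (n k : ℕ) (T : ℝ≥0) (G : SimpleGraph (Fin n))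
        (f : Finset (Fin n) → Fin n → ℝ≥0∞) (off adj : ℕ → ℕ),
        G.IsTree → 1 ≤ k → IsMinmaxMonotone G f → IsAdjacencyList G off adj →
        ∃ (σ : Memory) (c : ℝ),
          Exec ((n + k + 2) ^ d) (OneSinkOracle G f) t prog (initialMemory n k T off adj) σ c ∧
          IsSolution G f k T σ ∧
          (N ≤ n → c ≤ C * (k * t n * Real.log n)) := by
  refine ⟨sinkProg, 2, fun t ht => ?_⟩
  obtain ⟨A, N₀, hA0, hA⟩ := ht.exists_linear
  obtain ⟨B, N₁, hB⟩ := ht.subadd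
  refine ⟨3 * (4 * (48 * A + |B|) + 2 * (101 * A + |B|)) + 2 * 37 * A, max 2 (max N₀ N₁),
    fun n k T G f off adj hG hk hf hadj => ?_⟩
  have hW : n * n + 2 * n + k + 2 ≤ (n + k + 2) ^ 2 := by nlinarith
  by_cases hn : max 2 (max N₀ N₁) ≤ n
  · obtain ⟨hn2, hn0, hn1⟩ : 2 ≤ n ∧ N₀ ≤ n ∧ N₁ ≤ n := by simpa using hn
    have ht0 := ht.nonneg n
    obtain ⟨σ, c, h1, h2, h3⟩ := runs_sinkProg (T := T) ht.nonneg hG hf hadj hW (Y := |B| * t n)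
      (fun l hl hs => (hB l hl (hs ▸ hn1)).trans (by
        rw [hs]; exact mul_le_mul_of_nonneg_right (le_abs_self B) ht0)) (by positivity)
    refine ⟨σ, c, h1, h2, fun _ => h3.trans ?_⟩
    have hnA := hA n hn0
    have hn1' : (1 : ℝ) ≤ n := by exact_mod_cast (by omega : 1 ≤ n)
    have hk' : (1 : ℝ) ≤ k := by exact_mod_cast hk
    have hclog := clog_two_le hn2
    have hlog : 1 ≤ 2 * Real.log n := by
      have h := Real.log_two_gt_d9
      have h' : Real.log 2 ≤ Real.log n := Real.log_le_log (by norm_num) (by exact_mod_cast hn2)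
      linarith
    set L := Real.log n
    have hB0 := abs_nonneg B
    have hAt : 0 ≤ A * t n := by positivity
    have hBt : 0 ≤ |B| * t n := by positivity
    -- a round takes time `O(t n * log n)`
    have e1 : (33 * n + |B| * t n + 15) * (Nat.clog 2 n : ℝ) ≤
        (48 * A + |B|) * t n * (4 * L) :=
      mul_le_mul (by nlinarith) hclog (by positivity) (by positivity)
    have e2 : 60 * n + |B| * t n + 41 ≤ (101 * A + |B|) * t n * (2 * L) := by
      have : 60 * n + |B| * t n + 41 ≤ (101 * A + |B|) * t n := by nlinarith
      exact this.trans (le_mul_of_one_le_right (by positivity) hlog)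
    have e3 : (27 * n + 10 : ℝ) ≤ 37 * A * t n * (2 * L) * k := by
      have h : (27 * n + 10 : ℝ) ≤ 37 * A * t n := by nlinarith
      exact (h.trans (le_mul_of_one_le_right (by positivity) hlog)).trans
        (le_mul_of_one_le_right (by positivity) hk')
    have e4 : (2 * (k : ℝ) + 1) * ((33 * n + |B| * t n + 15) * Nat.clog 2 n + 60 * n +
        |B| * t n + 41) ≤ (3 * k) * ((48 * A + |B|) * t n * (4 * L) +
          (101 * A + |B|) * t n * (2 * L)) :=
      mul_le_mul (by linarith) (by linarith) (by positivity) (by positivity)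
    linarith
  · obtain ⟨σ, c, h1, h2, -⟩ := runs_sinkProg (T := T) ht.nonneg hG hf hadj hW (Y := n * t n)
      (fun l hl hs => ht.sum_le_mul hl hs) (mul_nonneg (Nat.cast_nonneg n) (ht.nonneg n))
    exact ⟨σ, c, h1, h2, fun h => absurd h hn⟩

end Main
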